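/- A 3-form $\varphi$ on a real 7-dimensional vector space $V$ is called positive if there are an inner product $g_\varphi$ on $V$ and a volume form $\operatorname{dvol}_\varphi$ of $g_\varphi$ (for one of the two orientations of $V$) with $$\tfrac16\,\iota_X\varphi\wedge\iota_Y\varphi\wedge\varphi=g_\varphi(X,Y)\operatorname{dvol}_\varphi\qquad\text{for all }X,Y\in V;$$ these are then unique, so a positive 3-form induces a metric, an orientation and a Hodge star $*_\varphi$. A smooth 3-form $\varphi$ on $S^7$ is called positive if it is positive at every point, and its $G_2$-Laplacian is $\Delta_\varphi\varphi=*_\varphi d*_\varphi d\varphi-d*_\varphi d*_\varphi\varphi$, the Hodge Laplacian of the metric induced by $\varphi$ applied to $\varphi$. Let $G$ be one of the following groups with its standard transitive action on $S^7$: $SU(4)$ acting on the unit sphere of $\mathbb{C}^4$; $Spin(7)$ acting through the real 8-dimensional spin representation on the unit sphere of $\mathbb{R}^8$ (the unit octonions); or $(Sp(2)\times Sp(1))/\mathbb{Z}_2$ acting on the unit sphere of $\mathbb{H}^2$ by $(A,q)\cdot v=Avq^{-1}$. Then the map $\varphi\mapsto\Delta_\varphi\varphi$ is a bijection of the set of positive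 $G$-invariant 3-forms on $S^7$ onto itself, and it preserves orientation: for every positive $G$-invariant 3-form $\varphi$, the forms $\varphi$ and $\Delta_\varphi\varphi$ induce the same orientation of $S^7$. Consequently, for every positive $G$-invariant 3-form $\mu$ on $S^7$ there is a unique positive $G$-invariant 3-form $\varphi$ with $\Delta_\varphi\varphi=\mu$. -/

import Mathlib

open Set Metric Quaternion
open scoped ContDiff RealInnerProductSpace Matrix

noncomputable section

/-! ## Multilinear algebra of 3-forms on a 7-dimensional space -/

section Linear

variable {V : Type*} [NormedAddCommGroup V] [NormedSpace ℝ V]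

/-- The wedge product of real-valued alternating forms (sum over shuffles). -/
def wedge {k l : ℕ} (a : V [⋀^Fin k]→ₗ[ℝ] ℝ) (b : V [⋀^Fin l]→ₗ[ℝ] ℝ) :
    V [⋀^Fin (k + l)]→ₗ[ℝ] ℝ :=
  ((LinearMap.mul' ℝ ℝ).compAlternatingMap (a.domCoprod b)).domDomCongr finSumFinEquiv

/-- The 7-form `(1/6) (ι_X φ ∧ ι_Y φ ∧ φ)`; here `φ.curryLeft X` is the interior product. -/
def bryantForm (φ : V [⋀^Fin 3]→L[ℝ] ℝ) (X Y : V) : V [⋀^Fin 7]→ₗ[ℝ] ℝ :=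
  (1 / 6 : ℝ) • wedge (wedge (φ.curryLeft X).toAlternatingMap (φ.curryLeft Y).toAlternatingMap)
    φ.toAlternatingMap

/-- `b` is a basis that is orthonormal for the bilinear form `g`. -/
def IsOrthonormalBasis (g : V →ₗ[ℝ] V →ₗ[ℝ] ℝ) (b : Module.Basis (Fin 7) ℝ V) : Prop :=
  ∀ i j, g (b i) (b j) = if i = j then 1 else 0

/-- `g` is an inner product, `vol` is the volume form of `g` for one of the two orientations, and
`(1/6) ι_X φ ∧ ι_Y φ ∧ φ = g(X, Y) vol` for all `X` and `Y`. -/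
structure Induces (φ : V [⋀^Fin 3]→L[ℝ] ℝ) (g : V →ₗ[ℝ] V →ₗ[ℝ] ℝ)
    (vol : V [⋀^Fin 7]→L[ℝ] ℝ) : Prop where
  symm : ∀ X Y, g X Y = g Y X
  pos : ∀ X, X ≠ 0 → 0 < g X X
  vol_eq : ∀ b : Module.Basis (Fin 7) ℝ V, IsOrthonormalBasis g b → |vol b| = 1
  eq : ∀ X Y, bryantForm φ X Y = g X Y • vol.toAlternatingMap

/-- A 3-form is positive if it induces an inner product. -/
def IsPositive (φ : V [⋀^Fin 3]→L[ℝ] ℝ) : Prop := ∃ g vol, Induces φ g vol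

open Classical in
/-- The inner product `g_φ` of a positive 3-form (it is unique), and `0` for other 3-forms. -/
def inducedMetric (φ : V [⋀^Fin 3]→L[ℝ] ℝ) : V →ₗ[ℝ] V →ₗ[ℝ] ℝ :=
  if h : IsPositive φ then h.choose else 0

open Classical in
/-- The volume form `dvol_φ` of a positive 3-form (it is unique), and `0` for other 3-forms. -/
def inducedVolume (φ : V [⋀^Fin 3]→L[ℝ] ℝ) : V [⋀^Fin 7]→L[ℝ] ℝ :=
  if h : IsPositive φ then h.choose_spec.choose else 0

/-- `contract w η = η(w 0, …, w (k - 1), ·)`. -/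
def contract {m : ℕ} : {k : ℕ} → (Fin k → V) → V [⋀^Fin (m + k)]→L[ℝ] ℝ → V [⋀^Fin m]→L[ℝ] ℝ
  | 0, _, η => η
  | _ + 1, w, η => contract (Fin.tail w) (η.curryLeft (w 0))

open Classical in
/-- The Hodge star on `k`-forms of the 7-dimensional space `V` for the inner product `g` and the
volume form `vol`: for any `g`-orthonormal basis `b`,
`(⋆α)(v₁, …, v_m) = (1/k!) ∑_I α(b_{I 0}, …, b_{I (k-1)}) vol(b_{I 0}, …, b_{I (k-1)}, v₁, …, v_m)`
where `I` runs over all multi-indices. The value does not depend on the choice of `b`. -/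
def hodgeStar {k m : ℕ} (hkm : 7 = m + k) (g : V →ₗ[ℝ] V →ₗ[ℝ] ℝ) (vol : V [⋀^Fin 7]→L[ℝ] ℝ)
    (α : V [⋀^Fin k]→L[ℝ] ℝ) : V [⋀^Fin m]→L[ℝ] ℝ :=
  if h : ∃ b : Module.Basis (Fin 7) ℝ V, IsOrthonormalBasis g b then
    (1 / (k.factorial : ℝ)) •
      ∑ I : Fin k → Fin 7, α (h.choose ∘ I) • contract (h.choose ∘ I) (hkm ▸ vol)
  else 0

end Linear

/-! ## Differential forms on the unit sphere -/

section Sphere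

variable {E : Type*} [NormedAddCommGroup E] [InnerProductSpace ℝ E]

/-- The tangent space of the unit sphere at `x`: the orthogonal complement of `x`. -/
abbrev Tan (x : sphere (0 : E) 1) : Submodule ℝ E := (ℝ ∙ (x : E))ᗮ

variable (E) in
/-- A (not necessarily smooth) differential `k`-form on the unit sphere of `E`. -/
abbrev SphereForm (k : ℕ) : Type _ := ∀ x : sphere (0 : E) 1, Tan x [⋀^Fin k]→L[ℝ] ℝ

/-- The radial projection `y ↦ y / ‖y‖` onto the unit sphere. -/
def radial (y : E) (hy : y ≠ 0) : sphere (0 : E) 1 :=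
  ⟨‖y‖⁻¹ • y, by simp [norm_smul, hy]⟩

/-- The derivative of the radial projection at `y ≠ 0`: orthogonal projection to the complement
of `y`, divided by `‖y‖`. -/
def radialDeriv (y : E) (hy : y ≠ 0) : E →L[ℝ] Tan (radial y hy) :=
  ‖y‖⁻¹ • (Tan (radial y hy)).orthogonalProjectionOnto

open Classical in
/-- The pullback of a form on the sphere to `E ∖ {0}` under the radial projection (with value `0`
at the origin). -/
def radialExtend {k : ℕ} (η : SphereForm E k) (y : E) : E [⋀^Fin k]→L[ℝ] ℝ :=
  if hy : y ≠ 0 then (η (radial y hy)).compContinuousLinearMap (radialDeriv y hy) else 0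

/-- A form on the sphere is smooth if and only if its pullback under the (smooth, submersive)
radial projection is smooth on `E ∖ {0}`. -/
def IsSmoothForm {k : ℕ} (η : SphereForm E k) : Prop :=
  ContDiffOn ℝ ∞ (radialExtend η) {0}ᶜ

/-- The exterior derivative on the sphere. The radial projection restricts to the identity of the
sphere, so `dη` is the restriction to the sphere of the exterior derivative of the pullback. -/
def sphereD {k : ℕ} (η : SphereForm E k) : SphereForm E (k + 1) := fun x =>
  (extDeriv (radialExtend η) (x : E)).compContinuousLinearMap (Tan x).subtypeL

/-- The action of a linear isometry on points of the sphere. -/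
def spherePt (f : E ≃ₗᵢ[ℝ] E) (x : sphere (0 : E) 1) : sphere (0 : E) 1 :=
  ⟨f x, by simp⟩

/-- The derivative of the action of a linear isometry on the sphere. -/
def sphereDeriv (f : E ≃ₗᵢ[ℝ] E) (x : sphere (0 : E) 1) : Tan x →L[ℝ] Tan (spherePt f x) :=
  ((f.toContinuousLinearEquiv : E →L[ℝ] E).comp (Tan x).subtypeL).codRestrict _ (fun v => by
    have hv := Submodule.mem_orthogonal_singleton_iff_inner_right.1 v.2
    exact Submodule.mem_orthogonal_singleton_iff_inner_right.2
      ((f.inner_map_map (x : E) (v : E)).trans hv))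

/-- The pullback of a form on the sphere under a linear isometry. -/
def spherePullback {k : ℕ} (f : E ≃ₗᵢ[ℝ] E) (η : SphereForm E k) : SphereForm E k := fun x =>
  (η (spherePt f x)).compContinuousLinearMap (sphereDeriv f x)

/-- The Hodge star `⋆_φ` of a positive 3-form `φ` on the 7-sphere, from `k`-forms to `m`-forms,
`m + k = 7`. -/
def sphereStar (φ : SphereForm E 3) (k m : ℕ) (hkm : 7 = m + k) (α : SphereForm E k) :
    SphereForm E m := fun x =>
  hodgeStar hkm (inducedMetric (φ x)) (inducedVolume (φ x)) (α x)

/-- The Hodge Laplacian `Δ_φ = ⋆d⋆d - d⋆d⋆` on 3-forms, for the metric and the orientation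
induced by `φ`. -/
def hodgeLaplacian (φ ψ : SphereForm E 3) : SphereForm E 3 :=
  sphereStar φ 4 3 rfl (sphereD (sphereStar φ 4 3 rfl (sphereD ψ))) -
    sphereD (sphereStar φ 5 2 rfl (sphereD (sphereStar φ 3 4 rfl ψ)))

/-- The `G₂`-Laplacian `φ ↦ Δ_φ φ`. -/
def g2Laplacian (φ : SphereForm E 3) : SphereForm E 3 := hodgeLaplacian φ φ

/-- The positive smooth 3-forms on the unit sphere that are invariant under `G`. -/
def positiveInvariantForms (G : Subgroup (E ≃ₗᵢ[ℝ] E)) : Set (SphereForm E 3) :=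
  {φ | IsSmoothForm φ ∧ (∀ x, IsPositive (φ x)) ∧ ∀ f ∈ G, spherePullback f φ = φ}

/-- Two positive 3-forms induce the same orientation: their volume forms are positive multiples
of each other at each point. -/
def SameOrientation (φ ψ : SphereForm E 3) : Prop :=
  ∀ x, ∃ c : ℝ, 0 < c ∧ inducedVolume (ψ x) = c • inducedVolume (φ x)

/-- A norm-preserving linear action as a homomorphism to the group of linear isometries. -/
def isometricAction {G : Type*} [Group G] (ρ : G →* (E →ₗ[ℝ] E)) (h : ∀ g x, ‖ρ g x‖ = ‖x‖) :
    G →* (E ≃ₗᵢ[ℝ] E) where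
  toFun g :=
    { toLinearEquiv := LinearEquiv.ofLinearMap (ρ g) (ρ g⁻¹)
        (by rw [← Module.End.mul_eq_comp, ← map_mul]; simp; rfl)
        (by rw [← Module.End.mul_eq_comp, ← map_mul]; simp; rfl)
      norm_map' := h g }
  map_one' := by ext x; simp
  map_mul' g g' := by ext x; exact congrArg (fun L : E →ₗ[ℝ] E => L x) (map_mul ρ g g')

end Sphere

/-! ## The group `SU(4)` acting on the unit sphere of `ℂ⁴` -/

abbrev C4 : Type := EuclideanSpace ℂ (Fin 4)

def su4Rep : Matrix.specialUnitaryGroup (Fin 4) ℂ →* (C4 →ₗ[ℝ] C4) where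
  toFun A :=
    { toFun := fun v => WithLp.toLp 2 ((A : Matrix (Fin 4) (Fin 4) ℂ) *ᵥ v.ofLp)
      map_add' := fun v w => by ext i; simp [Matrix.mulVec_add]
      map_smul' := fun c v => by ext i; simp [Matrix.mulVec_smul] }
  map_one' := by ext v i; simp
  map_mul' A B := by ext v i; simp [Matrix.mulVec_mulVec]

theorem su4Rep_norm (A : Matrix.specialUnitaryGroup (Fin 4) ℂ) (v : C4) : ‖su4Rep A v‖ = ‖v‖ := by
  have hA : (A : Matrix (Fin 4) (Fin 4) ℂ)ᴴ * (A : Matrix (Fin 4) (Fin 4) ℂ) = 1 :=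
    Matrix.mem_unitaryGroup_iff'.1 (Matrix.mem_specialUnitaryGroup_iff.1 A.2).1
  have key : ∀ w : C4, ((‖w‖ ^ 2 : ℝ) : ℂ) = star w.ofLp ⬝ᵥ w.ofLp := fun w => by
    rw [EuclideanSpace.norm_sq_eq]
    simp [dotProduct, ← Complex.normSq_eq_conj_mul_self, Complex.normSq_eq_norm_sq]
  have h2 : ((‖su4Rep A v‖ ^ 2 : ℝ) : ℂ) = ((‖v‖ ^ 2 : ℝ) : ℂ) := by
    rw [key, key]
    change star ((A : Matrix (Fin 4) (Fin 4) ℂ) *ᵥ v.ofLp) ⬝ᵥ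
      ((A : Matrix (Fin 4) (Fin 4) ℂ) *ᵥ v.ofLp) = _
    rw [Matrix.star_mulVec, ← Matrix.dotProduct_mulVec, Matrix.mulVec_mulVec, hA,
      Matrix.one_mulVec]
  exact (sq_eq_sq₀ (norm_nonneg _) (norm_nonneg _)).1 (Complex.ofReal_injective h2)

/-- `SU(4)` as a group of isometries of `ℂ⁴`. -/
def SU4 : Subgroup (C4 ≃ₗᵢ[ℝ] C4) := (isometricAction su4Rep su4Rep_norm).range

/-! ## The group `(Sp(2) × Sp(1)) / ℤ₂` acting on the unit sphere of `ℍ²` -/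

abbrev H2 : Type := PiLp 2 (fun _ : Fin 2 => ℍ)

/-- `Sp(2)`: quaternionic `2 × 2` matrices `A` with `A A* = A* A = 1`. -/
abbrev Sp2 : Submonoid (Matrix (Fin 2) (Fin 2) ℍ) := unitary (Matrix (Fin 2) (Fin 2) ℍ)

/-- `Sp(1)`: unit quaternions. -/
abbrev Sp1 : Submonoid ℍ := unitary ℍ

/-- `(A, q)` acts on column vectors `v` by `v ↦ A v q⁻¹`. -/
def sp2sp1Rep : Sp2 × Sp1 →* (H2 →ₗ[ℝ] H2) where
  toFun p :=
    { toFun := fun v => WithLp.toLp 2 (fun i =>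
        ((p.1 : Matrix (Fin 2) (Fin 2) ℍ) *ᵥ v.ofLp) i * star (p.2 : ℍ))
      map_add' := fun v w => by ext1 i; simp [Matrix.mulVec_add, add_mul]
      map_smul' := fun c v => by ext1 i; simp [Matrix.mulVec_smul] }
  map_one' := by ext1 v; ext1 i; simp
  map_mul' p q := by
    ext1 v
    ext1 i
    have h : ∀ (A : Matrix (Fin 2) (Fin 2) ℍ) (w : Fin 2 → ℍ) (c : ℍ),
        (A *ᵥ fun j => w j * c) i = (A *ᵥ w) i * c := fun A w c => by
      simp [Matrix.mulVec, dotProduct, mul_assoc, add_mul]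
    change (((p.1 : Matrix (Fin 2) (Fin 2) ℍ) * (q.1 : Matrix (Fin 2) (Fin 2) ℍ)) *ᵥ v.ofLp) i *
      star ((p.2 : ℍ) * (q.2 : ℍ)) = ((p.1 : Matrix (Fin 2) (Fin 2) ℍ) *ᵥ fun j =>
        ((q.1 : Matrix (Fin 2) (Fin 2) ℍ) *ᵥ v.ofLp) j * star (q.2 : ℍ)) i * star (p.2 : ℍ)
    rw [h, ← Matrix.mulVec_mulVec, star_mul, mul_assoc]

theorem sp2sp1Rep_norm (p : Sp2 × Sp1) (v : H2) : ‖sp2sp1Rep p v‖ = ‖v‖ := by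
  have hA : (p.1 : Matrix (Fin 2) (Fin 2) ℍ)ᴴ * (p.1 : Matrix (Fin 2) (Fin 2) ℍ) = 1 :=
    (Unitary.mem_iff.1 p.1.2).1
  have hq : ‖star (p.2 : ℍ)‖ = 1 := by
    rw [Quaternion.norm_star]
    exact CStarRing.norm_of_mem_unitary p.2.2
  have key : ∀ w : Fin 2 → ℍ, ((∑ i, ‖w i‖ ^ 2 : ℝ) : ℍ) = star w ⬝ᵥ w := fun w => by
    simp [dotProduct, Quaternion.star_mul_self, Quaternion.normSq_eq_norm_mul_self, sq]
  have h2 : ‖sp2sp1Rep p v‖ ^ 2 = ‖v‖ ^ 2 := by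
    rw [PiLp.norm_sq_eq_of_L2, PiLp.norm_sq_eq_of_L2]
    change ∑ i, ‖((p.1 : Matrix (Fin 2) (Fin 2) ℍ) *ᵥ v.ofLp) i * star (p.2 : ℍ)‖ ^ 2 = _
    simp_rw [norm_mul, hq, mul_one]
    apply Quaternion.coe_injective (R := ℝ)
    rw [key, key v.ofLp, Matrix.star_mulVec, ← Matrix.dotProduct_mulVec, Matrix.mulVec_mulVec, hA,
      Matrix.one_mulVec]
  exact (sq_eq_sq₀ (norm_nonneg _) (norm_nonneg _)).1 h2

/-- The image of `Sp(2) × Sp(1)` in the isometries of `ℍ²`. The kernel of the action is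
`{(1, 1), (-1, -1)}`, so this is the group `(Sp(2) × Sp(1)) / ℤ₂`. -/
def Sp2Sp1 : Subgroup (H2 ≃ₗᵢ[ℝ] H2) := (isometricAction sp2sp1Rep sp2sp1Rep_norm).range

/-! ## The group `Spin(7)` acting on the unit sphere of the octonions -/

/-- The octonions as pairs of quaternions. -/
abbrev Oct : Type := WithLp 2 (ℍ × ℍ)

theorem oct_ext {x y : Oct} (h₁ : x.fst = y.fst) (h₂ : x.snd = y.snd) : x = y :=
  WithLp.ofLp_injective 2 (Prod.ext h₁ h₂)

/-- The imaginary octonions, a 7-dimensional Euclidean space. -/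
def ImOct : Submodule ℝ Oct where
  carrier := {a | a.fst.re = 0}
  add_mem' := fun {a b} ha hb => by
    simp only [mem_ofPred_eq] at ha hb ⊢; simp [ha, hb]
  zero_mem' := by simp
  smul_mem' := fun c a ha => by
    simp only [mem_ofPred_eq] at ha ⊢; simp [ha]

/-- Left multiplication in the octonions by an imaginary octonion, for the Cayley–Dickson product
`(a, b) (c, d) = (a c - d* b, d a + b c*)`. -/
def octMul : ImOct →ₗ[ℝ] (Oct →ₗ[ℝ] Oct) :=
  LinearMap.mk₂ ℝ (fun (x : ImOct) (y : Oct) => WithLp.toLp 2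
      ((x : Oct).fst * y.fst - star y.snd * (x : Oct).snd,
        y.snd * (x : Oct).fst + (x : Oct).snd * star y.fst))
    (fun x x' y => by refine oct_ext ?_ ?_ <;> ext <;> simp <;> ring)
    (fun c x y => by refine oct_ext ?_ ?_ <;> ext <;> simp <;> ring)
    (fun x y y' => by refine oct_ext ?_ ?_ <;> ext <;> simp <;> ring)
    (fun c x y => by refine oct_ext ?_ ?_ <;> ext <;> simp <;> ring)

/-- The negative definite quadratic form `a ↦ -‖a‖²` on the imaginary octonions. -/
def octForm : QuadraticForm ℝ ImOct := -(LinearMap.BilinMap.toQuadraticMap (innerₗ ImOct))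

theorem octMul_sq (a : ImOct) :
    octMul a * octMul a = algebraMap ℝ (Module.End ℝ Oct) (octForm a) := by
  have ha : (a : Oct).fst.re = 0 := a.2
  have hn : octForm a = -(Quaternion.normSq (a : Oct).fst + Quaternion.normSq (a : Oct).snd) := by
    change -⟪(a : Oct), (a : Oct)⟫ = _
    rw [WithLp.prod_inner_apply]
    rfl
  rw [hn]
  refine LinearMap.ext fun x => ?_
  rw [Module.algebraMap_end_apply]
  refine oct_ext ?_ ?_ <;> ext <;> simp [octMul, Quaternion.normSq_def', ha] <;> ring

/-- The Clifford algebra acts on the octonions; `a` acts by left multiplication. -/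
def cliffordRep : CliffordAlgebra octForm →ₐ[ℝ] Module.End ℝ Oct :=
  CliffordAlgebra.lift octForm ⟨octMul, octMul_sq⟩

/-- The spin representation of `Spin(7)` on the octonions. -/
def spin7Rep : spinGroup octForm →* (Oct →ₗ[ℝ] Oct) :=
  (cliffordRep : CliffordAlgebra octForm →* Module.End ℝ Oct).comp (spinGroup octForm).subtype

theorem spin7Rep_norm (s : spinGroup octForm) (x : Oct) : ‖spin7Rep s x‖ = ‖x‖ := by
  have adj : ∀ (c : CliffordAlgebra octForm) (x y : Oct),
      ⟪cliffordRep c x, y⟫ = ⟪x, cliffordRep (star c) y⟫ := fun c => by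
    induction c using CliffordAlgebra.induction with
    | algebraMap r =>
      intro x y
      rw [CliffordAlgebra.star_algebraMap]
      simp [AlgHom.commutes, inner_smul_left, inner_smul_right]
    | ι a =>
      intro x y
      have ha : (a : Oct).fst.re = 0 := a.2
      rw [CliffordAlgebra.star_ι]
      simp [cliffordRep, octMul, Quaternion.inner_def, ha]
      ring
    | mul c c' h h' => intro x y; simp [h, h']
    | add c c' h h' => intro x y; simp [h, h', inner_add_left, inner_add_right]
  have hs : star (s : CliffordAlgebra octForm) * (s : CliffordAlgebra octForm) = 1 :=
    spinGroup.star_mul_self_of_mem s.2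
  have h2 : ⟪spin7Rep s x, spin7Rep s x⟫ = ⟪x, x⟫ := by
    change ⟪cliffordRep s x, cliffordRep s x⟫ = ⟪x, x⟫
    rw [adj, ← Module.End.mul_apply, ← map_mul, hs]
    simp
  rw [real_inner_self_eq_norm_sq, real_inner_self_eq_norm_sq] at h2
  exact (sq_eq_sq₀ (norm_nonneg _) (norm_nonneg _)).1 h2

/-- `Spin(7)` as a group of isometries of the octonions. -/
def Spin7 : Subgroup (Oct ≃ₗᵢ[ℝ] Oct) := (isometricAction spin7Rep spin7Rep_norm).range

end

/-!
Each of the three groups acts transitively on the sphere, so an invariant form is determined by its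
value at one point, which is any form fixed by the isotropy group (`SU(3)`, `G₂` or
`Sp(1) × Sp(1)`). Elements of the isotropy group that permute a frame up to signs already cut the
3-forms down to a space of dimension 3, 1 or 2 (`su4_rigid`, `spin7_rigid`, `sp2_rigid`), and all of
it is realized by restrictions of invariant polynomial forms on the ambient 8-dimensional space:
`su4Form`, `spin7Form`, `sp2Form`. Their smoothness and exterior derivative are computed in the
ambient space (`isSmoothForm_restrict`, `sphereD_restrict`). `InvariantFamily` collects these facts.

At the base point, rescaling a frame brings a positive member of the family to the standard
components `g2Tensor`. A finite evaluation of the 7-form `(1/6) ι_X φ ∧ ι_Y φ ∧ φ` (`bryantSum`)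
shows that such a frame is orthonormal and oriented (`induces_of_g2Tensor`), and that the remaining
members are not positive (`not_isPositive_of_frame`). By invariance `⋆_φ d` maps the family to
itself, by a linear map that depends only on the scales of the frame (`su4_star`, `spin7_star`,
`sp2_star`). This linear map is invertible, so `φ = ⋆_φ dψ` for an invariant `ψ`; then
`⋆_φ φ = dψ` is closed, the second term of the Laplacian vanishes, and `Δ_φ φ = ⋆_φ d ⋆_φ d φ`
(`InvariantFamily.g2Laplacian_eq`).

It remains to study an explicit map of the parameters:

* `SU(4)`: `(a, z) ↦ (16 a³ |z|^(-8/3), 16 |z|^(4/3) a⁻² z)` on `a ≠ 0`, `z ≠ 0`;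
* `Spin(7)`: `c ↦ 16 c^(1/3)` on `c ≠ 0`;
* `Sp(2) × Sp(1)`: in the coordinates `a = τ³`, `b = m τ³`, with `τ ≠ 0` and `m > 0`, the map sends
  `(a, b)` to `τ (24 (1 + m) / m²) · (1, m / (1 + m) + m² / 6)`.

The first two are bijective by taking roots. In the third, the ratio of the components is an
increasing function of `m` with range `(0, ∞)` and determines `m`, after which the first component
determines `τ`. The frames that are standard for `φ` and for `Δ_φ φ` differ by positive factors
(`exists_inducedVolume_smul`), so the orientations agree.
-/

noncomputable section

open Equiv

/-! ### The wedge product as an alternating sum -/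

section Wedge
variable {V : Type*} [NormedAddCommGroup V] [NormedSpace ℝ V]

/-- The wedge product, which `wedge` defines through shuffles, as a sum over all permutations. -/
theorem factorial_smul_wedge {k l : ℕ} (a : V [⋀^Fin k]→ₗ[ℝ] ℝ) (b : V [⋀^Fin l]→ₗ[ℝ] ℝ)
    (v : Fin (k + l) → V) :
    ((k.factorial * l.factorial : ℕ) : ℝ) * wedge a b v =
      ∑ σ : Perm (Fin (k + l)), (Perm.sign σ : ℝ) *
        (a (fun i => v (σ (Fin.castAdd l i))) * b (fun i => v (σ (Fin.natAdd k i)))) := by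
  have h := MultilinearMap.domCoprod_alternization_eq a b
  have h2 := congrArg (fun F : V [⋀^Fin k ⊕ Fin l]→ₗ[ℝ] TensorProduct ℝ ℝ ℝ =>
    LinearMap.mul' ℝ ℝ (F (fun i => v (finSumFinEquiv i)))) h
  simp only [Fintype.card_fin] at h2
  have h3 : LinearMap.mul' ℝ ℝ (((k.factorial * l.factorial) • a.domCoprod b)
      (fun i => v (finSumFinEquiv i))) =
      ((k.factorial * l.factorial : ℕ) : ℝ) * wedge a b v := by
    rw [AlternatingMap.smul_apply, map_nsmul, nsmul_eq_mul]
    rfl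
  rw [← h3, ← h2, MultilinearMap.alternatization_apply, map_sum]
  refine Fintype.sum_equiv (Equiv.permCongr finSumFinEquiv) _ _ fun σ => ?_
  rw [Equiv.Perm.sign_permCongr]
  have : ∀ (u : ℤˣ) (t : TensorProduct ℝ ℝ ℝ),
      LinearMap.mul' ℝ ℝ (u • t) = ((u : ℤ) : ℝ) * LinearMap.mul' ℝ ℝ t := by
    intro u t
    rw [Units.smul_def, map_zsmul, zsmul_eq_mul]
  rw [this]
  simp [MultilinearMap.domDomCongr_apply, MultilinearMap.domCoprod_apply, Equiv.permCongr_apply]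

/-- Antisymmetrizing over the first `m` of `m + l` variables before antisymmetrizing over all of
them only contributes the factor `m!`. -/
theorem sum_sign_sum_sign {m l : ℕ} (F : Perm (Fin (m + l)) → ℝ) :
    ∑ σ : Perm (Fin (m + l)), (Perm.sign σ : ℝ) * ∑ τ : Perm (Fin m), (Perm.sign τ : ℝ) *
      F (σ * finSumFinEquiv.permCongr (Perm.sumCongr τ 1)) =
    m.factorial * ∑ σ : Perm (Fin (m + l)), (Perm.sign σ : ℝ) * F σ := by
  simp_rw [Finset.mul_sum]
  rw [Finset.sum_comm]
  have : ∀ τ : Perm (Fin m), ∑ σ : Perm (Fin (m + l)), (Perm.sign σ : ℝ) * ((Perm.sign τ : ℝ) *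
      F (σ * finSumFinEquiv.permCongr (Perm.sumCongr τ 1))) =
      ∑ σ : Perm (Fin (m + l)), (Perm.sign σ : ℝ) * F σ := by
    intro τ
    refine Fintype.sum_equiv (Equiv.mulRight (finSumFinEquiv.permCongr (Perm.sumCongr τ 1)))
      _ _ fun σ => ?_
    rw [Equiv.coe_mulRight, Perm.sign_mul, Equiv.Perm.sign_permCongr, Perm.sign_sumCongr]
    simp [mul_assoc]
  rw [Finset.sum_congr rfl fun τ _ => this τ]
  simp [Fintype.card_perm, ← Finset.mul_sum]

theorem bryantForm_apply (φ : V [⋀^Fin 3]→L[ℝ] ℝ) (X Y : V) (v : Fin 7 → V) :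
    144 * bryantForm φ X Y v = ∑ σ : Perm (Fin 7), (Perm.sign σ : ℝ) *
      (φ ![X, v (σ 0), v (σ 1)] * φ ![Y, v (σ 2), v (σ 3)] * φ ![v (σ 4), v (σ 5), v (σ 6)]) := by
  set α := (φ.curryLeft X).toAlternatingMap
  set β := (φ.curryLeft Y).toAlternatingMap
  have h1 := factorial_smul_wedge (wedge α β) φ.toAlternatingMap v
  have h2 : ∀ w, wedge α β w = (1 / 4) * ∑ σ : Perm (Fin (2 + 2)), (Perm.sign σ : ℝ) *
        (α (fun i => w (σ (Fin.castAdd 2 i))) * β (fun i => w (σ (Fin.natAdd 2 i)))) := by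
    intro w
    rw [← factorial_smul_wedge α β w]
    norm_num [Nat.factorial]
    ring
  have h3 := sum_sign_sum_sign (m := 2 + 2) (l := 3) fun σ =>
    φ ![X, v (σ 0), v (σ 1)] * φ ![Y, v (σ 2), v (σ 3)] * φ ![v (σ 4), v (σ 5), v (σ 6)]
  have h4 : bryantForm φ X Y v = (1 / 6) * wedge (wedge α β) φ.toAlternatingMap v := by
    rw [bryantForm, AlternatingMap.smul_apply, smul_eq_mul]
  have h5 : (((2 + 2).factorial * Nat.factorial 3 : ℕ) : ℝ) = 144 := by norm_num [Nat.factorial]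
  rw [h5] at h1
  have h6 : (((2 + 2).factorial : ℕ) : ℝ) = 24 := by norm_num [Nat.factorial]
  rw [h6] at h3
  have key : 4 * (144 * wedge (wedge α β) φ.toAlternatingMap v) =
    24 * ∑ σ : Perm (Fin 7), (Perm.sign σ : ℝ) *
      (φ ![X, v (σ 0), v (σ 1)] * φ ![Y, v (σ 2), v (σ 3)] * φ ![v (σ 4), v (σ 5), v (σ 6)]) := by
    refine Eq.trans ?_ h3
    rw [h1, Finset.mul_sum]
    refine Finset.sum_congr rfl fun σ _ => ?_
    rw [h2, ← mul_assoc, ← mul_assoc, ← mul_assoc, mul_comm 4, mul_assoc, mul_assoc, mul_assoc]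
    congr 1
    have : ∀ x y : ℝ, 4 * (1 / 4 * (x * y)) = x * y := by
      intros; ring
    rw [this, Finset.sum_mul]
    refine Finset.sum_congr rfl fun τ _ => ?_
    rw [mul_assoc]
    congr 2
    · congr 1
      · change φ _ = φ _
        congr 1
        funext i
        fin_cases i <;> rfl
      · change φ _ = φ _
        congr 1
        funext i
        fin_cases i <;> rfl
    · change φ _ = φ _
      congr 1
      funext i
      fin_cases i <;> rfl
  rw [h4]
  linarith

end Wedge

/-! ### Evaluation of alternating sums over permutations -/

section AlternatingSum

/-- The sum of `± F [v (σ (n-1)), …, v (σ 0)] ++ pre` over all permutations `σ`, computed by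
recursion, where the branches whose prefix is declared `dead` are pruned. -/
def prunedAltSum {α : Type*} (dead : List α → Bool) (F : List α → ℤ) :
    (n : ℕ) → (Fin n → α) → List α → ℤ
  | 0, _, pre => F pre
  | n + 1, v, pre => if dead pre then 0 else
      ∑ p : Fin (n + 1), (if p = 0 then 1 else -1) *
        prunedAltSum dead F n (fun i => v (swap 0 p i.succ)) (v p :: pre)

theorem sum_sign_eq_prunedAltSum {α : Type*} (dead : List α → Bool) (F : List α → ℤ)
    (hd : ∀ pre l, dead pre → F (l ++ pre) = 0) (n : ℕ) (v : Fin n → α) (pre : List α) :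
    ∑ σ : Perm (Fin n), (Perm.sign σ : ℤ) * F ((List.ofFn (v ∘ σ)).reverse ++ pre) =
      prunedAltSum dead F n v pre := by
  induction n generalizing pre with
  | zero => simp [prunedAltSum]
  | succ n ih =>
    rw [prunedAltSum]
    split_ifs with h
    · exact Finset.sum_eq_zero fun σ _ => by rw [hd _ _ h, mul_zero]
    · rw [← Equiv.sum_comp Perm.decomposeFin.symm, Fintype.sum_prod_type]
      refine Finset.sum_congr rfl fun p _ => ?_
      rw [← ih, Finset.mul_sum]
      refine Finset.sum_congr rfl fun e _ => ?_
      rw [Perm.decomposeFin.symm_sign, List.ofFn_succ]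
      simp only [Function.comp_apply, Perm.decomposeFin_symm_apply_zero,
        Perm.decomposeFin_symm_apply_succ, List.reverse_cons, List.append_assoc,
        List.singleton_append]
      rw [← mul_assoc]
      congr 1
      split_ifs <;> simp

/-- For a 3-form with integer components `c` in a frame `e`: 144 times the value of
`(1/6) ι_{e i} φ ∧ ι_{e j} φ ∧ φ` on the frame. -/
def bryantSum (c : Fin 7 → Fin 7 → Fin 7 → ℤ) (i j : Fin 7) : ℤ :=
  prunedAltSum
    (fun
      | [b, a] => c i a b == 0
      | [q, p, b, a] => c i a b * c j p q == 0
      | _ => false)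
    (fun
      | [z, y, x, q, p, b, a] => c i a b * c j p q * c x y z
      | _ => 0) 7 id []

theorem bryantSum_eq (c : Fin 7 → Fin 7 → Fin 7 → ℤ) (i j : Fin 7) :
    bryantSum c i j = ∑ σ : Perm (Fin 7), (Perm.sign σ : ℤ) *
      (c i (σ 0) (σ 1) * c j (σ 2) (σ 3) * c (σ 4) (σ 5) (σ 6)) := by
  rw [bryantSum, ← sum_sign_eq_prunedAltSum]
  · rfl
  · intro pre l h
    split at h
    · rename_i b a
      have h : c i a b = 0 := by simpa using h
      split
      · rename_i heq
        have := congrArg List.reverse heq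
        simp at this
        obtain ⟨rfl, rfl, -⟩ := this
        simp [h]
      · rfl
    · rename_i q p b a
      have h : c i a b * c j p q = 0 := by simpa using h
      split
      · rename_i heq
        have := congrArg List.reverse heq
        simp at this
        obtain ⟨rfl, rfl, rfl, rfl, -⟩ := this
        rw [h, zero_mul]
      · rfl
    · simp at h

/-- The components of the elementary 3-form `e^{abc}`. -/
def elem3 (a b c i j k : Fin 7) : ℤ :=
  if i = a ∧ j = b ∧ k = c ∨ i = b ∧ j = c ∧ k = a ∨ i = c ∧ j = a ∧ k = b then 1
  else if i = a ∧ j = c ∧ k = b ∨ i = c ∧ j = b ∧ k = a ∨ i = b ∧ j = a ∧ k = c then -1 else 0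

/-- The components of the standard positive 3-form
`e^{012} + e^{034} + e^{056} + e^{135} - e^{146} - e^{236} - e^{245}`. -/
def g2Tensor (i j k : Fin 7) : ℤ :=
  elem3 0 1 2 i j k + elem3 0 3 4 i j k + elem3 0 5 6 i j k + elem3 1 3 5 i j k
    - elem3 1 4 6 i j k - elem3 2 3 6 i j k - elem3 2 4 5 i j k

theorem bryantSum_g2Tensor (i j : Fin 7) :
    bryantSum g2Tensor i j = if i = j then 144 else 0 := by
  revert i j
  decide +kernel

end AlternatingSum

/-! ### Positive 3-forms -/

section Positive
variable {V : Type*} [NormedAddCommGroup V] [NormedSpace ℝ V]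

theorem bryantForm_frame (φ : V [⋀^Fin 3]→L[ℝ] ℝ) (b : Fin 7 → V) (c : Fin 7 → Fin 7 → Fin 7 → ℤ)
    (h : ∀ i j k, φ ![b i, b j, b k] = c i j k) (i j : Fin 7) :
    144 * bryantForm φ (b i) (b j) b = bryantSum c i j := by
  rw [bryantForm_apply, bryantSum_eq]
  push_cast
  simp only [h]

theorem map_smul_three (φ : V [⋀^Fin 3]→L[ℝ] ℝ) (r s t : ℝ) (x y z : V) :
    φ ![r • x, s • y, t • z] = r * s * t * φ ![x, y, z] := by
  have := φ.map_smul_univ ![r, s, t] ![x, y, z]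
  rw [Fin.prod_univ_three] at this
  rw [show (![r • x, s • y, t • z] : Fin 3 → V) = fun i => ![r, s, t] i • ![x, y, z] i from by
    funext i; fin_cases i <;> rfl]
  exact this

theorem bryantForm_add_left (φ : V [⋀^Fin 3]→L[ℝ] ℝ) (X X' Y : V) :
    bryantForm φ (X + X') Y = bryantForm φ X Y + bryantForm φ X' Y := by
  ext v
  have h : ∀ u w : V, φ ![X + X', u, w] = φ ![X, u, w] + φ ![X', u, w] := fun u w => by
    have := congrArg (fun F : V [⋀^Fin 2]→L[ℝ] ℝ => F ![u, w]) (φ.curryLeft.map_add X X')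
    exact this
  have e := bryantForm_apply φ (X + X') Y v
  have e1 := bryantForm_apply φ X Y v
  have e2 := bryantForm_apply φ X' Y v
  simp only [h, add_mul, mul_add, Finset.sum_add_distrib] at e
  rw [AlternatingMap.add_apply]
  linarith

theorem bryantForm_smul_left (φ : V [⋀^Fin 3]→L[ℝ] ℝ) (r : ℝ) (X Y : V) :
    bryantForm φ (r • X) Y = r • bryantForm φ X Y := by
  ext v
  have h : ∀ u w : V, φ ![r • X, u, w] = r * φ ![X, u, w] := fun u w => by
    have := congrArg (fun F : V [⋀^Fin 2]→L[ℝ] ℝ => F ![u, w]) (φ.curryLeft.map_smul r X)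
    exact this
  have e := bryantForm_apply φ (r • X) Y v
  have e1 := bryantForm_apply φ X Y v
  simp only [h] at e
  rw [AlternatingMap.smul_apply, smul_eq_mul]
  have : (144:ℝ) * (r * bryantForm φ X Y v) = r * (144 * bryantForm φ X Y v) := by ring
  rw [← mul_right_inj' (show (144:ℝ) ≠ 0 by norm_num), this, e1, e, Finset.mul_sum]
  exact Finset.sum_congr rfl fun σ _ => by ring

theorem bryantForm_add_right (φ : V [⋀^Fin 3]→L[ℝ] ℝ) (X Y Y' : V) :
    bryantForm φ X (Y + Y') = bryantForm φ X Y + bryantForm φ X Y' := by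
  ext v
  have h : ∀ u w : V, φ ![Y + Y', u, w] = φ ![Y, u, w] + φ ![Y', u, w] := fun u w => by
    have := congrArg (fun F : V [⋀^Fin 2]→L[ℝ] ℝ => F ![u, w]) (φ.curryLeft.map_add Y Y')
    exact this
  have e := bryantForm_apply φ X (Y + Y') v
  have e1 := bryantForm_apply φ X Y v
  have e2 := bryantForm_apply φ X Y' v
  simp only [h, add_mul, mul_add, Finset.sum_add_distrib] at e
  rw [AlternatingMap.add_apply]
  linarith

theorem bryantForm_smul_right (φ : V [⋀^Fin 3]→L[ℝ] ℝ) (r : ℝ) (X Y : V) :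
    bryantForm φ X (r • Y) = r • bryantForm φ X Y := by
  ext v
  have h : ∀ u w : V, φ ![r • Y, u, w] = r * φ ![Y, u, w] := fun u w => by
    have := congrArg (fun F : V [⋀^Fin 2]→L[ℝ] ℝ => F ![u, w]) (φ.curryLeft.map_smul r Y)
    exact this
  have e := bryantForm_apply φ X (r • Y) v
  have e1 := bryantForm_apply φ X Y v
  simp only [h] at e
  rw [AlternatingMap.smul_apply, smul_eq_mul]
  have : (144:ℝ) * (r * bryantForm φ X Y v) = r * (144 * bryantForm φ X Y v) := by ring
  rw [← mul_right_inj' (show (144:ℝ) ≠ 0 by norm_num), this, e1, e, Finset.mul_sum]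
  exact Finset.sum_congr rfl fun σ _ => by ring

/-- `bryantForm φ` as a bilinear map. -/
def bryantBilin (φ : V [⋀^Fin 3]→L[ℝ] ℝ) : V →ₗ[ℝ] V →ₗ[ℝ] V [⋀^Fin 7]→ₗ[ℝ] ℝ :=
  LinearMap.mk₂ ℝ (bryantForm φ) (bryantForm_add_left φ) (bryantForm_smul_left φ)
    (bryantForm_add_right φ) (bryantForm_smul_right φ)

theorem bryantForm_comp {W : Type*} [NormedAddCommGroup W] [NormedSpace ℝ W]
    (φ : W [⋀^Fin 3]→L[ℝ] ℝ) (L : V →L[ℝ] W) (X Y : V) :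
    bryantForm (φ.compContinuousLinearMap L) X Y =
      (bryantForm φ (L X) (L Y)).compLinearMap (L : V →ₗ[ℝ] W) := by
  ext v
  rw [← mul_right_inj' (show (144:ℝ) ≠ 0 by norm_num), bryantForm_apply,
    AlternatingMap.compLinearMap_apply, bryantForm_apply]
  refine Finset.sum_congr rfl fun σ _ => ?_
  have : ∀ x y z : V, φ.compContinuousLinearMap L ![x, y, z] = φ ![L x, L y, L z] := fun x y z =>
    congrArg φ (by funext i; fin_cases i <;> rfl)
  simp [this]

/-- The bilinear form for which the basis `b` is orthonormal. -/
def basisMetric (b : Module.Basis (Fin 7) ℝ V) : V →ₗ[ℝ] V →ₗ[ℝ] ℝ :=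
  b.constr ℝ fun i => b.coord i

theorem basisMetric_apply (b : Module.Basis (Fin 7) ℝ V) (X Y : V) :
    basisMetric b X Y = ∑ i, b.repr X i * b.repr Y i := by
  simp [basisMetric, Module.Basis.constr_apply_fintype]

theorem basisMetric_orthonormal (b : Module.Basis (Fin 7) ℝ V) :
    IsOrthonormalBasis (basisMetric b) b := fun i j => by
  rw [basisMetric_apply]
  simp [Finsupp.single_apply]

theorem IsOrthonormalBasis.metric_eq {g : V →ₗ[ℝ] V →ₗ[ℝ] ℝ} {b : Module.Basis (Fin 7) ℝ V}
    (h : IsOrthonormalBasis g b) : g = basisMetric b :=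
  b.ext fun i => b.ext fun j => by rw [h, basisMetric_orthonormal]

theorem map_swap_left (φ : V [⋀^Fin 3]→L[ℝ] ℝ) (x y z : V) : φ ![y, x, z] = -φ ![x, y, z] := by
  refine Eq.trans ?_ (φ.toAlternatingMap.map_swap ![x, y, z] (show (0 : Fin 3) ≠ 1 by decide))
  change φ _ = φ _
  congr 1; funext i; fin_cases i <;> rfl

theorem map_swap_right (φ : V [⋀^Fin 3]→L[ℝ] ℝ) (x y z : V) : φ ![x, z, y] = -φ ![x, y, z] := by
  refine Eq.trans ?_ (φ.toAlternatingMap.map_swap ![x, y, z] (show (1 : Fin 3) ≠ 2 by decide))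
  change φ _ = φ _
  congr 1; funext i; fin_cases i <;> rfl

/-- The components of a 3-form in a frame are determined by those with increasing indices. -/
theorem tensor_eq_of_sorted (φ : V [⋀^Fin 3]→L[ℝ] ℝ) {n : ℕ} (b : Fin n → V)
    (c : Fin n → Fin n → Fin n → ℝ)
    (c₁ : ∀ i j k, c j i k = -c i j k) (c₂ : ∀ i j k, c i k j = -c i j k)
    (h : ∀ i j k, i < j → j < k → φ ![b i, b j, b k] = c i j k) (i j k : Fin n) :
    φ ![b i, b j, b k] = c i j k := by
  have s₁ := map_swap_left φ
  have s₂ := map_swap_right φ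
  have z₁ : ∀ x z : V, φ ![x, x, z] = 0 := fun x z => by linarith [s₁ x x z]
  have z₂ : ∀ x z : V, φ ![x, z, z] = 0 := fun x z => by linarith [s₂ x z z]
  have z₃ : ∀ x z : V, φ ![z, x, z] = 0 := fun x z => by linarith [s₁ x z z, z₂ x z]
  have d₁ : ∀ i k, c i i k = 0 := fun i k => by linarith [c₁ i i k]
  have d₂ : ∀ i k, c i k k = 0 := fun i k => by linarith [c₂ i k k]
  have d₃ : ∀ i k, c k i k = 0 := fun i k => by linarith [c₁ i k k, d₂ i k]
  rcases lt_trichotomy i j with h1 | rfl | h1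
  · rcases lt_trichotomy j k with h2 | rfl | h2
    · exact h i j k h1 h2
    · rw [z₂, d₂]
    · rcases lt_trichotomy i k with h3 | rfl | h3
      · rw [s₂, h i k j h3 h2, c₂, neg_neg]
      · rw [z₃, d₃]
      · rw [s₂, s₁, h k i j h3 h1, c₂ i k j, c₁ k i j]
  · rw [z₁, d₁]
  · rcases lt_trichotomy i k with h2 | rfl | h2
    · rw [s₁, h j i k h1 h2, c₁, neg_neg]
    · rw [z₃, d₃]
    · rcases lt_trichotomy j k with h3 | rfl | h3
      · rw [s₁, s₂, h j k i h3 h2, c₁ j i k, c₂ j k i]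
      · rw [z₂, d₂]
      · rw [s₁, s₂, s₁, h k j i h3 h1, c₁ j i k, c₂ j k i, c₁ k j i]

theorem ext_of_sorted {n : ℕ} (b : Module.Basis (Fin n) ℝ V) (φ : V [⋀^Fin 3]→L[ℝ] ℝ)
    (h : ∀ i j k, i < j → j < k → φ ![b i, b j, b k] = 0) : φ = 0 := by
  have h0 := tensor_eq_of_sorted φ b (fun _ _ _ => 0) (by simp) (by simp) h
  apply ContinuousAlternatingMap.toAlternatingMap_injective
  refine Module.Basis.ext_alternating b fun v _ => ?_
  refine Eq.trans ?_ (h0 (v 0) (v 1) (v 2))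
  change φ _ = φ _
  congr 1; funext i; fin_cases i <;> rfl

theorem ext_frame_seven (b : Module.Basis (Fin 7) ℝ V) {f g : V [⋀^Fin 7]→L[ℝ] ℝ}
    (h : f b = g b) : f = g := by
  apply ContinuousAlternatingMap.toAlternatingMap_injective
  rw [AlternatingMap.eq_smul_basis_det b f.toAlternatingMap,
    AlternatingMap.eq_smul_basis_det b g.toAlternatingMap]
  congr 1

/-- An alternating map on a finite-dimensional space, as a continuous alternating map. -/
def AlternatingMap.toContinuous [FiniteDimensional ℝ V] {n : ℕ} (f : V [⋀^Fin n]→ₗ[ℝ] ℝ) :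
    V [⋀^Fin n]→L[ℝ] ℝ :=
  { f with
    cont := by
      have b := Module.finBasis ℝ V
      have h : ∀ v : Fin n → V, f v = ∑ r : Fin n → Fin (Module.finrank ℝ V),
          (∏ i, b.coord (r i) (v i)) * f fun i => b (r i) := by
        intro v
        conv_lhs => rw [show v = fun i => ∑ j, b.coord j (v i) • b j from
          funext fun i => (b.sum_repr (v i)).symm]
        refine (f.toMultilinearMap.map_sum (fun i j => b.coord j (v i) • b j)).trans ?_
        refine Finset.sum_congr rfl fun r _ => ?_
        exact f.toMultilinearMap.map_smul_univ (fun i => b.coord (r i) (v i)) fun i => b (r i)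
      change Continuous fun v => f v
      rw [funext h]
      have hc : ∀ j, Continuous (b.coord j) := fun j => (b.coord j).continuous_of_finiteDimensional
      exact continuous_finsetSum _ fun r _ => (continuous_finsetProd _ fun i _ =>
        (hc (r i)).comp (continuous_apply i)).mul continuous_const
    map_eq_zero_of_eq' := f.map_eq_zero_of_eq' }

/-- A 3-form with the standard components in a basis is positive: that basis is orthonormal for
the induced metric and positively oriented. -/
theorem induces_of_g2Tensor [FiniteDimensional ℝ V] (φ : V [⋀^Fin 3]→L[ℝ] ℝ)
    (b : Module.Basis (Fin 7) ℝ V) (h : ∀ i j k, φ ![b i, b j, b k] = g2Tensor i j k) :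
    ∃ vol : V [⋀^Fin 7]→L[ℝ] ℝ, vol b = 1 ∧ Induces φ (basisMetric b) vol := by
  refine ⟨b.det.toContinuous, b.det_self, ?_, ?_, ?_, ?_⟩
  · intro X Y
    simp only [basisMetric_apply, mul_comm]
  · intro X hX
    rw [basisMetric_apply]
    obtain ⟨i, hi⟩ : ∃ i, b.repr X i ≠ 0 := by
      by_contra! h0
      exact hX (b.repr.map_eq_zero_iff.1 (Finsupp.ext h0))
    exact Finset.sum_pos' (fun i _ => mul_self_nonneg _)
      ⟨i, Finset.mem_univ _, mul_self_pos.2 hi⟩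
  · intro b' hb'
    change |b.det b'| = 1
    have hM : (b.toMatrix b')ᵀ * b.toMatrix b' = 1 := by
      ext i j
      rw [Matrix.mul_apply, Matrix.one_apply, ← hb' i j, basisMetric_apply]
      rfl
    have hd := congrArg Matrix.det hM
    rw [Matrix.det_mul, Matrix.det_transpose, Matrix.det_one] at hd
    rw [Module.Basis.det_apply, ← abs_one, ← sq_eq_sq_iff_abs_eq_abs]
    rw [sq, hd, one_pow]
  · intro X Y
    have key : bryantBilin φ = (basisMetric b).compr₂ (LinearMap.toSpanSingleton ℝ _ b.det) := by
      refine b.ext fun i => b.ext fun j => ?_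
      rw [bryantBilin, LinearMap.mk₂_apply, LinearMap.compr₂_apply,
        LinearMap.toSpanSingleton_apply]
      generalize hB : bryantForm φ (b i) (b j) = B
      rw [AlternatingMap.eq_smul_basis_det b B, basisMetric_orthonormal, ← hB]
      congr 1
      have := bryantForm_frame φ b g2Tensor h i j
      rw [bryantSum_g2Tensor] at this
      split_ifs at this ⊢ <;> push_cast at this <;> linarith
    exact congrArg (fun F : V →ₗ[ℝ] V →ₗ[ℝ] V [⋀^Fin 7]→ₗ[ℝ] ℝ => F X Y) key

/-- Every inner product on a 7-dimensional space has an orthonormal basis. -/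
theorem exists_isOrthonormalBasis (b : Module.Basis (Fin 7) ℝ V) (g : V →ₗ[ℝ] V →ₗ[ℝ] ℝ)
    (hs : ∀ X Y, g X Y = g Y X) (hp : ∀ X, X ≠ 0 → 0 < g X X) :
    ∃ b' : Module.Basis (Fin 7) ℝ V, IsOrthonormalBasis g b' := by
  have : FiniteDimensional ℝ V := Module.Finite.of_basis b
  have hsymm : LinearMap.IsSymm g := ⟨fun X Y => hs X Y⟩
  obtain ⟨v, hv⟩ := LinearMap.BilinForm.exists_orthogonal_basis hsymm
  have hd : Module.finrank ℝ V = 7 := by rw [Module.finrank_eq_card_basis b]; rfl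
  let v' := v.reindex (finCongr hd)
  have hv' : ∀ i j, i ≠ j → g (v' i) (v' j) = 0 := fun i j hij => by
    simp only [v', Module.Basis.reindex_apply]
    exact hv (fun h => hij ((finCongr hd).symm.injective h))
  have hpos : ∀ i, 0 < g (v' i) (v' i) := fun i => hp _ (v'.ne_zero i)
  have hne : ∀ i, √(g (v' i) (v' i)) ≠ 0 := fun i => (Real.sqrt_pos.2 (hpos i)).ne'
  refine ⟨v'.unitsSMul fun i => Units.mk0 (√(g (v' i) (v' i)))⁻¹ (inv_ne_zero (hne i)), ?_⟩
  intro i j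
  simp only [Module.Basis.unitsSMul_apply, Units.smul_mk0, map_smul, LinearMap.smul_apply,
    smul_eq_mul]
  split_ifs with h
  · subst h
    have := Real.mul_self_sqrt (hpos i).le
    field_simp
    rw [sq, this, div_self (hpos i).ne']
  · rw [hv' i j h, mul_zero, mul_zero]

/-- The 7-forms `(1/6) ι_X φ ∧ ι_X φ ∧ φ`, `X ≠ 0`, of a positive form all define the same
orientation. -/
theorem Induces.mul_pos {φ : V [⋀^Fin 3]→L[ℝ] ℝ} {g : V →ₗ[ℝ] V →ₗ[ℝ] ℝ}
    {vol : V [⋀^Fin 7]→L[ℝ] ℝ} (h : Induces φ g vol) (b : Module.Basis (Fin 7) ℝ V) {X Y : V}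
    (hX : X ≠ 0) (hY : Y ≠ 0) : 0 < bryantForm φ X X b * bryantForm φ Y Y b := by
  obtain ⟨b', hb'⟩ := exists_isOrthonormalBasis b g h.symm h.pos
  have hv : vol b ≠ 0 := fun h0 => by
    have : vol = 0 := ext_frame_seven b h0
    have h1 := h.vol_eq b' hb'
    simp [this] at h1
  rw [h.eq, h.eq]
  change 0 < (g X X * vol b) * (g Y Y * vol b)
  have := _root_.mul_pos (_root_.mul_pos (h.pos X hX) (h.pos Y hY)) (mul_self_pos.2 hv)
  linarith

/-- The metric and the volume form induced by a positive 3-form are unique. -/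
theorem Induces.unique {φ : V [⋀^Fin 3]→L[ℝ] ℝ} {g g' : V →ₗ[ℝ] V →ₗ[ℝ] ℝ}
    {vol vol' : V [⋀^Fin 7]→L[ℝ] ℝ} (b₀ : Module.Basis (Fin 7) ℝ V) (h : Induces φ g vol)
    (h' : Induces φ g' vol') : g = g' ∧ vol = vol' := by
  obtain ⟨b, hb⟩ := exists_isOrthonormalBasis b₀ g h.symm h.pos
  have e : ∀ X Y, g X Y * vol b = g' X Y * vol' b := fun X Y =>
    congrArg (fun F : V [⋀^Fin 7]→ₗ[ℝ] ℝ => F b) ((h.eq X Y).symm.trans (h'.eq X Y))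
  have hv := h.vol_eq b hb
  have hv0 : vol b ≠ 0 := fun h0 => by simp [h0] at hv
  -- `g' = c⁻¹ g` and `vol' = c vol` for a constant `c > 0`
  have e0 : vol b = g' (b 0) (b 0) * vol' b := by
    rw [← e, hb, if_pos rfl, one_mul]
  have hv0' : vol' b ≠ 0 := fun h0 => hv0 (by rw [e0, h0, mul_zero])
  set r := g' (b 0) (b 0) with hr
  have hrpos : 0 < r := h'.pos _ (b.ne_zero 0)
  have hg : ∀ X Y, g' X Y = r * g X Y := fun X Y => by
    have := e X Y
    rw [e0] at this
    have := mul_right_cancel₀ hv0' (show g' X Y * vol' b = (r * g X Y) * vol' b by linarith)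
    exact this
  have hs : (√r)⁻¹ ≠ 0 := inv_ne_zero (Real.sqrt_pos.2 hrpos).ne'
  have hsq : (√r)⁻¹ * (√r)⁻¹ * r = 1 := by
    rw [← mul_inv, Real.mul_self_sqrt hrpos.le, inv_mul_cancel₀ hrpos.ne']
  have h1 := h'.vol_eq (b.unitsSMul fun _ => Units.mk0 (√r)⁻¹ hs) (fun i j => by
    simp only [Module.Basis.unitsSMul_apply, Units.smul_mk0, map_smul, LinearMap.smul_apply,
      smul_eq_mul, hg, hb i j]
    split_ifs
    · linarith
    · simp)
  have h2 : vol' (b.unitsSMul fun _ => Units.mk0 (√r)⁻¹ hs) = (√r)⁻¹ ^ 7 * vol' b := by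
    have := vol'.map_smul_univ (fun _ => (√r)⁻¹) b
    rw [Finset.prod_const, Finset.card_univ, Fintype.card_fin] at this
    rw [smul_eq_mul] at this
    rw [← this]
    congr 1
    funext i
    simp [Module.Basis.unitsSMul_apply, Units.smul_mk0]
  rw [h2, abs_mul] at h1
  rw [e0, abs_mul] at hv
  set u := (√r)⁻¹ with hu
  have hupos : 0 < u := inv_pos.2 (Real.sqrt_pos.2 hrpos)
  rw [abs_of_pos hrpos] at hv
  rw [abs_of_pos (pow_pos hupos 7)] at h1
  have h3 : u ^ 9 = 1 := by
    have hne : |vol' b| ≠ 0 := abs_ne_zero.2 hv0'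
    have : u ^ 7 = r := mul_right_cancel₀ hne (h1.trans hv.symm)
    calc u ^ 9 = u * u * u ^ 7 := by ring
      _ = 1 := by rw [this, hsq]
  have hu1 : u = 1 := (pow_eq_one_iff_of_nonneg hupos.le (by norm_num)).1 h3
  have hr1 : r = 1 := by rw [hu1] at hsq; linarith
  refine ⟨?_, ext_frame_seven b (by rw [e0, hr1, one_mul])⟩
  ext X Y
  rw [hg, hr1, one_mul]

theorem Induces.inducedMetric_eq {φ : V [⋀^Fin 3]→L[ℝ] ℝ} {g : V →ₗ[ℝ] V →ₗ[ℝ] ℝ}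
    {vol : V [⋀^Fin 7]→L[ℝ] ℝ} (b : Module.Basis (Fin 7) ℝ V) (h : Induces φ g vol) :
    inducedMetric φ = g := by
  have hp : IsPositive φ := ⟨g, vol, h⟩
  rw [inducedMetric, dif_pos hp]
  exact (hp.choose_spec.choose_spec.unique b h).1

theorem Induces.inducedVolume_eq {φ : V [⋀^Fin 3]→L[ℝ] ℝ} {g : V →ₗ[ℝ] V →ₗ[ℝ] ℝ}
    {vol : V [⋀^Fin 7]→L[ℝ] ℝ} (b : Module.Basis (Fin 7) ℝ V) (h : Induces φ g vol) :
    inducedVolume φ = vol := by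
  have hp : IsPositive φ := ⟨g, vol, h⟩
  rw [inducedVolume, dif_pos hp]
  exact (hp.choose_spec.choose_spec.unique b h).2

/-- Induced metrics and volume forms are natural under linear isomorphisms. -/
theorem Induces.comp {W : Type*} [NormedAddCommGroup W] [NormedSpace ℝ W]
    {φ : W [⋀^Fin 3]→L[ℝ] ℝ} {g : W →ₗ[ℝ] W →ₗ[ℝ] ℝ}
    {vol : W [⋀^Fin 7]→L[ℝ] ℝ} (h : Induces φ g vol) (L : V →L[ℝ] W)
    (hL : Function.Bijective L) :
    Induces (φ.compContinuousLinearMap L) (g.compl₁₂ (L : V →ₗ[ℝ] W) (L : V →ₗ[ℝ] W))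
      (vol.compContinuousLinearMap L) where
  symm X Y := h.symm _ _
  pos X hX := h.pos _ fun h0 => hX (hL.1 (h0.trans (map_zero L).symm))
  vol_eq b hb := by
    refine Eq.trans ?_ (h.vol_eq (b.map (LinearEquiv.ofBijective (L : V →ₗ[ℝ] W) hL)) ?_)
    · change |vol _| = |vol _|
      congr 2
    · intro i j
      rw [← hb i j]
      simp
  eq X Y := by
    rw [bryantForm_comp, h.eq]
    rfl

end Positive

/-! ### The Hodge star in dimension seven -/

section Star
variable {V : Type*} [NormedAddCommGroup V] [NormedSpace ℝ V]

theorem contract_apply {m k : ℕ} (w : Fin k → V) (η : V [⋀^Fin (m + k)]→L[ℝ] ℝ) (v : Fin m → V) :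
    contract w η v = η fun i => Fin.append w v (Fin.cast (Nat.add_comm m k) i) := by
  induction k with
  | zero =>
    change η v = _
    congr 1
    funext i
    have : Fin.cast (Nat.add_comm m 0) i = Fin.natAdd 0 i := by ext; simp
    rw [this, Fin.append_right]
  | succ k ih =>
    change contract (Fin.tail w) (η.curryLeft (w 0)) v = _
    rw [ih, ContinuousAlternatingMap.curryLeft_apply_apply]
    congr 1
    funext i
    refine Fin.cases ?_ (fun j => ?_) i
    · have : Fin.cast (Nat.add_comm m (k + 1)) 0 = Fin.castAdd m (0 : Fin (k + 1)) := by
        ext; simp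
      rw [this, Fin.append_left]
      rfl
    · have h : ∀ l : Fin (k + m), ∀ h' : k + m + 1 = k + 1 + m,
          Fin.append w v (Fin.cast h' l.succ) = Fin.append (Fin.tail w) v l := by
        intro l h'
        refine Fin.addCases (fun a => ?_) (fun a => ?_) l
        · have : Fin.cast h' (Fin.castAdd m a).succ = Fin.castAdd m a.succ := by ext; simp
          rw [this, Fin.append_left, Fin.append_left]
          rfl
        · have : Fin.cast h' (Fin.natAdd k a).succ = Fin.natAdd (k + 1) a := by
            ext; simp; omega
          rw [this, Fin.append_right, Fin.append_right]
      exact (h (Fin.cast (Nat.add_comm m k) j) (by omega)).symm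

/-- The first `k` and the last `m` of seven indices. -/
def splitSeven {k m : ℕ} (hkm : 7 = m + k) : Fin k ⊕ Fin m ≃ Fin 7 :=
  finSumFinEquiv.trans (finCongr (by omega))

theorem contract_cast_apply {m k : ℕ} (hkm : 7 = m + k) (w : Fin k → V)
    (η : V [⋀^Fin 7]→L[ℝ] ℝ) (v : Fin m → V) :
    contract w (hkm ▸ η) v = η (Sum.elim w v ∘ (splitSeven hkm).symm) := by
  have h : ∀ (n : ℕ) (e : n = m + k) (η : V [⋀^Fin n]→L[ℝ] ℝ),
      contract w (e ▸ η) v =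
        η (Sum.elim w v ∘ (finSumFinEquiv.trans (finCongr (by omega : k + m = n))).symm) := by
    rintro n rfl η
    rw [contract_apply]
    congr 1
    funext i
    obtain ⟨x, rfl⟩ := (finSumFinEquiv.trans (finCongr (by omega : k + m = m + k))).surjective i
    rw [Function.comp_apply, Equiv.symm_apply_apply]
    rcases x with x | x
    · exact Fin.append_left w v x
    · exact Fin.append_right w v x
  exact h 7 hkm η

/-- The contraction of two multilinear maps over an orthonormal basis does not depend on the
basis. -/
theorem sum_orthonormal_indep {k : ℕ} {g : V →ₗ[ℝ] V →ₗ[ℝ] ℝ} {b b' : Module.Basis (Fin 7) ℝ V}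
    (hb : IsOrthonormalBasis g b) (hb' : IsOrthonormalBasis g b')
    (f h : MultilinearMap ℝ (fun _ : Fin k => V) ℝ) :
    ∑ I : Fin k → Fin 7, f (b ∘ I) * h (b ∘ I) = ∑ I : Fin k → Fin 7, f (b' ∘ I) * h (b' ∘ I) := by
  have hO : ∀ j l, ∑ i, b'.repr (b i) j * b'.repr (b i) l = if j = l then 1 else 0 := by
    have hM : b'.toMatrix b * (b'.toMatrix b)ᵀ = 1 := by
      rw [mul_eq_one_comm]
      ext i j
      rw [Matrix.mul_apply, Matrix.one_apply, ← hb i j, hb'.metric_eq, basisMetric_apply]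
      rfl
    intro j l
    have := congrFun (congrFun hM j) l
    rw [Matrix.mul_apply, Matrix.one_apply] at this
    exact this
  have hexp : ∀ (F : MultilinearMap ℝ (fun _ : Fin k => V) ℝ) (I : Fin k → Fin 7),
      F (b ∘ I) = ∑ J : Fin k → Fin 7, (∏ m, b'.repr (b (I m)) (J m)) * F (b' ∘ J) := by
    intro F I
    conv_lhs => rw [show b ∘ I = fun i => ∑ j, b'.repr (b (I i)) j • b' j from
      funext fun i => (b'.sum_repr (b (I i))).symm]
    refine (F.map_sum (fun i j => b'.repr (b (I i)) j • b' j)).trans ?_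
    refine Finset.sum_congr rfl fun r _ => ?_
    exact F.map_smul_univ (fun i => b'.repr (b (I i)) (r i)) fun i => b' (r i)
  have hprod : ∀ J K : Fin k → Fin 7, ∑ I : Fin k → Fin 7,
      (∏ m, b'.repr (b (I m)) (J m)) * ∏ m, b'.repr (b (I m)) (K m) = if J = K then 1 else 0 := by
    intro J K
    simp_rw [← Finset.prod_mul_distrib]
    rw [← Fintype.prod_sum fun m i => b'.repr (b i) (J m) * b'.repr (b i) (K m)]
    simp_rw [hO]
    rw [Finset.prod_ite_zero]
    simp [funext_iff]
  calc ∑ I : Fin k → Fin 7, f (b ∘ I) * h (b ∘ I)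
      = ∑ I : Fin k → Fin 7, ∑ J : Fin k → Fin 7, ∑ K : Fin k → Fin 7,
        ((∏ m, b'.repr (b (I m)) (J m)) * ∏ m, b'.repr (b (I m)) (K m)) *
          (f (b' ∘ J) * h (b' ∘ K)) := by
        refine Finset.sum_congr rfl fun I _ => ?_
        rw [hexp f, hexp h, Finset.sum_mul_sum]
        refine Finset.sum_congr rfl fun J _ => Finset.sum_congr rfl fun K _ => by ring
    _ = ∑ J : Fin k → Fin 7, ∑ K : Fin k → Fin 7, (if J = K then 1 else 0) *
          (f (b' ∘ J) * h (b' ∘ K)) := by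
        rw [Finset.sum_comm]
        refine Finset.sum_congr rfl fun J _ => ?_
        rw [Finset.sum_comm]
        refine Finset.sum_congr rfl fun K _ => ?_
        rw [← hprod, Finset.sum_mul]
    _ = _ := by simp

/-- The Hodge star, which `hodgeStar` defines through a chosen orthonormal basis, in terms of any
orthonormal basis. -/
theorem hodgeStar_apply {k m : ℕ} (hkm : 7 = m + k) {g : V →ₗ[ℝ] V →ₗ[ℝ] ℝ}
    (vol : V [⋀^Fin 7]→L[ℝ] ℝ) {b : Module.Basis (Fin 7) ℝ V} (hb : IsOrthonormalBasis g b)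
    (α : V [⋀^Fin k]→L[ℝ] ℝ) (v : Fin m → V) :
    hodgeStar hkm g vol α v = (1 / (k.factorial : ℝ)) * ∑ I : Fin k → Fin 7,
      α (b ∘ I) * vol (Sum.elim (b ∘ I) v ∘ (splitSeven hkm).symm) := by
  have hex : ∃ b : Module.Basis (Fin 7) ℝ V, IsOrthonormalBasis g b := ⟨b, hb⟩
  rw [hodgeStar, dif_pos hex]
  set b' := hex.choose with hb'
  let M : MultilinearMap ℝ (fun _ : Fin k => V) (MultilinearMap ℝ (fun _ : Fin m => V) ℝ) :=
    (vol.toMultilinearMap.domDomCongr (splitSeven hkm).symm).currySum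
  let h : MultilinearMap ℝ (fun _ : Fin k => V) ℝ :=
    { toFun := fun w => M w v
      map_update_add' := fun w i x y => by rw [M.map_update_add, _root_.add_apply]
      map_update_smul' := fun w i c x => by rw [M.map_update_smul, _root_.smul_apply] }
  have hh : ∀ w, h w = vol (Sum.elim w v ∘ (splitSeven hkm).symm) := fun w => by
    change M w v = _
    rw [MultilinearMap.currySum_apply, MultilinearMap.domDomCongr_apply]
    rfl
  simp_rw [← hh]
  have := sum_orthonormal_indep (g := g) hex.choose_spec hb α.toMultilinearMap h
  refine Eq.trans ?_ (congrArg (fun x => (1 / (k.factorial : ℝ)) * x) this)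
  rw [ContinuousAlternatingMap.smul_apply, ContinuousAlternatingMap.sum_apply, smul_eq_mul]
  congr 1
  refine Finset.sum_congr rfl fun I _ => ?_
  rw [ContinuousAlternatingMap.smul_apply, contract_cast_apply, hh]
  rfl

theorem hodgeStar_apply_perm {k m : ℕ} (hkm : 7 = m + k) {g : V →ₗ[ℝ] V →ₗ[ℝ] ℝ}
    {vol : V [⋀^Fin 7]→L[ℝ] ℝ} {b : Module.Basis (Fin 7) ℝ V} (hb : IsOrthonormalBasis g b)
    (hv : vol b = 1) (α : V [⋀^Fin k]→L[ℝ] ℝ) (σ : Perm (Fin 7)) :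
    hodgeStar hkm g vol α (fun j => b (σ (splitSeven hkm (Sum.inr j)))) =
      (Perm.sign σ : ℝ) * α fun i => b (σ (splitSeven hkm (Sum.inl i))) := by
  rw [hodgeStar_apply hkm vol hb]
  set E := splitSeven hkm with hE
  have hperm : ∀ ρ : Perm (Fin 7), vol (b ∘ ρ) = (Perm.sign ρ : ℝ) := fun ρ => by
    refine (vol.toAlternatingMap.map_perm b ρ).trans ?_
    change Perm.sign ρ • vol b = _
    rw [hv, Units.smul_def, zsmul_eq_mul, mul_one]
  have hperm' : ∀ (τ : Perm (Fin k)) (f : Fin k → V),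
      α (f ∘ τ) = (Perm.sign τ : ℝ) * α f := fun τ f => by
    refine (α.toAlternatingMap.map_perm f τ).trans ?_
    rw [Units.smul_def, zsmul_eq_mul]
    rfl
  have key := Fintype.sum_of_injective
    (fun τ : Perm (Fin k) => fun i => σ (E (Sum.inl (τ i))))
    (fun τ τ' h => Equiv.ext fun i => by
      simpa using congrFun h i)
    (fun _ => (Perm.sign σ : ℝ) * α fun i => b (σ (E (Sum.inl i))))
    (fun I => α (b ∘ I) * vol (Sum.elim (b ∘ I) (fun j => b (σ (E (Sum.inr j)))) ∘ E.symm))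
    ?_ ?_
  · rw [← key]
    have : (k.factorial : ℝ) ≠ 0 := by positivity
    simp only [Finset.sum_const, Finset.card_univ, Fintype.card_perm, Fintype.card_fin,
      nsmul_eq_mul]
    field_simp
  · intro I hI
    have h0 : ¬ Function.Injective (Sum.elim I (fun j => σ (E (Sum.inr j))) ∘ E.symm) := by
      intro hinj
      apply hI
      have hinj' : Function.Injective (Sum.elim I fun j => σ (E (Sum.inr j))) :=
        (E.symm.injective_comp _).1 hinj
      have hex : ∀ i, ∃ j, I i = σ (E (Sum.inl j)) := by
        intro i
        obtain ⟨s, hs⟩ := (E.trans σ).surjective (I i)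
        rcases s with s | s
        · exact ⟨s, hs.symm⟩
        · have h : Sum.elim I (fun j => σ (E (Sum.inr j))) (Sum.inl i) =
              Sum.elim I (fun j => σ (E (Sum.inr j))) (Sum.inr s) := hs.symm
          exact absurd (hinj' h) (by simp)
      choose t ht using hex
      have htinj : Function.Injective t := fun i j hij => by
        have h : I i = I j := by rw [ht, ht, hij]
        exact Sum.inl_injective (hinj' (by simpa using h))
      refine ⟨Equiv.ofBijective t (Finite.injective_iff_bijective.1 htinj), ?_⟩
      funext i
      exact (ht i).symm
    have h1 : (Sum.elim (b ∘ I) (fun j => b (σ (E (Sum.inr j)))) ∘ E.symm) =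
        b ∘ (Sum.elim I (fun j => σ (E (Sum.inr j))) ∘ E.symm) := by
      funext i
      simp only [Function.comp_apply]
      cases E.symm i <;> rfl
    have h2 : vol (b ∘ (Sum.elim I (fun j => σ (E (Sum.inr j))) ∘ E.symm)) = 0 :=
      vol.toAlternatingMap.map_eq_zero_of_not_injective _ fun h => h0 (Function.Injective.of_comp h)
    simp only [h1, h2, mul_zero]
  · intro τ
    have h1 : (Sum.elim (b ∘ fun i => σ (E (Sum.inl (τ i)))) (fun j => b (σ (E (Sum.inr j))))
        ∘ E.symm) = b ∘ (σ * E.permCongr (Perm.sumCongr τ 1)) := by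
      funext i
      obtain ⟨s, rfl⟩ := E.surjective i
      cases s <;> simp [Equiv.permCongr_apply]
    have h2 : α (b ∘ fun i => σ (E (Sum.inl (τ i)))) =
        (Perm.sign τ : ℝ) * α fun i => b (σ (E (Sum.inl i))) :=
      hperm' τ fun i => b (σ (E (Sum.inl i)))
    have h3 : (Perm.sign τ : ℝ) * (Perm.sign τ : ℝ) = 1 := by
      rcases Int.units_eq_one_or (Perm.sign τ) with h | h <;> simp [h]
    rw [h1, hperm, h2, Perm.sign_mul, Equiv.Perm.sign_permCongr, Perm.sign_sumCongr]
    push_cast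
    simp only [Perm.sign_one, Units.val_one, Int.cast_one, mul_one]
    linear_combination (-(Perm.sign σ : ℝ) * α fun i => b (σ (E (Sum.inl i)))) * h3

theorem hodgeStar_comp {W : Type*} [NormedAddCommGroup W] [NormedSpace ℝ W] {k m : ℕ}
    (hkm : 7 = m + k) {g : W →ₗ[ℝ] W →ₗ[ℝ] ℝ}
    (vol : W [⋀^Fin 7]→L[ℝ] ℝ) (α : W [⋀^Fin k]→L[ℝ] ℝ) (L : V →L[ℝ] W)
    (hL : Function.Bijective L) {b : Module.Basis (Fin 7) ℝ W} (hb : IsOrthonormalBasis g b) :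
    hodgeStar hkm (g.compl₁₂ (L : V →ₗ[ℝ] W) (L : V →ₗ[ℝ] W)) (vol.compContinuousLinearMap L)
      (α.compContinuousLinearMap L) = (hodgeStar hkm g vol α).compContinuousLinearMap L := by
  let b' := b.map (LinearEquiv.ofBijective (L : V →ₗ[ℝ] W) hL).symm
  have hLb : ∀ i, L (b' i) = b i := fun i => by
    have := (LinearEquiv.ofBijective (L : V →ₗ[ℝ] W) hL).apply_symm_apply (b i)
    exact this
  have hb' : IsOrthonormalBasis (g.compl₁₂ (L : V →ₗ[ℝ] W) (L : V →ₗ[ℝ] W)) b' := fun i j => by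
    rw [← hb i j, ← hLb i, ← hLb j]
    rfl
  ext v
  rw [hodgeStar_apply hkm _ hb', ContinuousAlternatingMap.compContinuousLinearMap_apply,
    hodgeStar_apply hkm _ hb]
  congr 1
  refine Finset.sum_congr rfl fun I _ => ?_
  congr 1
  · change α _ = α _
    congr 1
    funext i
    exact hLb (I i)
  · change vol _ = vol _
    congr 1
    funext i
    simp only [Function.comp_apply]
    cases (splitSeven hkm).symm i
    · exact hLb _
    · rfl

theorem hodgeStar_zero {k m : ℕ} (hkm : 7 = m + k) (g : V →ₗ[ℝ] V →ₗ[ℝ] ℝ)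
    (vol : V [⋀^Fin 7]→L[ℝ] ℝ) : hodgeStar hkm g vol (0 : V [⋀^Fin k]→L[ℝ] ℝ) = 0 := by
  unfold hodgeStar
  split_ifs <;> simp

/-- `⋆⋆ = 1` on 4-forms in dimension seven. -/
theorem hodgeStar_hodgeStar {g : V →ₗ[ℝ] V →ₗ[ℝ] ℝ}
    {vol : V [⋀^Fin 7]→L[ℝ] ℝ} {b : Module.Basis (Fin 7) ℝ V} (hb : IsOrthonormalBasis g b)
    (hv : vol b = 1) (α : V [⋀^Fin 4]→L[ℝ] ℝ) :
    hodgeStar (k := 3) (m := 4) rfl g vol (hodgeStar (k := 4) (m := 3) rfl g vol α) = α := by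
  apply ContinuousAlternatingMap.toAlternatingMap_injective
  refine Module.Basis.ext_alternating b fun v hvi => ?_
  -- every injective choice of four indices is the last part of a permutation of all seven
  obtain ⟨σ, hσ⟩ : ∃ σ : Perm (Fin 7),
      ∀ j : Fin 4, σ (splitSeven (k := 3) (m := 4) rfl (Sum.inr j)) = v j := by
    obtain ⟨σ, hσ⟩ := Equiv.Perm.exists_extending_pair
      (fun j : Fin 4 => splitSeven (k := 3) (m := 4) rfl (Sum.inr j)) v
      (fun i j h => by simpa using h) hvi
    exact ⟨σ, hσ⟩
  let ρ : Perm (Fin 7) := ((splitSeven (k := 4) (m := 3) rfl).symm.trans (Equiv.sumComm _ _)).trans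
    (splitSeven (k := 3) (m := 4) rfl)
  have hρ : Perm.sign ρ = 1 := by decide +kernel
  have h1 := hodgeStar_apply_perm (k := 3) (m := 4) rfl hb hv
    (hodgeStar (k := 4) (m := 3) rfl g vol α) σ
  have h2 := hodgeStar_apply_perm (k := 4) (m := 3) rfl hb hv α (σ * ρ)
  rw [Perm.sign_mul, hρ, mul_one] at h2
  have h3 : (Perm.sign σ : ℝ) * (Perm.sign σ : ℝ) = 1 := by
    rcases Int.units_eq_one_or (Perm.sign σ) with h | h <;> simp [h]
  have e1 : ∀ i, (σ * ρ) (splitSeven (k := 4) (m := 3) rfl (Sum.inr i)) =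
      σ (splitSeven (k := 3) (m := 4) rfl (Sum.inl i)) := fun i => by simp [ρ]
  have e2 : ∀ i, (σ * ρ) (splitSeven (k := 4) (m := 3) rfl (Sum.inl i)) = v i := fun i => by
    rw [← hσ]; simp [ρ]
  simp only [e1, e2] at h2
  simp only [hσ] at h1
  rw [h2, ← mul_assoc, h3, one_mul] at h1
  exact h1

end Star

/-! ### Differential forms on the sphere as restrictions of ambient forms -/

section SphereForms

theorem minSmoothness_two_le : minSmoothness ℝ 2 ≤ ∞ := by
  rw [minSmoothness_of_isRCLikeNormedField]
  exact WithTop.coe_le_coe.2 le_top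

variable {E : Type*} [NormedAddCommGroup E] [InnerProductSpace ℝ E]

theorem sphereForm_congr {k : ℕ} (η : SphereForm E k) {x x' : sphere (0 : E) 1} (h : x = x')
    {v : Fin k → Tan x} {v' : Fin k → Tan x'} (hv : ∀ i, (v i : E) = v' i) : η x v = η x' v' := by
  subst h
  congr 1
  funext i
  exact Subtype.ext (hv i)

theorem coe_radialDeriv (y : E) (hy : y ≠ 0) (v : E) :
    (radialDeriv y hy v : E) = ‖y‖⁻¹ • (v - ⟪‖y‖⁻¹ • y, v⟫ • (‖y‖⁻¹ • y)) := by
  have hn : ‖‖y‖⁻¹ • y‖ = 1 := by simp [norm_smul, hy]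
  change ‖y‖⁻¹ • ((Tan (radial y hy)).orthogonalProjectionOnto v : E) = _
  congr 1
  change ((ℝ ∙ (‖y‖⁻¹ • y))ᗮ).starProjection v = _
  rw [Submodule.starProjection_orthogonal', sub_apply, Submodule.starProjection_unit_singleton ℝ hn]
  rfl

/-- The derivative of `y ↦ y / ‖y‖`. -/
theorem hasFDerivAt_radial (y : E) (hy : y ≠ 0) :
    HasFDerivAt (fun z : E => ‖z‖⁻¹ • z) ((Tan (radial y hy)).subtypeL ∘L radialDeriv y hy) y := by
  have hn : ‖y‖ ≠ 0 := norm_ne_zero_iff.2 hy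
  have h1 := (hasStrictFDerivAt_norm_sq y).hasFDerivAt.sqrt (pow_ne_zero 2 hn)
  have h2 : (fun z : E => √(‖z‖ ^ 2)) = fun z => ‖z‖ := by
    funext z; exact Real.sqrt_sq (norm_nonneg z)
  rw [h2] at h1
  have h3 := ((hasDerivAt_inv hn).comp_hasFDerivAt y h1).smul (hasFDerivAt_id y)
  refine h3.congr_fderiv ?_
  ext v
  simp only [ContinuousLinearMap.comp_apply, Submodule.subtypeL_apply, coe_radialDeriv]
  simp [inner_smul_left, smul_sub, smul_smul]
  rw [sub_eq_add_neg]
  congr 1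
  rw [← neg_smul]
  field_simp
  rw [neg_smul]

theorem contDiffAt_radial {n : WithTop ℕ∞} (y : E) (hy : y ≠ 0) :
    ContDiffAt ℝ n (fun z : E => ‖z‖⁻¹ • z) y :=
  ((contDiffAt_norm ℝ hy).inv (norm_ne_zero_iff.2 hy)).smul contDiffAt_id

/-- The restriction to the sphere of a form on the ambient space. -/
def sphereRestrict {k : ℕ} (A : E → E [⋀^Fin k]→L[ℝ] ℝ) : SphereForm E k := fun x =>
  (A x).compContinuousLinearMap (Tan x).subtypeL

theorem sphereRestrict_apply {k : ℕ} (A : E → E [⋀^Fin k]→L[ℝ] ℝ) (x : sphere (0 : E) 1)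
    (v : Fin k → Tan x) : sphereRestrict A x v = A x fun i => v i := rfl

theorem radialExtend_restrict {k : ℕ} (A : E → E [⋀^Fin k]→L[ℝ] ℝ) (y : E) (hy : y ≠ 0) :
    radialExtend (sphereRestrict A) y = (A (‖y‖⁻¹ • y)).compContinuousLinearMap
      (fderiv ℝ (fun z : E => ‖z‖⁻¹ • z) y) := by
  rw [radialExtend, dif_pos hy, (hasFDerivAt_radial y hy).fderiv]
  rfl

/-- The exterior derivative on the sphere is the restriction of the one on the ambient space: the
radial extension is the pullback of the ambient form under `y ↦ y / ‖y‖`, and `d` is natural. -/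
theorem sphereD_restrict {k : ℕ} (A : E → E [⋀^Fin k]→L[ℝ] ℝ) (hA : Differentiable ℝ A) :
    sphereD (sphereRestrict A) = sphereRestrict (extDeriv A) := by
  funext x
  have hx : ‖(x : E)‖ = 1 := by simp
  have hx0 : (x : E) ≠ 0 := fun h => by simp [h] at hx
  have h1 : radialExtend (sphereRestrict A) =ᶠ[nhds (x : E)] fun y =>
      (A (‖y‖⁻¹ • y)).compContinuousLinearMap (fderiv ℝ (fun z : E => ‖z‖⁻¹ • z) y) := by
    filter_upwards [isOpen_compl_singleton.mem_nhds hx0] with y hy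
    exact radialExtend_restrict A y hy
  rw [sphereD, h1.extDeriv_eq, extDeriv_pullback (r := ∞) (hA _) (contDiffAt_radial _ hx0)
    minSmoothness_two_le]
  ext v
  simp only [ContinuousAlternatingMap.compContinuousLinearMap_apply, sphereRestrict]
  rw [(hasFDerivAt_radial _ hx0).fderiv, hx, inv_one, one_smul]
  change extDeriv A ↑x _ = extDeriv A ↑x _
  congr 1
  funext i
  have hv : ⟪(x : E), (v i : E)⟫ = 0 := Submodule.mem_orthogonal_singleton_iff_inner_right.1 (v i).2
  simp only [Function.comp_apply, ContinuousLinearMap.comp_apply, Submodule.subtypeL_apply,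
    coe_radialDeriv, hx]
  simp [hv]

theorem sphereD_sphereD_restrict {k : ℕ} (A : E → E [⋀^Fin k]→L[ℝ] ℝ) (hA : ContDiff ℝ ∞ A) :
    sphereD (sphereD (sphereRestrict A)) = 0 := by
  have hd : ContDiff ℝ ∞ (extDeriv A) := by
    have h : extDeriv A = ContinuousAlternatingMap.alternatizeUncurryFinCLM (n := k) ℝ E ℝ ∘
        fderiv ℝ A := by
      funext y
      rw [Function.comp_apply, ContinuousAlternatingMap.alternatizeUncurryFinCLM_apply]
      rfl
    rw [h]
    exact (ContinuousAlternatingMap.alternatizeUncurryFinCLM (n := k) ℝ E ℝ).contDiff.comp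
      (hA.fderiv_right (m := ∞) (by simp))
  rw [sphereD_restrict A (hA.differentiable (by simp)),
    sphereD_restrict _ (hd.differentiable (by simp)), extDeriv_extDeriv hA
    minSmoothness_two_le]
  rfl

/-- Changing the arguments of an alternating map by multiples of a vector that it annihilates. -/
theorem map_sub_smul_of_annihilates {k : ℕ} (f : E [⋀^Fin k]→L[ℝ] ℝ) (z : E)
    (hz : ∀ v : Fin k → E, ∀ i, v i = z → f v = 0) (v : Fin k → E) (c : Fin k → ℝ) :
    f (fun i => v i - c i • z) = f v := by
  have h : ∀ s : Finset (Fin k), f (s.piecewise (fun i => v i - c i • z) v) = f v := by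
    intro s
    induction s using Finset.induction_on with
    | empty => simp
    | insert j s hj ih =>
      rw [Finset.piecewise_insert]
      refine (f.toMultilinearMap.map_update_sub _ j (v j) (c j • z)).trans ?_
      rw [MultilinearMap.map_update_smul]
      have h1 : f.toMultilinearMap (Function.update (s.piecewise (fun i => v i - c i • z) v) j z) =
          0 := hz _ j (by simp)
      rw [h1, smul_zero, sub_zero, ← ih]
      change f _ = f _
      congr 1
      refine Function.update_eq_self_iff.2 ?_
      simp [hj]
  have := h Finset.univ
  rwa [Finset.piecewise_univ] at this

/-- If the form `A` is annihilated by the radial vector, then the radial extension of its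
restriction is `‖y‖⁻ᵏ A (y / ‖y‖)`, which is smooth away from the origin. -/
theorem isSmoothForm_restrict {k : ℕ} (A : E → E [⋀^Fin k]→L[ℝ] ℝ) (hA : ContDiff ℝ ∞ A)
    (hor : ∀ y, ∀ v : Fin k → E, ∀ i, v i = y → A y v = 0) : IsSmoothForm (sphereRestrict A) := by
  have h : EqOn (radialExtend (sphereRestrict A)) (fun y => ‖y‖⁻¹ ^ k • A (‖y‖⁻¹ • y)) {0}ᶜ := by
    intro y hy
    rw [radialExtend_restrict A y hy, (hasFDerivAt_radial y hy).fderiv]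
    ext v
    have h1 : (((Tan (radial y hy)).subtypeL ∘L radialDeriv y hy : E →L[ℝ] E) ∘ v) =
        fun i => ‖y‖⁻¹ • (v i - ⟪‖y‖⁻¹ • y, v i⟫ • (‖y‖⁻¹ • y)) := by
      funext i
      exact coe_radialDeriv y hy (v i)
    rw [ContinuousAlternatingMap.compContinuousLinearMap_apply, h1]
    refine ((A (‖y‖⁻¹ • y)).map_smul_univ (fun _ => ‖y‖⁻¹) _).trans ?_
    rw [map_sub_smul_of_annihilates _ _ (hor _)]
    simp
  refine ContDiffOn.congr ?_ h
  intro y hy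
  have hn := norm_ne_zero_iff.2 (show y ≠ 0 from hy)
  exact ((((contDiffAt_norm ℝ hy).inv hn).pow k).smul
    (hA.contDiffAt.comp y (contDiffAt_radial y hy))).contDiffWithinAt

theorem spherePullback_restrict {k : ℕ} (A : E → E [⋀^Fin k]→L[ℝ] ℝ) (f : E ≃ₗᵢ[ℝ] E)
    (h : ∀ y, (A (f y)).compContinuousLinearMap (f.toContinuousLinearEquiv : E →L[ℝ] E) = A y) :
    spherePullback f (sphereRestrict A) = sphereRestrict A := by
  funext x
  ext v
  rw [sphereRestrict, ← h x]
  rfl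

theorem extDeriv_invariant {k : ℕ} (A : E → E [⋀^Fin k]→L[ℝ] ℝ) (hA : Differentiable ℝ A)
    (f : E ≃ₗᵢ[ℝ] E)
    (h : ∀ y, (A (f y)).compContinuousLinearMap (f.toContinuousLinearEquiv : E →L[ℝ] E) = A y)
    (y : E) : (extDeriv A (f y)).compContinuousLinearMap
      (f.toContinuousLinearEquiv : E →L[ℝ] E) = extDeriv A y := by
  have hf : ∀ z, fderiv ℝ f z = (f.toContinuousLinearEquiv : E →L[ℝ] E) := fun z =>
    (f.toContinuousLinearEquiv : E →L[ℝ] E).fderiv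
  have h1 : A = fun y => (A (f y)).compContinuousLinearMap (fderiv ℝ f y) := by
    funext z; rw [hf, h]
  conv_rhs => rw [h1]
  rw [extDeriv_pullback (r := ∞) (hA _) f.contDiff.contDiffAt
    minSmoothness_two_le, hf]

/-- What invariance under an isometry that fixes `x` means at `x`. -/
theorem apply_eq_of_invariant {k : ℕ} {η : SphereForm E k} {f : E ≃ₗᵢ[ℝ] E}
    (h : spherePullback f η = η) {x : sphere (0 : E) 1} (hx : f x = x) {v w : Fin k → Tan x}
    (hw : ∀ i, (w i : E) = f (v i)) : η x w = η x v := by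
  refine Eq.trans ?_ (congrArg (fun F : Tan x [⋀^Fin k]→L[ℝ] ℝ => F v) (congrFun h x))
  change η x w = η (spherePt f x) fun i => sphereDeriv f x (v i)
  exact sphereForm_congr η (Subtype.ext hx.symm) fun i => hw i

theorem sphereDeriv_bijective (f : E ≃ₗᵢ[ℝ] E) (x : sphere (0 : E) 1) :
    Function.Bijective (sphereDeriv f x) := by
  refine ⟨fun v w h => Subtype.ext (f.injective (congrArg Subtype.val h)), fun w => ?_⟩
  have hw := Submodule.mem_orthogonal_singleton_iff_inner_right.1 w.2
  refine ⟨⟨f.symm w, Submodule.mem_orthogonal_singleton_iff_inner_right.2 ?_⟩,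
    Subtype.ext (f.apply_symm_apply _)⟩
  rw [← f.inner_map_map, f.apply_symm_apply]
  exact hw

end SphereForms

/-! ### Invariant forms under a transitive group -/

section Family
variable {E : Type*} [NormedAddCommGroup E] [InnerProductSpace ℝ E]

/-- The tangent spaces of the unit sphere of an 8-dimensional space are 7-dimensional. -/
theorem exists_basis_tan (hE : Module.finrank ℝ E = 8) (x : sphere (0 : E) 1) :
    Nonempty (Module.Basis (Fin 7) ℝ (Tan x)) := by
  have : Fact (Module.finrank ℝ E = 7 + 1) := ⟨hE⟩
  have hx : (x : E) ≠ 0 := fun h => by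
    have : ‖(x : E)‖ = 1 := by simp
    simp [h] at this
  have hd : Module.finrank ℝ (Tan x) = 7 := Submodule.finrank_orthogonal_span_singleton hx
  have : FiniteDimensional ℝ (Tan x) := Module.finite_of_finrank_pos (by omega)
  exact ⟨Module.finBasisOfFinrankEq ℝ _ hd⟩

theorem Induces.exists_oriented_basis {V : Type*} [NormedAddCommGroup V] [NormedSpace ℝ V]
    {φ : V [⋀^Fin 3]→L[ℝ] ℝ} {g : V →ₗ[ℝ] V →ₗ[ℝ] ℝ} {vol : V [⋀^Fin 7]→L[ℝ] ℝ}
    (h : Induces φ g vol) (b₀ : Module.Basis (Fin 7) ℝ V) :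
    ∃ b : Module.Basis (Fin 7) ℝ V, IsOrthonormalBasis g b ∧ vol b = 1 := by
  obtain ⟨b, hb⟩ := exists_isOrthonormalBasis b₀ g h.symm h.pos
  rcases abs_eq (zero_le_one' ℝ) |>.1 (h.vol_eq b hb) with hv | hv
  · exact ⟨b, hb, hv⟩
  · -- the dimension is odd, so `-b` has the opposite orientation
    have hneg : ∀ i, b.unitsSMul (fun _ => (-1 : ℝˣ)) i = (-1 : ℝ) • b i := fun i => by
      simp [Module.Basis.unitsSMul_apply, Units.smul_def]
    refine ⟨b.unitsSMul fun _ => -1, fun i j => ?_, ?_⟩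
    · rw [hneg, hneg, ← hb i j]
      simp
    · rw [show (⇑(b.unitsSMul fun _ => (-1 : ℝˣ)) : Fin 7 → V) = fun i => (-1 : ℝ) • b i from
        funext hneg]
      refine (vol.map_smul_univ (fun _ => (-1 : ℝ)) b).trans ?_
      rw [hv]
      norm_num [Finset.prod_const]

/-- Under a transitive group, an invariant form is determined by its value at one point. -/
theorem eq_of_invariant {k : ℕ} {G : Subgroup (E ≃ₗᵢ[ℝ] E)} {x₀ : sphere (0 : E) 1}
    (htrans : ∀ x, ∃ f ∈ G, spherePt f x₀ = x) {η η' : SphereForm E k}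
    (h : ∀ f ∈ G, spherePullback f η = η) (h' : ∀ f ∈ G, spherePullback f η' = η')
    (h₀ : η x₀ = η' x₀) : η = η' := by
  funext x
  obtain ⟨f, hf, rfl⟩ := htrans x
  have e := (congrFun (h f hf) x₀).trans (h₀.trans (congrFun (h' f hf) x₀).symm)
  ext v
  choose w hw using fun i => (sphereDeriv_bijective f x₀).2 (v i)
  obtain rfl : (fun i => sphereDeriv f x₀ (w i)) = v := funext hw
  exact congrArg (fun F : Tan x₀ [⋀^Fin k]→L[ℝ] ℝ => F w) e

theorem isPositive_of_invariant {G : Subgroup (E ≃ₗᵢ[ℝ] E)} {x₀ : sphere (0 : E) 1}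
    (htrans : ∀ x, ∃ f ∈ G, spherePt f x₀ = x) {φ : SphereForm E 3}
    (h : ∀ f ∈ G, spherePullback f φ = φ) (h₀ : IsPositive (φ x₀)) (x : sphere (0 : E) 1) :
    IsPositive (φ x) := by
  obtain ⟨f, hf, rfl⟩ := htrans x
  have hx : spherePt f⁻¹ (spherePt f x₀) = x₀ := Subtype.ext (f.symm_apply_apply (x₀ : E))
  obtain ⟨g, vol, hi⟩ : IsPositive (φ (spherePt f⁻¹ (spherePt f x₀))) := by rw [hx]; exact h₀
  rw [← congrFun (h _ (G.inv_mem hf)) (spherePt f x₀)]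
  exact ⟨_, _, hi.comp _ (sphereDeriv_bijective f⁻¹ _)⟩

theorem spherePullback_sphereStar (hE : Module.finrank ℝ E = 8) {φ : SphereForm E 3}
    (hφ : ∀ x, IsPositive (φ x)) {k m : ℕ} (hkm : 7 = m + k) {α : SphereForm E k}
    {f : E ≃ₗᵢ[ℝ] E} (h : spherePullback f φ = φ) (hα : spherePullback f α = α) :
    spherePullback f (sphereStar φ k m hkm α) = sphereStar φ k m hkm α := by
  funext x
  obtain ⟨g, vol, hi⟩ := hφ (spherePt f x)
  obtain ⟨b⟩ := exists_basis_tan hE x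
  obtain ⟨b'⟩ := exists_basis_tan hE (spherePt f x)
  obtain ⟨c, hc⟩ := exists_isOrthonormalBasis b' g hi.symm hi.pos
  have hL := sphereDeriv_bijective f x
  have hi' := hi.comp (sphereDeriv f x) hL
  have e : (φ (spherePt f x)).compContinuousLinearMap (sphereDeriv f x) = φ x := congrFun h x
  rw [e] at hi'
  change (hodgeStar hkm _ _ _).compContinuousLinearMap (sphereDeriv f x) = hodgeStar hkm _ _ _
  rw [hi.inducedMetric_eq b', hi.inducedVolume_eq b', hi'.inducedMetric_eq b,
    hi'.inducedVolume_eq b, ← hodgeStar_comp hkm vol _ _ hL hc]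
  congr 1
  exact congrFun hα x

theorem inducedVolume_comp (hE : Module.finrank ℝ E = 8) {φ : SphereForm E 3}
    (hφ : ∀ x, IsPositive (φ x)) {f : E ≃ₗᵢ[ℝ] E} (h : spherePullback f φ = φ)
    (x : sphere (0 : E) 1) :
    (inducedVolume (φ (spherePt f x))).compContinuousLinearMap (sphereDeriv f x) =
      inducedVolume (φ x) := by
  obtain ⟨g, vol, hi⟩ := hφ (spherePt f x)
  obtain ⟨b⟩ := exists_basis_tan hE x
  obtain ⟨b'⟩ := exists_basis_tan hE (spherePt f x)
  have hi' := hi.comp (sphereDeriv f x) (sphereDeriv_bijective f x)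
  have e : (φ (spherePt f x)).compContinuousLinearMap (sphereDeriv f x) = φ x := congrFun h x
  rw [e] at hi'
  rw [hi.inducedVolume_eq b', hi'.inducedVolume_eq b]

/-- A finite-dimensional family of forms on the ambient space that exhausts, by restriction, the
`G`-invariant 3-forms on the sphere: the data to which the computation of the `G₂`-Laplacian on
invariant forms is reduced. -/
structure InvariantFamily (G : Subgroup (E ≃ₗᵢ[ℝ] E)) (x₀ : sphere (0 : E) 1) {P : Type*}
    (A : P → E → E [⋀^Fin 3]→L[ℝ] ℝ) : Prop where
  finrank : Module.finrank ℝ E = 8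
  transitive : ∀ x, ∃ f ∈ G, spherePt f x₀ = x
  contDiff : ∀ p, ContDiff ℝ ∞ (A p)
  horizontal : ∀ p y, ∀ v : Fin 3 → E, ∀ i, v i = y → A p y v = 0
  invariant : ∀ p, ∀ f ∈ G, ∀ y, (A p (f y)).compContinuousLinearMap
    (f.toContinuousLinearEquiv : E →L[ℝ] E) = A p y
  exhausts : ∀ η : SphereForm E 3, (∀ f ∈ G, spherePullback f η = η) →
    ∃ p, η x₀ = sphereRestrict (A p) x₀
  injective : ∀ p q, sphereRestrict (A p) x₀ = sphereRestrict (A q) x₀ → p = q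

namespace InvariantFamily
variable {G : Subgroup (E ≃ₗᵢ[ℝ] E)} {x₀ : sphere (0 : E) 1} {P : Type*}
  {A : P → E → E [⋀^Fin 3]→L[ℝ] ℝ}

theorem pullback_eq (h : InvariantFamily G x₀ A) (p : P) (f : E ≃ₗᵢ[ℝ] E) (hf : f ∈ G) :
    spherePullback f (sphereRestrict (A p)) = sphereRestrict (A p) :=
  spherePullback_restrict _ _ (h.invariant p f hf)

theorem isPositive (h : InvariantFamily G x₀ A) {p : P}
    (hp : IsPositive (sphereRestrict (A p) x₀)) (x : sphere (0 : E) 1) :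
    IsPositive (sphereRestrict (A p) x) :=
  isPositive_of_invariant h.transitive (h.pullback_eq p) hp x

/-- `⋆_φ d` maps the family to itself, by invariance: it is determined by the components at the base
point. -/
theorem exists_star_d (h : InvariantFamily G x₀ A) {p : P}
    (hp : IsPositive (sphereRestrict (A p) x₀)) (q : P) :
    ∃ r, sphereStar (sphereRestrict (A p)) 4 3 rfl (sphereD (sphereRestrict (A q))) =
      sphereRestrict (A r) := by
  have hd : ∀ f ∈ G, spherePullback f (sphereD (sphereRestrict (A q))) =
      sphereD (sphereRestrict (A q)) := fun f hf => by
    have := (h.contDiff q).differentiable (by simp)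
    rw [sphereD_restrict _ this]
    exact spherePullback_restrict _ _ (extDeriv_invariant _ this f (h.invariant q f hf))
  have hs : ∀ f ∈ G, spherePullback f
      (sphereStar (sphereRestrict (A p)) 4 3 rfl (sphereD (sphereRestrict (A q)))) =
      sphereStar (sphereRestrict (A p)) 4 3 rfl (sphereD (sphereRestrict (A q))) := fun f hf =>
    spherePullback_sphereStar h.finrank (h.isPositive hp) rfl (h.pullback_eq p f hf) (hd f hf)
  obtain ⟨r, hr⟩ := h.exhausts _ hs
  exact ⟨r, eq_of_invariant h.transitive hs (h.pullback_eq r) hr⟩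

theorem star_star (h : InvariantFamily G x₀ A) {p : P}
    (hp : ∀ x, IsPositive (sphereRestrict (A p) x)) (α : SphereForm E 4) :
    sphereStar (sphereRestrict (A p)) 3 4 rfl (sphereStar (sphereRestrict (A p)) 4 3 rfl α) =
      α := by
  funext x
  obtain ⟨g, vol, hi⟩ := hp x
  obtain ⟨b'⟩ := exists_basis_tan h.finrank x
  obtain ⟨b, hb, hv⟩ := hi.exists_oriented_basis b'
  change hodgeStar _ _ _ (hodgeStar _ _ _ _) = _
  rw [hi.inducedMetric_eq b', hi.inducedVolume_eq b']
  exact hodgeStar_hodgeStar hb hv _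

/-- If the `4`-form `d A_r` is dual to `A_p`, then `A_p` is coclosed and its Laplacian is
`⋆d⋆d A_p`. -/
theorem g2Laplacian_eq (h : InvariantFamily G x₀ A) {p q s r : P}
    (hp : IsPositive (sphereRestrict (A p) x₀))
    (hq : sphereStar (sphereRestrict (A p)) 4 3 rfl (sphereD (sphereRestrict (A p))) =
      sphereRestrict (A q))
    (hs : sphereStar (sphereRestrict (A p)) 4 3 rfl (sphereD (sphereRestrict (A q))) =
      sphereRestrict (A s))
    (hr : sphereStar (sphereRestrict (A p)) 4 3 rfl (sphereD (sphereRestrict (A r))) =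
      sphereRestrict (A p)) :
    g2Laplacian (sphereRestrict (A p)) = sphereRestrict (A s) := by
  have hc : sphereStar (sphereRestrict (A p)) 3 4 rfl (sphereRestrict (A p)) =
      sphereD (sphereRestrict (A r)) := by
    have := h.star_star (h.isPositive hp) (sphereD (sphereRestrict (A r)))
    rwa [hr] at this
  have hz : sphereStar (sphereRestrict (A p)) 5 2 rfl (0 : SphereForm E 5) = 0 := by
    funext x
    exact hodgeStar_zero _ _ _
  have hz' : sphereD (0 : SphereForm E 2) = 0 := by
    have h0 : sphereRestrict (fun _ : E => (0 : E [⋀^Fin 2]→L[ℝ] ℝ)) = 0 := rfl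
    rw [← h0, sphereD_restrict _ (differentiable_const _)]
    funext x
    ext v
    simp [sphereRestrict, extDeriv, ContinuousAlternatingMap.alternatizeUncurryFin_apply]
  rw [g2Laplacian, hodgeLaplacian, hq, hs, hc, sphereD_sphereD_restrict _ (h.contDiff r), hz, hz',
    sub_zero]

/-- The theorem for one group: it suffices to compute `⋆d` at the base point on the invariant
family. There `F` is the `G₂`-Laplacian in terms of the parameters of the family. -/
theorem g2Laplacian_bijOn (h : InvariantFamily G x₀ A) (F : P → P) (pos : Set P)
    (hpos : ∀ p, IsPositive (sphereRestrict (A p) x₀) ↔ p ∈ pos)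
    (hF : ∀ p ∈ pos, ∃ q r,
      sphereStar (sphereRestrict (A p)) 4 3 rfl (sphereD (sphereRestrict (A p))) =
        sphereRestrict (A q) ∧
      sphereStar (sphereRestrict (A p)) 4 3 rfl (sphereD (sphereRestrict (A q))) =
        sphereRestrict (A (F p)) ∧
      sphereStar (sphereRestrict (A p)) 4 3 rfl (sphereD (sphereRestrict (A r))) =
        sphereRestrict (A p))
    (hbij : BijOn F pos pos)
    (hvol : ∀ p ∈ pos, ∃ c : ℝ, 0 < c ∧ inducedVolume (sphereRestrict (A (F p)) x₀) =
      c • inducedVolume (sphereRestrict (A p) x₀)) :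
    BijOn g2Laplacian (positiveInvariantForms G) (positiveInvariantForms G) ∧
      (∀ φ ∈ positiveInvariantForms G, SameOrientation φ (g2Laplacian φ)) ∧
      ∀ μ ∈ positiveInvariantForms G,
        ∃! φ, φ ∈ positiveInvariantForms G ∧ g2Laplacian φ = μ := by
  have hmem : ∀ p ∈ pos, sphereRestrict (A p) ∈ positiveInvariantForms G := fun p hp =>
    ⟨isSmoothForm_restrict _ (h.contDiff p) (h.horizontal p), h.isPositive ((hpos p).2 hp),
      h.pullback_eq p⟩
  have hex : ∀ φ ∈ positiveInvariantForms G, ∃ p ∈ pos, φ = sphereRestrict (A p) := by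
    rintro φ ⟨-, hφ, hinv⟩
    obtain ⟨p, hp⟩ := h.exhausts φ hinv
    exact ⟨p, (hpos p).1 (hp ▸ hφ x₀), eq_of_invariant h.transitive hinv (h.pullback_eq p) hp⟩
  have hL : ∀ p ∈ pos, g2Laplacian (sphereRestrict (A p)) = sphereRestrict (A (F p)) := by
    intro p hp
    obtain ⟨q, r, hq, hs, hr⟩ := hF p hp
    exact h.g2Laplacian_eq ((hpos p).2 hp) hq hs hr
  have hB : BijOn g2Laplacian (positiveInvariantForms G) (positiveInvariantForms G) := by
    refine ⟨fun φ hφ => ?_, fun φ hφ ψ hψ e => ?_, fun μ hμ => ?_⟩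
    · obtain ⟨p, hp, rfl⟩ := hex φ hφ
      rw [hL p hp]
      exact hmem _ (hbij.mapsTo hp)
    · obtain ⟨p, hp, rfl⟩ := hex φ hφ
      obtain ⟨q, hq, rfl⟩ := hex ψ hψ
      rw [hL p hp, hL q hq] at e
      rw [hbij.injOn hp hq (h.injective _ _ (congrFun e x₀))]
    · obtain ⟨p, hp, rfl⟩ := hex μ hμ
      obtain ⟨q, hq, rfl⟩ := hbij.surjOn hp
      exact ⟨_, hmem q hq, hL q hq⟩
  refine ⟨hB, fun φ hφ x => ?_, fun μ hμ => ?_⟩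
  · obtain ⟨p, hp, rfl⟩ := hex φ hφ
    obtain ⟨f, hf, rfl⟩ := h.transitive x
    rw [hL p hp]
    obtain ⟨c, hc, hcv⟩ := hvol p hp
    refine ⟨c, hc, ?_⟩
    rw [← inducedVolume_comp h.finrank (hmem _ (hbij.mapsTo hp)).2.1 (h.pullback_eq _ f hf),
      ← inducedVolume_comp h.finrank (hmem _ hp).2.1 (h.pullback_eq _ f hf)] at hcv
    ext v
    choose w hw using fun i => (sphereDeriv_bijective f x₀).2 (v i)
    obtain rfl : (fun i => sphereDeriv f x₀ (w i)) = v := funext hw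
    exact congrArg (fun F : Tan x₀ [⋀^Fin 7]→L[ℝ] ℝ => F w) hcv
  · obtain ⟨φ, hφ, e⟩ := hB.surjOn hμ
    exact ⟨φ, ⟨hφ, e⟩, fun ψ hψ => hB.injOn hψ.1 hφ (hψ.2.trans e.symm)⟩

end InvariantFamily
end Family

/-! ### Forms with constant components in a frame -/

section Frames
variable {E : Type*} [NormedAddCommGroup E] [InnerProductSpace ℝ E]

theorem exists_frame (hE : Module.finrank ℝ E = 8) (x₀ : sphere (0 : E) 1) (v : Fin 7 → E)
    (h₀ : ∀ i, ⟪(x₀ : E), v i⟫ = 0) (hne : ∀ i, v i ≠ 0) (ho : ∀ i j, i ≠ j → ⟪v i, v j⟫ = 0) :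
    ∃ b : Module.Basis (Fin 7) ℝ (Tan x₀), ∀ i, (b i : E) = v i := by
  obtain ⟨b'⟩ := exists_basis_tan hE x₀
  let w : Fin 7 → Tan x₀ := fun i =>
    ⟨v i, Submodule.mem_orthogonal_singleton_iff_inner_right.2 (h₀ i)⟩
  have hli : LinearIndependent ℝ w := by
    refine linearIndependent_of_ne_zero_of_inner_eq_zero
      (fun i h => hne i (congrArg Subtype.val h)) fun i j hij => ho i j hij
  have hc : Fintype.card (Fin 7) = Module.finrank ℝ (Tan x₀) :=
    (Module.finrank_eq_card_basis b').symm
  exact ⟨basisOfLinearIndependentOfCardEqFinrank hli hc, fun i => by simp [w]⟩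

/-- The Hodge star on 4-forms in a frame in which the 3-form is standard. -/
theorem sphereStar_frame {φ : SphereForm E 3} {x : sphere (0 : E) 1}
    {b : Module.Basis (Fin 7) ℝ (Tan x)} (hb : ∀ i j k, φ x ![b i, b j, b k] = g2Tensor i j k)
    (α : SphereForm E 4) (σ : Perm (Fin 7)) :
    sphereStar φ 4 3 rfl α x ![b (σ 4), b (σ 5), b (σ 6)] =
      (Perm.sign σ : ℝ) * α x ![b (σ 0), b (σ 1), b (σ 2), b (σ 3)] := by
  have : FiniteDimensional ℝ (Tan x) := Module.Finite.of_basis b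
  obtain ⟨vol, hv, hi⟩ := induces_of_g2Tensor (φ x) b hb
  have h := hodgeStar_apply_perm (k := 4) (m := 3) rfl (basisMetric_orthonormal b) hv (α x) σ
  change hodgeStar _ _ _ _ _ = _
  rw [hi.inducedMetric_eq b, hi.inducedVolume_eq b]
  convert h using 2
  · funext i; fin_cases i <;> rfl
  · congr 1; funext i; fin_cases i <;> rfl

theorem isPositive_of_frame {φ : SphereForm E 3} {x : sphere (0 : E) 1}
    {b : Module.Basis (Fin 7) ℝ (Tan x)} (hb : ∀ i j k, φ x ![b i, b j, b k] = g2Tensor i j k) :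
    IsPositive (φ x) := by
  have : FiniteDimensional ℝ (Tan x) := Module.Finite.of_basis b
  obtain ⟨vol, hv, hi⟩ := induces_of_g2Tensor (φ x) b hb
  exact ⟨_, _, hi⟩

/-- The values of the quadratic map `X ↦ (1/6) ι_X φ ∧ ι_X φ ∧ φ` on the frame vectors would all
have the same nonzero sign if the form were positive. -/
theorem not_isPositive_of_frame {φ : SphereForm E 3} {x : sphere (0 : E) 1}
    {b : Module.Basis (Fin 7) ℝ (Tan x)} (c : Fin 7 → Fin 7 → Fin 7 → ℤ)
    (hb : ∀ i j k, φ x ![b i, b j, b k] = c i j k) (i j : Fin 7)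
    (hc : bryantSum c i i * bryantSum c j j ≤ 0) : ¬ IsPositive (φ x) := by
  rintro ⟨g, vol, hi⟩
  have h := hi.mul_pos b (b.ne_zero i) (b.ne_zero j)
  have e1 := bryantForm_frame (φ x) b c hb i i
  have e2 := bryantForm_frame (φ x) b c hb j j
  have e3 : ((bryantSum c i i : ℝ)) * bryantSum c j j ≤ 0 := by exact_mod_cast hc
  rw [← e1, ← e2] at e3
  linarith

/-- Two forms that are standard in frames which differ by positive factors induce the same
orientation. -/
theorem exists_inducedVolume_smul {φ φ' : SphereForm E 3} {x : sphere (0 : E) 1}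
    {b b' : Module.Basis (Fin 7) ℝ (Tan x)}
    (hb : ∀ i j k, φ x ![b i, b j, b k] = g2Tensor i j k)
    (hb' : ∀ i j k, φ' x ![b' i, b' j, b' k] = g2Tensor i j k) (l : Fin 7 → ℝ)
    (hl : ∀ i, 0 < l i) (h : ∀ i, b i = l i • b' i) :
    ∃ c : ℝ, 0 < c ∧ inducedVolume (φ' x) = c • inducedVolume (φ x) := by
  have : FiniteDimensional ℝ (Tan x) := Module.Finite.of_basis b
  obtain ⟨vol, hv, hi⟩ := induces_of_g2Tensor (φ x) b hb
  obtain ⟨vol', hv', hi'⟩ := induces_of_g2Tensor (φ' x) b' hb'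
  refine ⟨∏ i, l i, Finset.prod_pos fun i _ => hl i, ?_⟩
  rw [hi.inducedVolume_eq b, hi'.inducedVolume_eq b]
  refine ext_frame_seven b ?_
  rw [ContinuousAlternatingMap.smul_apply, hv, smul_eq_mul, mul_one]
  rw [show (b : Fin 7 → Tan x) = fun i => l i • b' i from funext h]
  refine (vol'.map_smul_univ l b').trans ?_
  rw [hv', smul_eq_mul, mul_one]

theorem sphereRestrict_frame (A : E → E [⋀^Fin 3]→L[ℝ] ℝ) {x : sphere (0 : E) 1}
    (b : Fin 7 → Tan x) (i j k : Fin 7) :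
    sphereRestrict A x ![b i, b j, b k] = A x ![(b i : E), b j, b k] := by
  rw [sphereRestrict_apply]
  congr 1
  funext l
  fin_cases l <;> rfl

/-- The components of an invariant 3-form under an element of the stabilizer that permutes the
frame up to signs. -/
theorem apply_signedPerm {η : SphereForm E 3} {f : E ≃ₗᵢ[ℝ] E} (h : spherePullback f η = η)
    {x : sphere (0 : E) 1} (hx : f x = x) {b : Fin 7 → Tan x} (π : Fin 7 → Fin 7)
    (ε : Fin 7 → ℤ) (hb : ∀ i, f (b i) = (ε i : ℝ) • (b (π i) : E)) (i j k : Fin 7) :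
    η x ![b i, b j, b k] = (ε i * ε j * ε k : ℤ) * η x ![b (π i), b (π j), b (π k)] := by
  push_cast
  rw [← map_smul_three]
  symm
  refine apply_eq_of_invariant h hx fun l => ?_
  fin_cases l
  exacts [(hb i).symm, (hb j).symm, (hb k).symm]

/-- The diagonal sign changes in `G₂` annihilate all but seven sorted components of a 3-form. -/
theorem eq_zero_of_signs {V : Type*} [NormedAddCommGroup V] [NormedSpace ℝ V]
    (φ : V [⋀^Fin 3]→L[ℝ] ℝ) (b : Module.Basis (Fin 7) ℝ V)
    (h : ∀ ε ∈ [![1, 1, 1, -1, -1, -1, -1], ![1, -1, -1, 1, 1, -1, -1],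
      (![-1, 1, -1, 1, -1, 1, -1] : Fin 7 → ℤ)], ∀ i j k,
      φ ![b i, b j, b k] = (ε i * ε j * ε k : ℤ) * φ ![b i, b j, b k])
    (h₀ : φ ![b 0, b 1, b 2] = 0) (h₁ : φ ![b 0, b 3, b 4] = 0) (h₂ : φ ![b 0, b 5, b 6] = 0)
    (h₃ : φ ![b 1, b 3, b 5] = 0) (h₄ : φ ![b 1, b 4, b 6] = 0) (h₅ : φ ![b 2, b 3, b 6] = 0)
    (h₆ : φ ![b 2, b 4, b 5] = 0) : φ = 0 := by
  have hcase : ∀ i j k : Fin 7, i < j → j < k →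
      (∃ ε ∈ [![1, 1, 1, -1, -1, -1, -1], ![1, -1, -1, 1, 1, -1, -1],
        (![-1, 1, -1, 1, -1, 1, -1] : Fin 7 → ℤ)], ε i * ε j * ε k = -1) ∨
      (i, j, k) ∈ [((0, 1, 2) : Fin 7 × Fin 7 × Fin 7), (0, 3, 4), (0, 5, 6), (1, 3, 5), (1, 4, 6),
        (2, 3, 6), (2, 4, 5)] := by decide +kernel
  refine ext_of_sorted b _ fun i j k hij hjk => ?_
  rcases hcase i j k hij hjk with ⟨ε, hε, he⟩ | h'
  · have := h ε hε i j k
    rw [he] at this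
    push_cast at this
    linarith
  · simp only [List.mem_cons, Prod.mk.injEq, List.not_mem_nil, or_false] at h'
    rcases h' with ⟨rfl, rfl, rfl⟩ | ⟨rfl, rfl, rfl⟩ | ⟨rfl, rfl, rfl⟩ | ⟨rfl, rfl, rfl⟩ |
      ⟨rfl, rfl, rfl⟩ | ⟨rfl, rfl, rfl⟩ | ⟨rfl, rfl, rfl⟩ <;> assumption

theorem pullback_sub {η ψ : SphereForm E 3} {f : E ≃ₗᵢ[ℝ] E} (h : spherePullback f η = η)
    (h' : spherePullback f ψ = ψ) : spherePullback f (η - ψ) = η - ψ :=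
  (show spherePullback f (η - ψ) = spherePullback f η - spherePullback f ψ from rfl).trans
    (by rw [h, h'])

end Frames

/-! ### Contractions of constant 4-forms with the position vector -/

/-- In finite dimension, a field of alternating forms is smooth if its values on fixed vectors
are. -/
theorem contDiff_alternating {E : Type*} [NormedAddCommGroup E] [NormedSpace ℝ E]
    [FiniteDimensional ℝ E] {k : ℕ} {A : E → E [⋀^Fin k]→L[ℝ] ℝ}
    (h : ∀ v, ContDiff ℝ ∞ fun y => A y v) : ContDiff ℝ ∞ A := by
  let b := Module.finBasis ℝ E
  let T : (E [⋀^Fin k]→L[ℝ] ℝ) →ₗ[ℝ] ((Fin k → Fin (Module.finrank ℝ E)) → ℝ) :=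
    { toFun := fun f r => f fun i => b (r i)
      map_add' := fun _ _ => rfl
      map_smul' := fun _ _ => rfl }
  have hT : LinearMap.ker T = ⊥ := LinearMap.ker_eq_bot.2 fun f g hfg => by
    apply ContinuousAlternatingMap.toAlternatingMap_injective
    exact Module.Basis.ext_alternating b fun r _ => congrFun hfg r
  obtain ⟨g, hg⟩ := T.exists_leftInverse_of_injective hT
  have hA : A = fun y => LinearMap.toContinuousLinearMap g (T (A y)) :=
    funext fun y => (LinearMap.congr_fun hg (A y)).symm
  rw [hA]
  exact (LinearMap.toContinuousLinearMap g).contDiff.comp (contDiff_pi.2 fun r => h _)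

section FourForms
variable {E : Type*} [NormedAddCommGroup E] [InnerProductSpace ℝ E]

/-- `d (ι_y Φ) = 4 Φ` for a constant 4-form `Φ`. -/
theorem extDeriv_curryLeft (Φ : E [⋀^Fin 4]→L[ℝ] ℝ) (x : E) :
    extDeriv (fun y => Φ.curryLeft y) x = (4 : ℝ) • Φ := by
  have h : fderiv ℝ (fun y => Φ.curryLeft y) x = Φ.curryLeft := Φ.curryLeft.fderiv
  rw [extDeriv, h, ContinuousAlternatingMap.alternatizeUncurryFin_curryLeft,
    ← Nat.cast_smul_eq_nsmul ℝ]
  norm_num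

theorem contDiff_curryLeft (Φ : E [⋀^Fin 4]→L[ℝ] ℝ) : ContDiff ℝ ∞ fun y => Φ.curryLeft y :=
  Φ.curryLeft.contDiff

/-- The components of `⋆ d (ι_y Φ)` in a frame in which the 3-form is standard. -/
theorem sphereStar_curryLeft {φ : SphereForm E 3} {x : sphere (0 : E) 1}
    {b : Module.Basis (Fin 7) ℝ (Tan x)} (hb : ∀ i j k, φ x ![b i, b j, b k] = g2Tensor i j k)
    (Φ : E [⋀^Fin 4]→L[ℝ] ℝ) (σ : Perm (Fin 7)) :
    sphereStar φ 4 3 rfl (sphereD (sphereRestrict fun y => Φ.curryLeft y)) x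
        ![b (σ 4), b (σ 5), b (σ 6)] =
      (Perm.sign σ : ℝ) *
        (4 * Φ ![(b (σ 0) : E), (b (σ 1) : E), (b (σ 2) : E), (b (σ 3) : E)]) := by
  rw [sphereStar_frame hb, sphereD_restrict _ ((contDiff_curryLeft Φ).differentiable (by simp)),
    sphereRestrict_apply, extDeriv_curryLeft, ContinuousAlternatingMap.smul_apply, smul_eq_mul]
  congr 3
  funext l
  fin_cases l <;> rfl

theorem curryLeft_horizontal (Φ : E [⋀^Fin 4]→L[ℝ] ℝ) (y : E) (v : Fin 3 → E) (i : Fin 3)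
    (h : v i = y) : Φ.curryLeft y v = 0 :=
  Φ.map_eq_zero_of_eq (Matrix.vecCons y v) (i := 0) (j := i.succ)
    (by simp [h]) (Fin.succ_ne_zero i).symm

theorem curryLeft_invariant {Φ : E [⋀^Fin 4]→L[ℝ] ℝ} {f : E →L[ℝ] E}
    (h : ∀ v, Φ (f ∘ v) = Φ v) (y : E) :
    (Φ.curryLeft (f y)).compContinuousLinearMap f = Φ.curryLeft y := by
  ext v
  have := h (Matrix.vecCons y v)
  rwa [show f ∘ Matrix.vecCons y v = Matrix.vecCons (f y) (f ∘ v) from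
    funext fun i => Fin.cases rfl (fun _ => rfl) i] at this

variable {W : Type*} [NormedAddCommGroup W] [InnerProductSpace ℝ W]

/-- Half of the square of an alternating `W`-valued bilinear map `B`: the 4-form
`⟨B(x, y), B(z, w)⟩ - ⟨B(x, z), B(y, w)⟩ + ⟨B(x, w), B(y, z)⟩`. -/
def squareForm (B : E →ₗ[ℝ] E →ₗ[ℝ] W) (hB : ∀ x, B x x = 0) : E [⋀^Fin 4]→ₗ[ℝ] ℝ where
  toFun v := ⟪B (v 0) (v 1), B (v 2) (v 3)⟫ - ⟪B (v 0) (v 2), B (v 1) (v 3)⟫ +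
    ⟪B (v 0) (v 3), B (v 1) (v 2)⟫
  map_update_add' := by
    intro inst v i x y
    obtain rfl : inst = instDecidableEqFin 4 := Subsingleton.elim _ _
    fin_cases i <;> simp [Function.update, inner_add_left, inner_add_right] <;> ring
  map_update_smul' := by
    intro inst v i c x
    obtain rfl : inst = instDecidableEqFin 4 := Subsingleton.elim _ _
    fin_cases i <;> simp [Function.update, inner_smul_left, inner_smul_right] <;> ring
  map_eq_zero_of_eq' := by
    intro v i j h hij
    have hB' : ∀ x y, B x y = -B y x := fun x y => by
      have := hB (x + y)
      simp only [map_add, LinearMap.add_apply, hB] at this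
      rw [eq_neg_iff_add_eq_zero, add_comm]
      simpa using this
    have key : ∀ i j, i < j → v i = v j → ⟪B (v 0) (v 1), B (v 2) (v 3)⟫ -
        ⟪B (v 0) (v 2), B (v 1) (v 3)⟫ + ⟪B (v 0) (v 3), B (v 1) (v 2)⟫ = 0 := by
      intro i j hij h
      fin_cases i <;> fin_cases j <;> first | exact absurd hij (by decide) | skip
      all_goals
        simp only [Fin.zero_eta, Fin.mk_one, Fin.reduceFinMk] at h
        simp only [h, hB, hB' (v 2) (v 1), hB' (v 3) (v 1), hB' (v 3) (v 2), inner_neg_left,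
          inner_neg_right, inner_zero_left, inner_zero_right]
        linarith [real_inner_comm (B (v 1) (v 2)) (B (v 1) (v 3)),
          real_inner_comm (B (v 1) (v 2)) (B (v 2) (v 3)),
          real_inner_comm (B (v 1) (v 3)) (B (v 2) (v 3))]
    rcases lt_or_gt_of_ne hij with hij | hij
    · exact key i j hij h
    · exact key j i hij h.symm

end FourForms

/-! ### Real cube roots -/

/-- The bijection `t ↦ t³` of the real line. -/
def cubeEquiv : ℝ ≃ ℝ :=
  Equiv.ofBijective (fun t => t ^ 3) ⟨(Odd.strictMono_pow (by decide)).injective, fun c => by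
    have h : ∀ c : ℝ, 0 ≤ c → ∃ t : ℝ, t ^ 3 = c := fun c hc => ⟨c ^ (1 / 3 : ℝ), by
      rw [← Real.rpow_natCast, ← Real.rpow_mul hc]
      norm_num⟩
    rcases le_total 0 c with hc | hc
    · exact h c hc
    · obtain ⟨t, ht⟩ := h (-c) (by linarith)
      exact ⟨-t, by change (-t) ^ 3 = c; rw [Odd.neg_pow (by decide), ht, neg_neg]⟩⟩

theorem cubeEquiv_symm_pow (c : ℝ) : cubeEquiv.symm c ^ 3 = c := cubeEquiv.apply_symm_apply c

/-! ### The group `SU(4)` -/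

section SU4

theorem C4.finrank : Module.finrank ℝ C4 = 8 := by
  rw [finrank_real_of_complex, finrank_euclideanSpace]
  simp

/-- The Kähler form `ω(x, y) = Im ∑ x̄ᵢ yᵢ` of `ℂ⁴`. -/
def kaehler : C4 →ₗ[ℝ] C4 →ₗ[ℝ] ℝ :=
  LinearMap.mk₂ ℝ (fun x y => (star x.ofLp ⬝ᵥ y.ofLp).im)
    (fun x x' y => by simp [add_dotProduct])
    (fun c x y => by simp [dotProduct, Fin.sum_univ_four]; ring)
    (fun x y y' => by simp [dotProduct_add])
    (fun c x y => by simp [dotProduct, Fin.sum_univ_four]; ring)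

theorem kaehler_self (x : C4) : kaehler x x = 0 := by
  simp [kaehler, dotProduct, Fin.sum_univ_four]
  ring

/-- The real part of a multiple of the complex volume form `dz⁰ ∧ dz¹ ∧ dz² ∧ dz³`. -/
def reVolume (z : ℂ) : C4 [⋀^Fin 4]→ₗ[ℝ] ℝ where
  toFun v := (z * Matrix.detRowAlternating fun i => (v i).ofLp).re
  map_update_add' v i x y := by
    have h : ∀ w : C4, (fun j => (Function.update v i w j).ofLp) =
        Function.update (fun j => (v j).ofLp) i w.ofLp := fun w =>
      funext fun j => Function.apply_update (fun _ (u : C4) => u.ofLp) v i w j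
    rw [h, h, h, WithLp.ofLp_add, AlternatingMap.map_update_add, mul_add, Complex.add_re]
  map_update_smul' v i c x := by
    have h : ∀ w : C4, (fun j => (Function.update v i w j).ofLp) =
        Function.update (fun j => (v j).ofLp) i w.ofLp := fun w =>
      funext fun j => Function.apply_update (fun _ (u : C4) => u.ofLp) v i w j
    rw [h, h, WithLp.ofLp_smul, ← Complex.coe_smul, AlternatingMap.map_update_smul]
    simp only [smul_eq_mul, mul_left_comm z, Complex.re_ofReal_mul]
  map_eq_zero_of_eq' v i j h hij := by
    rw [AlternatingMap.map_eq_zero_of_eq _ _ (by simp [h]) hij, mul_zero, Complex.zero_re]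

/-- The `SU(4)`-invariant 4-forms `(a/2) ω² + Re (z dz⁰ ∧ dz¹ ∧ dz² ∧ dz³)` on `ℂ⁴`. -/
def su4FourForm (p : ℝ × ℂ) : C4 [⋀^Fin 4]→L[ℝ] ℝ :=
  (p.1 • squareForm kaehler kaehler_self + reVolume p.2).toContinuous

theorem su4FourForm_apply (p : ℝ × ℂ) (v : Fin 4 → C4) :
    su4FourForm p v = p.1 * (kaehler (v 0) (v 1) * kaehler (v 2) (v 3) -
      kaehler (v 0) (v 2) * kaehler (v 1) (v 3) + kaehler (v 0) (v 3) * kaehler (v 1) (v 2)) +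
      (p.2 * (Matrix.of fun i => (v i).ofLp).det).re := by
  change p.1 * (⟪_, _⟫ - ⟪_, _⟫ + ⟪_, _⟫) + (p.2 * (Matrix.of fun i => (v i).ofLp).det).re = _
  simp only [RCLike.inner_apply, conj_trivial]
  ring

theorem mem_SU4 {A : Matrix (Fin 4) (Fin 4) ℂ} (hA : A ∈ Matrix.specialUnitaryGroup (Fin 4) ℂ) :
    ∃ f ∈ SU4, ∀ v : C4, f v = WithLp.toLp 2 (A *ᵥ v.ofLp) :=
  ⟨_, ⟨⟨A, hA⟩, rfl⟩, fun _ => rfl⟩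

theorem su4FourForm_invariant (p : ℝ × ℂ) {f : C4 ≃ₗᵢ[ℝ] C4} (hf : f ∈ SU4) (v : Fin 4 → C4) :
    su4FourForm p (f ∘ v) = su4FourForm p v := by
  obtain ⟨A, rfl⟩ := hf
  have hA : (A : Matrix (Fin 4) (Fin 4) ℂ)ᴴ * (A : Matrix (Fin 4) (Fin 4) ℂ) = 1 :=
    Matrix.mem_unitaryGroup_iff'.1 (Matrix.mem_specialUnitaryGroup_iff.1 A.2).1
  have hd : (A : Matrix (Fin 4) (Fin 4) ℂ).det = 1 := (Matrix.mem_specialUnitaryGroup_iff.1 A.2).2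
  have hk : ∀ x y, kaehler (isometricAction su4Rep su4Rep_norm A x)
      (isometricAction su4Rep su4Rep_norm A y) = kaehler x y := fun x y => by
    change (star ((A : Matrix (Fin 4) (Fin 4) ℂ) *ᵥ x.ofLp) ⬝ᵥ
      ((A : Matrix (Fin 4) (Fin 4) ℂ) *ᵥ y.ofLp)).im = (star x.ofLp ⬝ᵥ y.ofLp).im
    rw [Matrix.star_mulVec, ← Matrix.dotProduct_mulVec, Matrix.mulVec_mulVec, hA,
      Matrix.one_mulVec]
  have hm : (Matrix.of fun i => ((isometricAction su4Rep su4Rep_norm A) (v i)).ofLp) =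
      (Matrix.of fun i => (v i).ofLp) * (A : Matrix (Fin 4) (Fin 4) ℂ)ᵀ := by
    funext i j
    rw [Matrix.mul_apply]
    change ∑ k, (A : Matrix (Fin 4) (Fin 4) ℂ) j k * (v i).ofLp k = _
    exact Finset.sum_congr rfl fun k _ =>
      mul_comm ((A : Matrix (Fin 4) (Fin 4) ℂ) j k) ((v i).ofLp k)
  simp only [su4FourForm_apply, Function.comp_apply, hk, hm]
  rw [Matrix.det_mul, Matrix.det_transpose, hd, mul_one]

/-- The base point `e₀` of the unit sphere of `ℂ⁴`. -/
def C4.base : sphere (0 : C4) 1 := ⟨EuclideanSpace.single 0 1, by simp⟩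

theorem SU4_transitive (x : sphere (0 : C4) 1) : ∃ f ∈ SU4, spherePt f C4.base = x := by
  have hv : Orthonormal ℂ (({0} : Set (Fin 4)).domRestrict fun _ => (x : C4)) := by
    refine ⟨fun _ => norm_eq_of_mem_sphere x, fun i j hij => absurd (Subsingleton.elim i j) hij⟩
  obtain ⟨b, hb⟩ := hv.exists_orthonormalBasis_extension_of_card_eq (by simp)
  set U := (EuclideanSpace.basisFun (Fin 4) ℂ).toBasis.toMatrix b with hU
  have hU' : U ∈ Matrix.unitaryGroup (Fin 4) ℂ :=
    OrthonormalBasis.toMatrix_orthonormalBasis_mem_unitary _ _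
  have hd : star U.det * U.det = 1 := by
    have := congrArg Matrix.det (Matrix.mem_unitaryGroup_iff'.1 hU')
    rwa [Matrix.det_mul, Matrix.star_eq_conjTranspose, Matrix.det_conjTranspose, Matrix.det_one]
      at this
  -- the last column is corrected so that the determinant becomes `1`
  have hD : Matrix.diagonal ![1, 1, 1, star U.det] ∈ Matrix.unitaryGroup (Fin 4) ℂ := by
    rw [Matrix.mem_unitaryGroup_iff', Matrix.star_eq_conjTranspose,
      Matrix.diagonal_conjTranspose, Matrix.diagonal_mul_diagonal, ← Matrix.diagonal_one]
    congr 1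
    funext i
    fin_cases i <;> simp
    rw [mul_comm]
    exact hd
  obtain ⟨f, hf, hfv⟩ := mem_SU4 (A := U * Matrix.diagonal ![1, 1, 1, star U.det])
    (Matrix.mem_specialUnitaryGroup_iff.2 ⟨mul_mem hU' hD, by
      rw [Matrix.det_mul, Matrix.det_diagonal, Fin.prod_univ_four]
      simp
      rw [mul_comm]
      exact hd⟩)
  refine ⟨f, hf, Subtype.ext ?_⟩
  change f (EuclideanSpace.single 0 1) = x
  rw [hfv, ← Matrix.mulVec_mulVec]
  have h0 : b 0 = x := hb 0 rfl
  ext i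
  simp [Matrix.mulVec, dotProduct, Fin.sum_univ_four, hU,
    Module.Basis.toMatrix_apply, h0]

/-- The frame `p i e₀, c e₁, c i e₁, c e₂, c i e₂, c e₃, c i e₃` of the tangent space at `e₀`. -/
def su4Frame (p : ℝ) (c : ℂ) : Fin 7 → C4 := fun i => WithLp.toLp 2 <|
  ![![p * Complex.I, 0, 0, 0], ![0, c, 0, 0], ![0, c * Complex.I, 0, 0], ![0, 0, c, 0],
    ![0, 0, c * Complex.I, 0], ![0, 0, 0, c], ![0, 0, 0, c * Complex.I]] i

theorem kaehler_apply (x y : C4) : kaehler x y = (star x.ofLp ⬝ᵥ y.ofLp).im := rfl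

theorem exists_su4Frame {p : ℝ} {c : ℂ} (hp : p ≠ 0) (hc : c ≠ 0) :
    ∃ b : Module.Basis (Fin 7) ℝ (Tan C4.base), ∀ i, (b i : C4) = su4Frame p c i := by
  have hi : ∀ x y : C4, ⟪x, y⟫ = (star x.ofLp ⬝ᵥ y.ofLp).re := fun x y => by
    rw [PiLp.inner_apply]
    simp [dotProduct, Complex.inner, mul_comm]
  refine exists_frame C4.finrank _ _ (fun i => ?_) (fun i h => ?_) fun i j hij => ?_
  · rw [hi]
    fin_cases i <;> simp [su4Frame, C4.base, dotProduct, Fin.sum_univ_four]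
  · have h' := congrArg (fun v : C4 => v.ofLp) h
    fin_cases i
    · exact hp (by simpa [su4Frame] using congrFun h' 0)
    · exact hc (by simpa [su4Frame] using congrFun h' 1)
    · exact hc (by simpa [su4Frame] using congrFun h' 1)
    · exact hc (by simpa [su4Frame] using congrFun h' 2)
    · exact hc (by simpa [su4Frame] using congrFun h' 2)
    · exact hc (by simpa [su4Frame] using congrFun h' 3)
    · exact hc (by simpa [su4Frame] using congrFun h' 3)
  · rw [hi]
    fin_cases i <;> fin_cases j <;> first | exact absurd rfl hij | skip
    all_goals simp [su4Frame, dotProduct, Fin.sum_univ_four] <;> ring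

/-- The components, in the frame `su4Frame 1 1`, of the contraction of `ω² / 2` with the base point,
that is, of `η ∧ ω` with `η = ι ω`. -/
def kaehlerTensor (i j k : Fin 7) : ℤ := elem3 0 1 2 i j k + elem3 0 3 4 i j k + elem3 0 5 6 i j k

/-- The components of `Re (dz¹ ∧ dz² ∧ dz³)` in the frame `su4Frame 1 1`. -/
def reTensor (i j k : Fin 7) : ℤ :=
  elem3 1 3 5 i j k - elem3 1 4 6 i j k - elem3 2 3 6 i j k - elem3 2 4 5 i j k

/-- The components of `Im (dz¹ ∧ dz² ∧ dz³)` in the frame `su4Frame 1 1`. -/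
def imTensor (i j k : Fin 7) : ℤ :=
  elem3 1 3 6 i j k + elem3 1 4 5 i j k + elem3 2 3 5 i j k - elem3 2 4 6 i j k

/-- The invariant 3-forms on the unit sphere of `ℂ⁴`, as restrictions of forms on `ℂ⁴`. -/
abbrev su4Form (q : ℝ × ℂ) (y : C4) : C4 [⋀^Fin 3]→L[ℝ] ℝ := (su4FourForm q).curryLeft y

theorem su4FourForm_base (q : ℝ × ℂ) (x y z : C4) :
    su4FourForm q ![(C4.base : C4), x, y, z] =
      q.1 * ((x 0).im * kaehler y z - (y 0).im * kaehler x z + (z 0).im * kaehler x y) +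
        (q.2 * (x 1 * (y 2 * z 3 - y 3 * z 2) - x 2 * (y 1 * z 3 - y 3 * z 1) +
          x 3 * (y 1 * z 2 - y 2 * z 1))).re := by
  have hk : ∀ w, kaehler C4.base w = (w 0).im := fun w => by
    simp [kaehler_apply, C4.base, dotProduct, Fin.sum_univ_four]
  rw [su4FourForm_apply]
  congr 1
  · simp [hk]
  · congr 2
    refine (Matrix.det_succ_row_zero
      (Matrix.of fun i => (![(C4.base : C4), x, y, z] i).ofLp)).trans ?_
    simp [Matrix.det_fin_three, C4.base, Fin.succAbove]
    ring

theorem su4Form_frame (q : ℝ × ℂ) {p : ℝ} {c : ℂ} {b : Module.Basis (Fin 7) ℝ (Tan C4.base)}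
    (hb : ∀ i, (b i : C4) = su4Frame p c i) (i j k : Fin 7) :
    sphereRestrict (su4Form q) C4.base ![b i, b j, b k] =
      q.1 * (p * ‖c‖ ^ 2) * kaehlerTensor i j k + (q.2 * c ^ 3).re * reTensor i j k -
        (q.2 * c ^ 3).im * imTensor i j k := by
  have h1 : ∀ i j k, kaehlerTensor j i k = -kaehlerTensor i j k ∧
    kaehlerTensor i k j = -kaehlerTensor i j k := by decide +kernel
  have h2 : ∀ i j k, reTensor j i k = -reTensor i j k ∧
    reTensor i k j = -reTensor i j k := by decide +kernel
  have h3 : ∀ i j k, imTensor j i k = -imTensor i j k ∧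
    imTensor i k j = -imTensor i j k := by decide +kernel
  refine tensor_eq_of_sorted _ b (fun i j k => q.1 * (p * ‖c‖ ^ 2) * kaehlerTensor i j k +
    (q.2 * c ^ 3).re * reTensor i j k - (q.2 * c ^ 3).im * imTensor i j k)
    (fun i j k => ?_) (fun i j k => ?_) (fun i j k hij hjk => ?_) i j k
  · simp only [(h1 i j k).1, (h2 i j k).1, (h3 i j k).1, Int.cast_neg]
    ring
  · simp only [(h1 i j k).2, (h2 i j k).2, (h3 i j k).2, Int.cast_neg]
    ring
  · rw [sphereRestrict_frame]
    change su4FourForm q ![(C4.base : C4), b i, b j, b k] = _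
    rw [su4FourForm_base, hb, hb, hb, Complex.sq_norm, Complex.normSq_apply]
    fin_cases i <;> fin_cases j <;> first | exact absurd hij (by decide) | skip
    all_goals fin_cases k <;> first | exact absurd hjk (by decide) | skip
    all_goals
      simp [su4Frame, kaehler_apply, dotProduct, Fin.sum_univ_four, kaehlerTensor, reTensor,
        imTensor, elem3, pow_succ]
    all_goals ring

/-- The parameters of an invariant form are three of its components in the unscaled frame. -/
theorem su4Form_frame_one (q : ℝ × ℂ) {b : Module.Basis (Fin 7) ℝ (Tan C4.base)}
    (hb : ∀ i, (b i : C4) = su4Frame 1 1 i) :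
    sphereRestrict (su4Form q) C4.base ![b 0, b 1, b 2] = q.1 ∧
      sphereRestrict (su4Form q) C4.base ![b 1, b 3, b 5] = q.2.re ∧
      sphereRestrict (su4Form q) C4.base ![b 2, b 4, b 6] = q.2.im := by
  simp only [su4Form_frame q hb]
  simp [kaehlerTensor, reTensor, imTensor, elem3]

theorem mem_su4_diagonal {d : Fin 4 → ℂ} (hd : ∀ i, star (d i) * d i = 1) (h : ∏ i, d i = 1) :
    ∃ f ∈ SU4, ∀ v : C4, f v = WithLp.toLp 2 fun i => d i * v i := by
  obtain ⟨f, hf, hfv⟩ := mem_SU4 (A := Matrix.diagonal d)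
    (Matrix.mem_specialUnitaryGroup_iff.2 ⟨by
      rw [Matrix.mem_unitaryGroup_iff', Matrix.star_eq_conjTranspose,
        Matrix.diagonal_conjTranspose, Matrix.diagonal_mul_diagonal, ← Matrix.diagonal_one]
      congr 1
      exact funext hd, by rw [Matrix.det_diagonal, h]⟩)
  refine ⟨f, hf, fun v => ?_⟩
  rw [hfv]
  ext i
  simp [Matrix.mulVec_diagonal]

theorem mem_su4_cycle : ∃ f ∈ SU4, ∀ v : C4, f v = WithLp.toLp 2 ![v 0, v 3, v 1, v 2] := by
  obtain ⟨f, hf, hfv⟩ := mem_SU4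
    (A := !![1, 0, 0, 0; 0, 0, 0, 1; 0, 1, 0, 0; 0, 0, 1, 0])
    (Matrix.mem_specialUnitaryGroup_iff.2 ⟨by
      rw [Matrix.mem_unitaryGroup_iff', Matrix.star_eq_conjTranspose]
      ext i j
      fin_cases i <;> fin_cases j <;> simp [Matrix.mul_apply, Fin.sum_univ_four], by
      rw [Matrix.det_succ_row_zero]
      simp [Fin.sum_univ_four, Matrix.det_fin_three, Fin.succAbove]⟩)
  refine ⟨f, hf, fun v => ?_⟩
  rw [hfv]
  ext i
  fin_cases i <;> simp [Matrix.mulVec, dotProduct, Fin.sum_univ_four]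

/-- The isotropy group `SU(3)` leaves only the three components of `su4Form_frame_one` free. -/
theorem su4_rigid {η : SphereForm C4 3} (hη : ∀ f ∈ SU4, spherePullback f η = η)
    {b : Module.Basis (Fin 7) ℝ (Tan C4.base)} (hb : ∀ i, (b i : C4) = su4Frame 1 1 i)
    (h₀ : η C4.base ![b 0, b 1, b 2] = 0) (h₁ : η C4.base ![b 1, b 3, b 5] = 0)
    (h₂ : η C4.base ![b 2, b 4, b 6] = 0) : η C4.base = 0 := by
  have key : ∀ (d : Fin 4 → ℂ) (_ : ∀ i, star (d i) * d i = 1) (_ : ∏ i, d i = 1) (_ : d 0 = 1)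
      (π : Fin 7 → Fin 7) (ε : Fin 7 → ℤ)
      (_ : ∀ i j, d j * su4Frame 1 1 i j = ε i * su4Frame 1 1 (π i) j) (i j k : Fin 7),
      η C4.base ![b i, b j, b k] =
        (ε i * ε j * ε k : ℤ) * η C4.base ![b (π i), b (π j), b (π k)] := by
    intro d hd hd' h0 π ε h i j k
    obtain ⟨f, hf, hfv⟩ := mem_su4_diagonal hd hd'
    refine apply_signedPerm (hη f hf) ?_ π ε (fun i => ?_) i j k
    · rw [hfv]
      ext i
      by_cases hi : i = 0
      · simp [C4.base, hi, h0]
      · simp [C4.base, hi]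
    · rw [hfv, hb, hb]
      ext j
      simpa using h i j
  have s₁ := key ![1, -1, -1, 1] (by simp [Fin.forall_fin_succ]) (by simp [Fin.prod_univ_four]) rfl
    id ![1, -1, -1, -1, -1, 1, 1] (by simp [Fin.forall_fin_succ, su4Frame])
  have s₂ := key ![1, 1, -1, -1] (by simp [Fin.forall_fin_succ]) (by simp [Fin.prod_univ_four]) rfl
    id ![1, 1, 1, -1, -1, -1, -1] (by simp [Fin.forall_fin_succ, su4Frame])
  have t₁ := key ![1, Complex.I, -Complex.I, 1] (by simp [Fin.forall_fin_succ])
    (by simp [Fin.prod_univ_four]) rfl ![0, 2, 1, 4, 3, 5, 6] ![1, 1, -1, -1, 1, 1, 1]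
    (by simp [Fin.forall_fin_succ, su4Frame])
  have t₂ := key ![1, 1, Complex.I, -Complex.I] (by simp [Fin.forall_fin_succ])
    (by simp [Fin.prod_univ_four]) rfl ![0, 1, 2, 4, 3, 6, 5] ![1, 1, 1, 1, -1, -1, 1]
    (by simp [Fin.forall_fin_succ, su4Frame])
  have r : ∀ i j k : Fin 7, η C4.base ![b i, b j, b k] = η C4.base ![b (![0, 3, 4, 5, 6, 1, 2] i),
      b (![0, 3, 4, 5, 6, 1, 2] j), b (![0, 3, 4, 5, 6, 1, 2] k)] := by
    obtain ⟨f, hf, hfv⟩ := mem_su4_cycle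
    have := apply_signedPerm (hη f hf) (x := C4.base) (b := b) (by
      rw [hfv]
      ext i
      fin_cases i <;> simp [C4.base]) ![0, 3, 4, 5, 6, 1, 2] 1 (fun i => by
      rw [hfv, hb, hb]
      ext j
      fin_cases i <;> fin_cases j <;> simp [su4Frame])
    simpa using this
  -- the sign changes leave eleven components, which the other symmetries relate to three of them
  have hcase : ∀ i j k : Fin 7, i < j → j < k →
      (![1, -1, -1, -1, -1, 1, 1] i * ![1, -1, -1, -1, -1, 1, 1] j *
        ![1, -1, -1, -1, -1, 1, 1] k : ℤ) = -1 ∨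
      (![1, 1, 1, -1, -1, -1, -1] i * ![1, 1, 1, -1, -1, -1, -1] j *
        ![1, 1, 1, -1, -1, -1, -1] k : ℤ) = -1 ∨
      (i, j, k) ∈ [((0, 1, 2) : Fin 7 × Fin 7 × Fin 7), (0, 3, 4), (0, 5, 6), (1, 3, 5), (1, 3, 6),
        (1, 4, 5), (1, 4, 6), (2, 3, 5), (2, 3, 6), (2, 4, 5), (2, 4, 6)] := by decide
  have a₁ := r 0 1 2
  have a₂ := r 0 3 4
  have a₃ := t₁ 1 3 5
  have a₄ := t₂ 1 3 5
  have a₅ := t₁ 2 3 6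
  have a₆ := t₁ 2 4 6
  have a₇ := t₂ 2 4 6
  have a₈ := t₁ 2 3 5
  simp [h₀, h₁, h₂] at a₁ a₂ a₃ a₄ a₅ a₆ a₇ a₈
  refine ext_of_sorted b _ fun i j k hij hjk => ?_
  rcases hcase i j k hij hjk with h | h | h
  · have := s₁ i j k
    rw [h] at this
    simp only [id, Int.cast_neg, Int.cast_one] at this
    linarith
  · have := s₂ i j k
    rw [h] at this
    simp only [id, Int.cast_neg, Int.cast_one] at this
    linarith
  · simp only [List.mem_cons, Prod.mk.injEq, List.not_mem_nil, or_false] at h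
    rcases h with ⟨rfl, rfl, rfl⟩ | ⟨rfl, rfl, rfl⟩ | ⟨rfl, rfl, rfl⟩ | ⟨rfl, rfl, rfl⟩ |
      ⟨rfl, rfl, rfl⟩ | ⟨rfl, rfl, rfl⟩ | ⟨rfl, rfl, rfl⟩ | ⟨rfl, rfl, rfl⟩ | ⟨rfl, rfl, rfl⟩ |
      ⟨rfl, rfl, rfl⟩ | ⟨rfl, rfl, rfl⟩
    all_goals first | assumption | linarith

theorem su4Form_invariant (p : ℝ × ℂ) {f : C4 ≃ₗᵢ[ℝ] C4} (hf : f ∈ SU4) (y : C4) :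
    (su4Form p (f y)).compContinuousLinearMap (f.toContinuousLinearEquiv : C4 →L[ℝ] C4) =
      su4Form p y :=
  curryLeft_invariant (f := (f.toContinuousLinearEquiv : C4 →L[ℝ] C4))
    (fun v => su4FourForm_invariant p hf v) y

theorem su4Form_pullback (p : ℝ × ℂ) {f : C4 ≃ₗᵢ[ℝ] C4} (hf : f ∈ SU4) :
    spherePullback f (sphereRestrict (su4Form p)) = sphereRestrict (su4Form p) :=
  spherePullback_restrict (su4Form p) f fun y => su4Form_invariant p hf y

theorem su4_family : InvariantFamily SU4 C4.base su4Form where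
  finrank := C4.finrank
  transitive := SU4_transitive
  contDiff p := contDiff_curryLeft _
  horizontal p y v i h := curryLeft_horizontal _ y v i h
  invariant p f hf y := su4Form_invariant p hf y
  exhausts η hη := by
    obtain ⟨b, hb⟩ := exists_su4Frame one_ne_zero one_ne_zero
    obtain ⟨q, h₀, h₁, h₂⟩ : ∃ q : ℝ × ℂ, η C4.base ![b 0, b 1, b 2] = q.1 ∧
        η C4.base ![b 1, b 3, b 5] = q.2.re ∧ η C4.base ![b 2, b 4, b 6] = q.2.im :=
      ⟨(_, ⟨_, _⟩), rfl, rfl, rfl⟩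
    obtain ⟨e₀, e₁, e₂⟩ := su4Form_frame_one q hb
    have h : ∀ f ∈ SU4, spherePullback f (η - sphereRestrict (su4Form q)) =
        η - sphereRestrict (su4Form q) := fun f hf => pullback_sub (hη f hf)
      (su4Form_pullback q hf)
    refine ⟨q, sub_eq_zero.1 (su4_rigid h hb (sub_eq_zero.2 (h₀.trans e₀.symm))
      (sub_eq_zero.2 (h₁.trans e₁.symm)) (sub_eq_zero.2 (h₂.trans e₂.symm)))⟩
  injective p q h := by
    obtain ⟨b, hb⟩ := exists_su4Frame one_ne_zero one_ne_zero
    obtain ⟨e₀, e₁, e₂⟩ := su4Form_frame_one p hb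
    obtain ⟨f₀, f₁, f₂⟩ := su4Form_frame_one q hb
    rw [h] at e₀ e₁ e₂
    exact Prod.ext (e₀.symm.trans f₀) (Complex.ext (e₁.symm.trans f₁) (e₂.symm.trans f₂))

theorem kaehlerTensor_add_reTensor (i j k : Fin 7) :
    kaehlerTensor i j k + reTensor i j k = g2Tensor i j k := by
  simp only [kaehlerTensor, reTensor, g2Tensor]
  ring

theorem su4Form_standard {q : ℝ × ℂ} {p : ℝ} {c : ℂ} {b : Module.Basis (Fin 7) ℝ (Tan C4.base)}
    (hb : ∀ i, (b i : C4) = su4Frame p c i) (h₁ : q.1 * (p * ‖c‖ ^ 2) = 1) (h₂ : q.2 * c ^ 3 = 1)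
    (i j k : Fin 7) :
    sphereRestrict (su4Form q) C4.base ![b i, b j, b k] = g2Tensor i j k := by
  rw [su4Form_frame q hb, h₁, h₂, ← kaehlerTensor_add_reTensor]
  push_cast
  simp

theorem su4FourForm_frame (q : ℝ × ℂ) (p : ℝ) (c : ℂ) :
    su4FourForm q ![su4Frame p c 3, su4Frame p c 4, su4Frame p c 5, su4Frame p c 6] =
        q.1 * (‖c‖ ^ 2) ^ 2 ∧
      su4FourForm q ![su4Frame p c 0, su4Frame p c 2, su4Frame p c 4, su4Frame p c 6] =
        p * (q.2 * c ^ 3).re ∧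
      su4FourForm q ![su4Frame p c 0, su4Frame p c 1, su4Frame p c 3, su4Frame p c 5] =
        -(p * (q.2 * c ^ 3).im) := by
  have hI : Complex.I ^ 4 = 1 := Complex.I_pow_four
  refine ⟨?_, ?_, ?_⟩
  · rw [su4FourForm_apply, Matrix.det_eq_zero_of_column_eq_zero 0
      (by simp [Fin.forall_fin_succ, su4Frame]), Complex.sq_norm, Complex.normSq_apply]
    simp [kaehler_apply, su4Frame, dotProduct, Fin.sum_univ_four]
    exact Or.inl (by ring)
  · rw [su4FourForm_apply, ← Complex.re_ofReal_mul, Matrix.det_succ_row_zero]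
    simp [kaehler_apply, su4Frame, dotProduct, Fin.sum_univ_four, Matrix.det_fin_three,
      Fin.succAbove, pow_succ]
    ring
  · rw [su4FourForm_apply, ← Complex.im_ofReal_mul, Matrix.det_succ_row_zero]
    simp [kaehler_apply, su4Frame, dotProduct, Fin.sum_univ_four, Matrix.det_fin_three,
      Fin.succAbove, pow_succ]
    ring

/-- `⋆d` on the family, in terms of the scaling of the frame. -/
theorem su4_star {q : ℝ × ℂ} {p : ℝ} {c : ℂ} (h₁ : q.1 * (p * ‖c‖ ^ 2) = 1)
    (h₂ : q.2 * c ^ 3 = 1) (q' : ℝ × ℂ) :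
    sphereStar (sphereRestrict (su4Form q)) 4 3 rfl (sphereD (sphereRestrict (su4Form q'))) =
      sphereRestrict (su4Form (4 * q'.1 * ‖c‖ ^ 2 / p, (4 * p : ℝ) * q'.2)) := by
  have hp : p ≠ 0 := by rintro rfl; simp at h₁
  have hc : c ≠ 0 := by rintro rfl; simp at h₁
  obtain ⟨b, hb⟩ := exists_su4Frame hp hc
  have std := su4Form_standard hb h₁ h₂
  obtain ⟨r, hr⟩ := su4_family.exists_star_d (isPositive_of_frame std) q'
  have val : ∀ σ : Perm (Fin 7), r.1 * (p * ‖c‖ ^ 2) * kaehlerTensor (σ 4) (σ 5) (σ 6) +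
      (r.2 * c ^ 3).re * reTensor (σ 4) (σ 5) (σ 6) -
        (r.2 * c ^ 3).im * imTensor (σ 4) (σ 5) (σ 6) =
      (Perm.sign σ : ℝ) * (4 * su4FourForm q' ![su4Frame p c (σ 0), su4Frame p c (σ 1),
        su4Frame p c (σ 2), su4Frame p c (σ 3)]) := fun σ => by
    rw [← su4Form_frame r hb, ← hr, ← hb, ← hb, ← hb, ← hb]
    exact sphereStar_curryLeft std (su4FourForm q') σ
  -- permutations of the indices that end in those of the component to be computed
  have e₀ := val ⟨![3, 4, 5, 6, 0, 1, 2], ![4, 5, 6, 0, 1, 2, 3], by decide, by decide⟩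
  have e₁ := val ⟨![0, 2, 4, 6, 1, 3, 5], ![0, 4, 1, 5, 2, 6, 3], by decide, by decide⟩
  have e₂ := val ⟨![0, 1, 3, 5, 2, 4, 6], ![0, 1, 4, 2, 5, 3, 6], by decide, by decide⟩
  rw [show Perm.sign _ = (1 : ℤˣ) by decide] at e₀
  rw [show Perm.sign _ = (1 : ℤˣ) by decide] at e₁
  rw [show Perm.sign _ = (-1 : ℤˣ) by decide] at e₂
  obtain ⟨f₀, f₁, f₂⟩ := su4FourForm_frame q' p c
  simp [f₀, kaehlerTensor, reTensor, imTensor, elem3] at e₀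
  simp [f₁, kaehlerTensor, reTensor, imTensor, elem3] at e₁
  simp [f₂, kaehlerTensor, reTensor, imTensor, elem3] at e₂
  have g₁ : r.1 = 4 * q'.1 * ‖c‖ ^ 2 / p := by
    rw [eq_div_iff hp]
    refine mul_right_cancel₀ (pow_ne_zero 2 (norm_ne_zero_iff.2 hc)) ?_
    linear_combination e₀
  have g₂ : r.2 = (4 * p : ℝ) * q'.2 := by
    refine mul_right_cancel₀ (pow_ne_zero 3 hc) (Complex.ext ?_ ?_)
    · rw [mul_assoc, Complex.re_ofReal_mul, Complex.mul_re, Complex.mul_re, e₁]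
      ring
    · rw [mul_assoc, Complex.im_ofReal_mul, Complex.mul_im, Complex.mul_im, e₂]
      ring
  rw [hr, ← g₁, ← g₂]

/-- The cube root of the norm. -/
def cbrtNorm (z : ℂ) : ℝ := ‖z‖ ^ (1 / 3 : ℝ)

theorem cbrtNorm_nonneg (z : ℂ) : 0 ≤ cbrtNorm z := Real.rpow_nonneg (norm_nonneg z) _

theorem cbrtNorm_pow (z : ℂ) : cbrtNorm z ^ 3 = ‖z‖ := by
  rw [cbrtNorm, ← Real.rpow_natCast, ← Real.rpow_mul (norm_nonneg z)]
  norm_num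

theorem cbrtNorm_pos {z : ℂ} (hz : z ≠ 0) : 0 < cbrtNorm z :=
  Real.rpow_pos_of_pos (norm_pos_iff.2 hz) _

theorem cbrtNorm_eq {z : ℂ} {t : ℝ} (ht : 0 ≤ t) (h : t ^ 3 = ‖z‖) : cbrtNorm z = t :=
  (pow_left_inj₀ (cbrtNorm_nonneg z) ht three_ne_zero).1 (by rw [cbrtNorm_pow, h])

/-- The `G₂`-Laplacian on the parameters of `su4Form`. -/
def su4Laplacian (q : ℝ × ℂ) : ℝ × ℂ :=
  (16 * q.1 ^ 3 / cbrtNorm q.2 ^ 8, ((16 * cbrtNorm q.2 ^ 4 / q.1 ^ 2 : ℝ) : ℂ) * q.2)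

theorem su4Laplacian_bijOn :
    BijOn su4Laplacian {q | q.1 ≠ 0 ∧ q.2 ≠ 0} {q | q.1 ≠ 0 ∧ q.2 ≠ 0} := by
  refine ⟨fun q hq => ?_, fun q hq q' hq' h => ?_, fun q hq => ?_⟩
  · have := cbrtNorm_pos hq.2
    have h1 := hq.1
    refine ⟨by simp only [su4Laplacian]; positivity, mul_ne_zero ?_ hq.2⟩
    rw [Complex.ofReal_ne_zero]
    positivity
  · obtain ⟨h1, h2⟩ := Prod.ext_iff.1 h
    obtain ⟨ha, hz⟩ := hq
    obtain ⟨ha', hz'⟩ := hq'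
    have ht := cbrtNorm_pos hz
    have ht' := cbrtNorm_pos hz'
    have h3 := congrArg norm h2
    simp only [su4Laplacian, norm_mul, Complex.norm_real, Real.norm_eq_abs,
      ← cbrtNorm_pow q.2, ← cbrtNorm_pow q'.2] at h1 h2 h3
    rw [abs_of_nonneg (by positivity), abs_of_nonneg (by positivity)] at h3
    -- with `t = |z| ^ (1/3)`, this combination of the two components eliminates `a`
    have key : ∀ a t : ℝ, a ≠ 0 → t ≠ 0 →
        (16 * a ^ 3 / t ^ 8) ^ 2 * (16 * t ^ 4 / a ^ 2 * t ^ 3) ^ 3 = 16 ^ 5 * t ^ 5 := by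
      intro a t ha ht
      field_simp
    have h5 := key _ _ ha ht.ne'
    rw [h1, h3, key _ _ ha' ht'.ne'] at h5
    have e : cbrtNorm q.2 = cbrtNorm q'.2 :=
      (pow_left_inj₀ ht.le ht'.le (n := 5) (by norm_num)).1 (by linarith)
    rw [e] at h1 h2
    have e' : q.1 = q'.1 := by
      refine (Odd.strictMono_pow (n := 3) (by decide)).injective ?_
      field_simp at h1
      linarith
    rw [e'] at h2
    refine Prod.ext e' (mul_left_cancel₀ ?_ h2)
    rw [Complex.ofReal_ne_zero]
    positivity
  · obtain ⟨ha, hz⟩ := hq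
    have hz' : 0 < ‖q.2‖ := norm_pos_iff.2 hz
    obtain ⟨t, ht, h5⟩ : ∃ t : ℝ, 0 < t ∧ t ^ 5 = q.1 ^ 2 * ‖q.2‖ ^ 3 / 16 ^ 5 := by
      refine ⟨(q.1 ^ 2 * ‖q.2‖ ^ 3 / 16 ^ 5) ^ (1 / 5 : ℝ), by positivity, ?_⟩
      rw [← Real.rpow_natCast, ← Real.rpow_mul (by positivity)]
      norm_num
    set a := q.1 * ‖q.2‖ * t / 256 with hadef
    have ha0 : a ≠ 0 := by positivity
    have hn : cbrtNorm (((a ^ 2 / (16 * t ^ 4) : ℝ) : ℂ) * q.2) = t := by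
      refine cbrtNorm_eq ht.le ?_
      rw [norm_mul, Complex.norm_real, Real.norm_eq_abs, abs_of_nonneg (by positivity), hadef]
      field_simp
      linear_combination (16 : ℝ) ^ 5 * h5
    refine ⟨(a, ((a ^ 2 / (16 * t ^ 4) : ℝ) : ℂ) * q.2), ⟨ha0, mul_ne_zero ?_ hz⟩, ?_⟩
    · rw [Complex.ofReal_ne_zero]
      positivity
    · refine Prod.ext ?_ ?_
      · simp only [su4Laplacian, hn]
        rw [hadef]
        field_simp
        linear_combination (- (16 : ℝ) ^ 6) * h5
      · simp only [su4Laplacian, hn]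
        rw [← mul_assoc, ← Complex.ofReal_mul]
        have : 16 * t ^ 4 / a ^ 2 * (a ^ 2 / (16 * t ^ 4)) = 1 := by field_simp
        rw [this, Complex.ofReal_one, one_mul]

/-- The scaling that makes the frame standard. -/
theorem exists_su4_scale {q : ℝ × ℂ} (ha : q.1 ≠ 0) (hz : q.2 ≠ 0) :
    ∃ (p : ℝ) (c : ℂ), q.1 * (p * ‖c‖ ^ 2) = 1 ∧ q.2 * c ^ 3 = 1 := by
  obtain ⟨c, hc⟩ := IsAlgClosed.exists_pow_nat_eq q.2⁻¹ (n := 3) (by norm_num)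
  have hc0 : c ≠ 0 := by
    rintro rfl
    rw [zero_pow (by norm_num)] at hc
    exact hz (inv_eq_zero.1 hc.symm)
  have := norm_ne_zero_iff.2 hc0
  refine ⟨(q.1 * ‖c‖ ^ 2)⁻¹, c, by field_simp, by rw [hc, mul_inv_cancel₀ hz]⟩

/-- If a parameter vanishes, then scaling the frame leaves a form with components `kaehlerTensor`,
`reTensor` or zero, which is degenerate. -/
theorem su4_isPositive_iff (q : ℝ × ℂ) :
    IsPositive (sphereRestrict (su4Form q) C4.base) ↔ q ∈ {q : ℝ × ℂ | q.1 ≠ 0 ∧ q.2 ≠ 0} := by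
  constructor
  · refine fun h => ⟨fun ha => ?_, fun hz => ?_⟩ <;> revert h
    · by_cases hz : q.2 = 0
      · obtain ⟨b, hb⟩ := exists_su4Frame one_ne_zero one_ne_zero
        refine not_isPositive_of_frame (b := b) (fun _ _ _ => 0) (fun i j k => ?_) 0 0
          (by decide +kernel)
        rw [su4Form_frame q hb, ha, hz]
        simp
      · obtain ⟨c, hc⟩ := IsAlgClosed.exists_pow_nat_eq q.2⁻¹ (n := 3) (by norm_num)
        have hc0 : c ≠ 0 := by
          rintro rfl
          rw [zero_pow (by norm_num)] at hc
          exact hz (inv_eq_zero.1 hc.symm)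
        obtain ⟨b, hb⟩ := exists_su4Frame one_ne_zero hc0
        refine not_isPositive_of_frame (b := b) reTensor (fun i j k => ?_) 0 0 (by decide +kernel)
        rw [su4Form_frame q hb, ha, hc, mul_inv_cancel₀ hz]
        simp
    · by_cases ha : q.1 = 0
      · obtain ⟨b, hb⟩ := exists_su4Frame one_ne_zero one_ne_zero
        refine not_isPositive_of_frame (b := b) (fun _ _ _ => 0) (fun i j k => ?_) 0 0
          (by decide +kernel)
        rw [su4Form_frame q hb, ha, hz]
        simp
      · obtain ⟨b, hb⟩ := exists_su4Frame (inv_ne_zero ha) one_ne_zero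
        refine not_isPositive_of_frame (b := b) kaehlerTensor (fun i j k => ?_) 1 1
          (by decide +kernel)
        rw [su4Form_frame q hb, hz]
        simp [ha]
  · rintro ⟨ha, hz⟩
    obtain ⟨p, c, h₁, h₂⟩ := exists_su4_scale ha hz
    have hp : p ≠ 0 := by rintro rfl; simp at h₁
    have hc : c ≠ 0 := by rintro rfl; simp at h₁
    obtain ⟨b, hb⟩ := exists_su4Frame hp hc
    exact isPositive_of_frame (su4Form_standard hb h₁ h₂)

theorem su4Laplacian_eq {q : ℝ × ℂ} {p : ℝ} {c : ℂ} (h₁ : q.1 * (p * ‖c‖ ^ 2) = 1)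
    (h₂ : q.2 * c ^ 3 = 1) : su4Laplacian q =
      (4 * (4 * q.1 * ‖c‖ ^ 2 / p) * ‖c‖ ^ 2 / p, (4 * p : ℝ) * ((4 * p : ℝ) * q.2)) := by
  have hp : p ≠ 0 := by rintro rfl; simp at h₁
  have hc : c ≠ 0 := by rintro rfl; simp at h₁
  have hc' := norm_ne_zero_iff.2 hc
  have ht : cbrtNorm q.2 = ‖c‖⁻¹ := by
    refine cbrtNorm_eq (by positivity) ?_
    have := congrArg norm h₂
    rw [norm_mul, norm_pow, norm_one] at this
    rw [inv_pow]
    exact (eq_inv_of_mul_eq_one_left this).symm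
  have ha : q.1 = (p * ‖c‖ ^ 2)⁻¹ := eq_inv_of_mul_eq_one_left h₁
  refine Prod.ext ?_ ?_
  · simp only [su4Laplacian, ht, ha]
    field_simp
    ring
  · simp only [su4Laplacian, ht, ha]
    rw [← mul_assoc, ← Complex.ofReal_mul]
    congr 2
    field_simp
    ring

theorem g2Laplacian_bijOn_SU4 :
    BijOn g2Laplacian (positiveInvariantForms SU4) (positiveInvariantForms SU4) ∧
      (∀ φ ∈ positiveInvariantForms SU4, SameOrientation φ (g2Laplacian φ)) ∧
      ∀ μ ∈ positiveInvariantForms SU4,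
        ∃! φ, φ ∈ positiveInvariantForms SU4 ∧ g2Laplacian φ = μ := by
  refine su4_family.g2Laplacian_bijOn su4Laplacian {q | q.1 ≠ 0 ∧ q.2 ≠ 0} su4_isPositive_iff
    (fun q hq => ?_) su4Laplacian_bijOn fun q hq => ?_
  · obtain ⟨p, c, h₁, h₂⟩ := exists_su4_scale hq.1 hq.2
    have hp : p ≠ 0 := by rintro rfl; simp at h₁
    have hc : c ≠ 0 := by rintro rfl; simp at h₁
    have hc' := norm_ne_zero_iff.2 hc
    refine ⟨_, (q.1 * p / (4 * ‖c‖ ^ 2), ((4 * p)⁻¹ : ℝ) * q.2), su4_star h₁ h₂ q, ?_, ?_⟩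
    · rw [su4_star h₁ h₂, su4Laplacian_eq h₁ h₂]
    · rw [su4_star h₁ h₂]
      congr 2
      refine Prod.ext ?_ ?_
      · field_simp
      · rw [← mul_assoc, ← Complex.ofReal_mul, mul_inv_cancel₀ (by positivity),
          Complex.ofReal_one, one_mul]
  · obtain ⟨p, c, h₁, h₂⟩ := exists_su4_scale hq.1 hq.2
    have hp : p ≠ 0 := by rintro rfl; simp at h₁
    have hc : c ≠ 0 := by rintro rfl; simp at h₁
    have hc' := norm_pos_iff.2 hc
    obtain ⟨l, hl, hl3⟩ : ∃ l : ℝ, 0 < l ∧ (16 * p ^ 2) * l ^ 3 = 1 := by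
      have h : 0 < 16 * p ^ 2 := by positivity
      refine ⟨((16 * p ^ 2)⁻¹) ^ (1 / 3 : ℝ), by positivity, ?_⟩
      rw [← Real.rpow_natCast (_ ^ (1 / 3 : ℝ)), ← Real.rpow_mul (by positivity)]
      norm_num
      field_simp
    have ha : q.1 = (p * ‖c‖ ^ 2)⁻¹ := eq_inv_of_mul_eq_one_left h₁
    have hn : ‖(l : ℂ) * c‖ = l * ‖c‖ := by
      rw [norm_mul, Complex.norm_real, Real.norm_eq_abs, abs_of_pos hl]
    have h₁' : (su4Laplacian q).1 * (p ^ 3 / (16 * l ^ 2 * ‖c‖ ^ 4) *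
        ‖(l : ℂ) * c‖ ^ 2) = 1 := by
      rw [su4Laplacian_eq h₁ h₂, hn, ha]
      field_simp
      norm_num
    have h₂' : (su4Laplacian q).2 * ((l : ℂ) * c) ^ 3 = 1 := by
      rw [su4Laplacian_eq h₁ h₂]
      have : (16 * p ^ 2 * l ^ 3 : ℂ) = 1 := by exact_mod_cast hl3
      push_cast
      linear_combination (16 * p ^ 2 * l ^ 3 : ℂ) * h₂ + this
    obtain ⟨b, hb⟩ := exists_su4Frame hp hc
    obtain ⟨b', hb'⟩ := exists_su4Frame (p := p ^ 3 / (16 * l ^ 2 * ‖c‖ ^ 4)) (c := (l : ℂ) * c)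
      (by positivity) (mul_ne_zero (Complex.ofReal_ne_zero.2 hl.ne') hc)
    refine exists_inducedVolume_smul (su4Form_standard hb h₁ h₂) (su4Form_standard hb' h₁' h₂')
      ![16 * l ^ 2 * ‖c‖ ^ 4 / p ^ 2, l⁻¹, l⁻¹, l⁻¹, l⁻¹, l⁻¹, l⁻¹] (fun i => ?_) fun i => ?_
    · fin_cases i <;> simp <;> positivity
    · refine Subtype.ext ?_
      rw [Submodule.coe_smul, hb, hb']
      ext j
      have hl' : (l : ℂ) ≠ 0 := Complex.ofReal_ne_zero.2 hl.ne'
      have hp' : (p : ℂ) ≠ 0 := Complex.ofReal_ne_zero.2 hp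
      have hc'' : (‖c‖ : ℂ) ≠ 0 := Complex.ofReal_ne_zero.2 hc'.ne'
      fin_cases i <;> fin_cases j <;> simp [su4Frame] <;> field_simp

end SU4

/-! ### The group `Spin(7)` -/

section Spin7

theorem Oct.inner_eq (x y : Oct) : ⟪x, y⟫ = x.fst.re * y.fst.re + x.fst.imI * y.fst.imI +
    x.fst.imJ * y.fst.imJ + x.fst.imK * y.fst.imK + (x.snd.re * y.snd.re + x.snd.imI * y.snd.imI +
    x.snd.imJ * y.snd.imJ + x.snd.imK * y.snd.imK) := by
  rw [WithLp.prod_inner_apply, Quaternion.inner_def, Quaternion.inner_def]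
  simp

/-- The imaginary part of the octonion `y x̄`, an alternating map that is adjoint to the left
multiplication: `⟨a, octCross x y⟩ = ⟨a x, y⟩`. -/
def octCross : Oct →ₗ[ℝ] Oct →ₗ[ℝ] Oct :=
  LinearMap.mk₂ ℝ (fun x y => WithLp.toLp 2
      ((y.fst * star x.fst + star x.snd * y.snd).im, y.snd * x.fst - x.snd * y.fst))
    (fun x x' y => by refine oct_ext ?_ ?_ <;> ext <;> simp <;> ring)
    (fun c x y => by refine oct_ext ?_ ?_ <;> ext <;> simp <;> ring)
    (fun x y y' => by refine oct_ext ?_ ?_ <;> ext <;> simp <;> ring)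
    (fun c x y => by refine oct_ext ?_ ?_ <;> ext <;> simp <;> ring)

theorem octCross_self (x : Oct) : octCross x x = 0 := by
  refine oct_ext ?_ ?_ <;> ext <;> simp [octCross] <;> ring

theorem octCross_re (x y : Oct) : (octCross x y).fst.re = 0 := by
  simp [octCross]

theorem octMul_octCross (x y : Oct) :
    octMul ⟨octCross x y, octCross_re x y⟩ x = ⟪x, x⟫ • y - ⟪x, y⟫ • x := by
  rw [Oct.inner_eq, Oct.inner_eq]
  refine oct_ext ?_ ?_ <;> ext <;> simp [octCross, octMul] <;> ring

theorem inner_octCross (a : ImOct) (x y : Oct) : ⟪(a : Oct), octCross x y⟫ = ⟪octMul a x, y⟫ := by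
  have ha : (a : Oct).fst.re = 0 := a.2
  rw [Oct.inner_eq, Oct.inner_eq]
  simp [octCross, octMul, ha]
  ring

theorem inner_octMul_octMul (u : ImOct) (x y : Oct) :
    ⟪octMul u x, octMul u y⟫ = ⟪(u : Oct), u⟫ * ⟪x, y⟫ := by
  have hu : (u : Oct).fst.re = 0 := u.2
  rw [Oct.inner_eq, Oct.inner_eq, Oct.inner_eq]
  simp [octMul, hu]
  ring

theorem inner_octMul_right (u : ImOct) (x y : Oct) : ⟪x, octMul u y⟫ = -⟪octMul u x, y⟫ := by
  have hu : (u : Oct).fst.re = 0 := u.2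
  rw [Oct.inner_eq, Oct.inner_eq]
  simp [octMul, hu]
  ring

theorem octMul_comm (a u : ImOct) (x : Oct) :
    octMul a (octMul u x) = -octMul u (octMul a x) - (2 * ⟪(a : Oct), u⟫) • x := by
  have h : ∀ v, octMul v (octMul v x) = -⟪(v : Oct), v⟫ • x := fun v => by
    rw [← Module.End.mul_apply, octMul_sq]
    rfl
  have h' := h (a + u)
  simp only [map_add, LinearMap.add_apply, h, Submodule.coe_add, inner_add_left, inner_add_right,
    real_inner_comm (a : Oct) u] at h'
  refine sub_eq_zero.1 (Eq.trans ?_ (sub_eq_zero.2 h'))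
  module

/-- Left multiplication by `u` acts on the values of `octCross` by a scaled reflection. -/
theorem octCross_octMul (u : ImOct) (x y : Oct) :
    octCross (octMul u x) (octMul u y) =
      (2 * ⟪(u : Oct), octCross x y⟫) • (u : Oct) - ⟪(u : Oct), u⟫ • octCross x y := by
  have hu : (u : Oct).fst.re = 0 := u.2
  let w : ImOct := ⟨octCross (octMul u x) (octMul u y) -
    ((2 * ⟪(u : Oct), octCross x y⟫) • (u : Oct) - ⟪(u : Oct), u⟫ • octCross x y),
    show (WithLp.fst (_ - _ : Oct)).re = 0 by simp [octCross_re, hu]⟩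
  have hw : ∀ a : ImOct, ⟪(a : Oct), w⟫ = 0 := fun a => by
    simp only [w, inner_sub_right, inner_smul_right, inner_octCross]
    rw [octMul_comm, inner_sub_left, inner_neg_left, inner_octMul_octMul, real_inner_smul_left,
      inner_octMul_right]
    ring
  exact sub_eq_zero.1 (inner_self_eq_zero.1 (hw w))

/-- The `Spin(7)`-invariant 4-form on the octonions. -/
def spin7FourForm : Oct [⋀^Fin 4]→L[ℝ] ℝ := (squareForm octCross octCross_self).toContinuous

theorem spin7FourForm_apply (v : Fin 4 → Oct) : spin7FourForm v =
    ⟪octCross (v 0) (v 1), octCross (v 2) (v 3)⟫ - ⟪octCross (v 0) (v 2), octCross (v 1) (v 3)⟫ +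
      ⟪octCross (v 0) (v 3), octCross (v 1) (v 2)⟫ := rfl

theorem spin7FourForm_octMul (u : ImOct) (v : Fin 4 → Oct) :
    spin7FourForm (octMul u ∘ v) = ⟪(u : Oct), u⟫ ^ 2 * spin7FourForm v := by
  have h : ∀ x y z w : Oct, ⟪octCross (octMul u x) (octMul u y), octCross (octMul u z)
      (octMul u w)⟫ = ⟪(u : Oct), u⟫ ^ 2 * ⟪octCross x y, octCross z w⟫ := fun x y z w => by
    rw [octCross_octMul, octCross_octMul]
    simp only [inner_sub_left, inner_sub_right, inner_smul_left, inner_smul_right,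
      real_inner_comm (u : Oct), conj_trivial]
    ring
  simp only [spin7FourForm_apply, Function.comp_apply, h]
  ring

/-- The elements of the Lipschitz group act by similarities that scale the invariant 4-form. -/
theorem lipschitz_scales {g : (CliffordAlgebra octForm)ˣ} (hg : g ∈ lipschitzGroup octForm) :
    ∃ c : ℝ, c ≠ 0 ∧ (∀ x, ⟪cliffordRep g x, cliffordRep g x⟫ = c * ⟪x, x⟫) ∧
      ∀ v, spin7FourForm (cliffordRep g ∘ v) = c ^ 2 * spin7FourForm v := by
  induction hg using Subgroup.closure_induction with
  | mem g hg =>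
    obtain ⟨u, hu⟩ := hg
    have hr : ∀ x, cliffordRep g x = octMul u x := fun x => by
      rw [← hu, cliffordRep, CliffordAlgebra.lift_ι_apply]
    refine ⟨⟪(u : Oct), u⟫, fun h0 => ?_, fun x => ?_, fun v => ?_⟩
    · have hz : u = 0 := Subtype.ext (inner_self_eq_zero.1 h0)
      have : (1 : CliffordAlgebra octForm) = 0 := by
        rw [← g.mul_inv, ← hu, hz, map_zero, zero_mul]
      exact one_ne_zero this
    · rw [hr, inner_octMul_octMul]
    · rw [show cliffordRep g ∘ v = octMul u ∘ v from funext fun i => hr _, spin7FourForm_octMul]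
  | one => exact ⟨1, one_ne_zero, by simp, fun v => by simp [Function.comp_def]⟩
  | mul g g' _ _ h h' =>
    obtain ⟨c, hc, h₁, h₂⟩ := h
    obtain ⟨c', hc', h₁', h₂'⟩ := h'
    refine ⟨c * c', mul_ne_zero hc hc', fun x => ?_, fun v => ?_⟩
    · rw [Units.val_mul, map_mul, Module.End.mul_apply, h₁, h₁', mul_assoc]
    · rw [Units.val_mul, map_mul]
      refine (h₂ (cliffordRep g' ∘ v)).trans ?_
      rw [h₂']
      ring
  | inv g _ h =>
    obtain ⟨c, hc, h₁, h₂⟩ := h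
    have hi : ∀ x, cliffordRep g (cliffordRep (g⁻¹ : (CliffordAlgebra octForm)ˣ) x) = x :=
        fun x => by
      rw [← Module.End.mul_apply, ← map_mul, g.mul_inv, map_one, Module.End.one_apply]
    refine ⟨c⁻¹, inv_ne_zero hc, fun x => ?_, fun v => ?_⟩
    · rw [eq_inv_mul_iff_mul_eq₀ hc, ← h₁, hi]
    · rw [inv_pow, eq_inv_mul_iff_mul_eq₀ (pow_ne_zero 2 hc), ← h₂]
      congr 1
      exact funext fun i => hi _

theorem spin7FourForm_invariant {f : Oct ≃ₗᵢ[ℝ] Oct} (hf : f ∈ Spin7) (v : Fin 4 → Oct) :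
    spin7FourForm (f ∘ v) = spin7FourForm v := by
  obtain ⟨s, rfl⟩ := hf
  obtain ⟨g, hg, hs⟩ := (pinGroup.mem_iff.1 (spinGroup.mem_pin s.2)).1
  obtain ⟨c, -, h₁, h₂⟩ := lipschitz_scales hg
  have hgs : (g : CliffordAlgebra octForm) = s := hs
  rw [hgs] at h₁ h₂
  have hc : c = 1 := by
    have h0 : (WithLp.toLp 2 (1, 0) : Oct) ≠ 0 := fun h => by
      simpa using congrArg (fun x : Oct => x.fst.re) h
    have := h₁ (WithLp.toLp 2 (1, 0))
    rw [real_inner_self_eq_norm_sq, real_inner_self_eq_norm_sq] at this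
    rw [show ‖cliffordRep (s : CliffordAlgebra octForm) (WithLp.toLp 2 (1, 0))‖ = _ from
      spin7Rep_norm s _] at this
    have hn := norm_ne_zero_iff.2 h0
    field_simp at this
    exact this.symm
  have := h₂ v
  rw [hc, one_pow, one_mul] at this
  exact this

/-- The product of four imaginary octonions of total norm `1` is in `Spin(7)`. -/
theorem mem_Spin7 {a b c d : ImOct}
    (h : ⟪(a : Oct), a⟫ * ⟪(b : Oct), b⟫ * ⟪(c : Oct), c⟫ * ⟪(d : Oct), d⟫ = 1) :
    ∃ f ∈ Spin7, ∀ x, f x = octMul a (octMul b (octMul c (octMul d x))) := by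
  have hQ : ∀ u : ImOct, octForm u = -⟪(u : Oct), u⟫ := fun u => rfl
  have hu : ∀ u : ImOct, ⟪(u : Oct), u⟫ ≠ 0 →
      ∃ g ∈ lipschitzGroup octForm,
        (g : CliffordAlgebra octForm) = CliffordAlgebra.ι octForm u := by
    intro u hu
    have : Invertible (octForm u) := invertibleOfNonzero (by rw [hQ]; exact neg_ne_zero.2 hu)
    have := CliffordAlgebra.invertibleιOfInvertible octForm u
    exact ⟨unitOfInvertible (CliffordAlgebra.ι octForm u), Subgroup.subset_closure ⟨u, rfl⟩, rfl⟩
  have hne : ⟪(a : Oct), a⟫ * ⟪(b : Oct), b⟫ * ⟪(c : Oct), c⟫ * ⟪(d : Oct), d⟫ ≠ 0 := by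
    rw [h]; exact one_ne_zero
  simp only [mul_ne_zero_iff] at hne
  obtain ⟨ga, hga, ea⟩ := hu a hne.1.1.1
  obtain ⟨gb, hgb, eb⟩ := hu b hne.1.1.2
  obtain ⟨gc, hgc, ec⟩ := hu c hne.1.2
  obtain ⟨gd, hgd, ed⟩ := hu d hne.2
  let ι := CliffordAlgebra.ι octForm
  have hsq : ∀ u, ι u * ι u = algebraMap ℝ _ (-⟪(u : Oct), u⟫) :=
    CliffordAlgebra.ι_sq_scalar octForm
  have hs : ι a * ι b * ι c * ι d ∈ spinGroup octForm := by
    refine spinGroup.mem_iff.2 ⟨pinGroup.mem_iff.2 ⟨⟨ga * gb * gc * gd,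
      mul_mem (mul_mem (mul_mem hga hgb) hgc) hgd, ?_⟩, ?_⟩, ?_⟩
    · change ((ga * gb * gc * gd : (CliffordAlgebra octForm)ˣ) : CliffordAlgebra octForm) = _
      push_cast
      rw [ea, eb, ec, ed]
    · have h1 : ∀ x y z w : ImOct, ι x * (ι y * (ι z * (ι w * (ι w * (ι z * (ι y * ι x)))))) =
          algebraMap ℝ _ (⟪(x : Oct), x⟫ * ⟪(y : Oct), y⟫ * ⟪(z : Oct), z⟫ * ⟪(w : Oct), w⟫) := by
        intro x y z w
        rw [← mul_assoc (ι w) (ι w), hsq, Algebra.left_comm, ← mul_assoc (ι z) (ι z), hsq,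
          Algebra.left_comm (ι y), Algebra.left_comm (ι y), ← mul_assoc (ι y) (ι y), hsq,
          Algebra.left_comm (ι x), Algebra.left_comm (ι x), Algebra.left_comm (ι x), hsq,
          ← map_mul, ← map_mul, ← map_mul]
        congr 1
        ring
      have hst : ∀ u, star (ι u) = -ι u := CliffordAlgebra.star_ι
      rw [Unitary.mem_iff]
      simp only [star_mul, hst, mul_assoc, neg_mul, mul_neg, neg_neg, h1]
      refine ⟨?_, ?_⟩
      · rw [← map_one (algebraMap ℝ (CliffordAlgebra octForm)), ← h]
        congr 1
        ring
      · rw [← map_one (algebraMap ℝ (CliffordAlgebra octForm)), ← h]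
        congr 1
        ring
    · rw [mul_assoc]
      exact mul_mem (CliffordAlgebra.ι_mul_ι_mem_evenOdd_zero _ _ _)
        (CliffordAlgebra.ι_mul_ι_mem_evenOdd_zero _ _ _)
  refine ⟨_, ⟨⟨_, hs⟩, rfl⟩, fun x => ?_⟩
  change cliffordRep (ι a * ι b * ι c * ι d) x = _
  have hr : ∀ u, cliffordRep (ι u) = octMul u := fun u =>
    CliffordAlgebra.lift_ι_apply octMul octMul_sq u
  simp only [map_mul, hr, Module.End.mul_apply]

theorem Oct.finrank : Module.finrank ℝ Oct = 8 := by
  rw [(WithLp.linearEquiv 2 ℝ (ℍ × ℍ)).finrank_eq, Module.finrank_prod,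
    Quaternion.finrank_eq_four]

/-- The unit octonion, the base point of the unit sphere. -/
def Oct.base : sphere (0 : Oct) 1 := ⟨WithLp.toLp 2 (1, 0), by
  rw [mem_sphere_zero_iff_norm, ← sq_eq_sq₀ (norm_nonneg _) zero_le_one,
    ← real_inner_self_eq_norm_sq, Oct.inner_eq]
  simp⟩

/-- The octonion units `i, j, k, l, li, lj, -lk`, in an order and with signs for which the
3-form `⟨xy, z⟩` has the standard components. -/
def octUnit : Fin 7 → Oct := fun i => WithLp.toLp 2 <|
  ![(⟨0, 1, 0, 0⟩, 0), (⟨0, 0, 1, 0⟩, 0), (⟨0, 0, 0, 1⟩, 0), (0, ⟨1, 0, 0, 0⟩),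
    (0, ⟨0, 1, 0, 0⟩), (0, ⟨0, 0, 1, 0⟩), (0, ⟨0, 0, 0, -1⟩)] i

theorem octUnit_re (i : Fin 7) : (octUnit i).fst.re = 0 := by
  fin_cases i <;> rfl

theorem octUnit_inner (i j : Fin 7) : ⟪octUnit i, octUnit j⟫ = if i = j then 1 else 0 := by
  rw [Oct.inner_eq]
  fin_cases i <;> fin_cases j <;> simp [octUnit]

theorem exists_octFrame {l : ℝ} (hl : l ≠ 0) :
    ∃ b : Module.Basis (Fin 7) ℝ (Tan Oct.base), ∀ i, (b i : Oct) = l • octUnit i := by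
  refine exists_frame Oct.finrank _ _ (fun i => ?_) (fun i h => ?_) fun i j hij => ?_
  · rw [inner_smul_right, Oct.inner_eq]
    fin_cases i <;> simp [octUnit, Oct.base]
  · have h1 := octUnit_inner i i
    rw [(smul_eq_zero.1 h).resolve_left hl] at h1
    simp at h1
  · rw [inner_smul_left, inner_smul_right, octUnit_inner, if_neg hij, mul_zero, mul_zero]

/-- The invariant 3-forms on the unit sphere of the octonions, as restrictions of forms. -/
abbrev spin7Form (c : ℝ) (y : Oct) : Oct [⋀^Fin 3]→L[ℝ] ℝ :=
  ((c / 3) • spin7FourForm).curryLeft y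

theorem spin7FourForm_base {x y z : Oct} (hx : x.fst.re = 0) (hy : y.fst.re = 0)
    (hz : z.fst.re = 0) : spin7FourForm ![(Oct.base : Oct), x, y, z] =
      3 * ⟪x, octCross y z⟫ := by
  have h : ∀ w : Oct, w.fst.re = 0 → octCross Oct.base w = w := fun w hw => by
    refine oct_ext ?_ ?_ <;> ext <;> simp [octCross, Oct.base, hw]
  rw [spin7FourForm_apply]
  change ⟪octCross Oct.base x, octCross y z⟫ - ⟪octCross Oct.base y, octCross x z⟫ +
    ⟪octCross Oct.base z, octCross x y⟫ = _
  rw [h x hx, h y hy, h z hz, Oct.inner_eq, Oct.inner_eq, Oct.inner_eq]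
  simp [octCross, hx, hy, hz]
  ring

theorem spin7Form_frame (c : ℝ) {l : ℝ} {b : Module.Basis (Fin 7) ℝ (Tan Oct.base)}
    (hb : ∀ i, (b i : Oct) = l • octUnit i) (i j k : Fin 7) :
    sphereRestrict (spin7Form c) Oct.base ![b i, b j, b k] = c * l ^ 3 * g2Tensor i j k := by
  have h1 : ∀ i j k, g2Tensor j i k = -g2Tensor i j k ∧
    g2Tensor i k j = -g2Tensor i j k := by decide +kernel
  refine tensor_eq_of_sorted _ b (fun i j k => c * l ^ 3 * g2Tensor i j k)
    (fun i j k => ?_) (fun i j k => ?_) (fun i j k hij hjk => ?_) i j k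
  · rw [(h1 i j k).1]
    push_cast
    ring
  · rw [(h1 i j k).2]
    push_cast
    ring
  · rw [sphereRestrict_frame]
    change c / 3 * spin7FourForm ![(Oct.base : Oct), b i, b j, b k] = _
    rw [hb, hb, hb, spin7FourForm_base (by simp [octUnit_re]) (by simp [octUnit_re])
      (by simp [octUnit_re])]
    simp only [map_smul, LinearMap.smul_apply, inner_smul_left, inner_smul_right, Oct.inner_eq]
    simp [octCross, octUnit_re]
    fin_cases i <;> fin_cases j <;> first | exact absurd hij (by decide) | skip
    all_goals fin_cases k <;> first | exact absurd hjk (by decide) | skip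
    all_goals
      simp [octUnit, g2Tensor, elem3]
    all_goals ring

theorem spin7FourForm_frame (l : ℝ) : spin7FourForm
    ![l • octUnit 3, l • octUnit 4, l • octUnit 5, l • octUnit 6] = 3 * l ^ 4 := by
  rw [spin7FourForm_apply]
  change ⟪octCross (l • octUnit 3) (l • octUnit 4), octCross (l • octUnit 5) (l • octUnit 6)⟫ -
    ⟪octCross (l • octUnit 3) (l • octUnit 5), octCross (l • octUnit 4) (l • octUnit 6)⟫ +
    ⟪octCross (l • octUnit 3) (l • octUnit 6), octCross (l • octUnit 4) (l • octUnit 5)⟫ = _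
  simp only [map_smul, LinearMap.smul_apply, inner_smul_left, inner_smul_right, Oct.inner_eq]
  simp [octCross]
  simp [octUnit]
  ring

/-- The octonion units `octUnit i` as imaginary octonions. -/
def imUnit (i : Fin 7) : ImOct := ⟨octUnit i, octUnit_re i⟩

/-- The basis of the octonions formed by `1` and the units `octUnit i`. -/
def octBasis : Fin 8 → Oct := Fin.cons (Oct.base : Oct) octUnit

/-- The signs in the multiplication table of the octonion units. -/
def octSign (i : Fin 7) (j : Fin 8) : ℤ :=
  !![1, -1, 1, -1, 1, -1, 1, -1; 1, -1, -1, 1, 1, -1, -1, 1; 1, 1, -1, -1, -1, -1, 1, 1;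
    1, -1, -1, 1, -1, 1, 1, -1; 1, 1, 1, 1, -1, -1, -1, -1; 1, -1, 1, -1, -1, 1, -1, 1;
    1, 1, -1, -1, 1, 1, -1, -1] i j

theorem octBasis_coord (j : Fin 8) :
    (octBasis j).fst.re = (![1, 0, 0, 0, 0, 0, 0, 0] j : ℤ) ∧
    (octBasis j).fst.imI = (![0, 1, 0, 0, 0, 0, 0, 0] j : ℤ) ∧
    (octBasis j).fst.imJ = (![0, 0, 1, 0, 0, 0, 0, 0] j : ℤ) ∧
    (octBasis j).fst.imK = (![0, 0, 0, 1, 0, 0, 0, 0] j : ℤ) ∧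
    (octBasis j).snd.re = (![0, 0, 0, 0, 1, 0, 0, 0] j : ℤ) ∧
    (octBasis j).snd.imI = (![0, 0, 0, 0, 0, 1, 0, 0] j : ℤ) ∧
    (octBasis j).snd.imJ = (![0, 0, 0, 0, 0, 0, 1, 0] j : ℤ) ∧
    (octBasis j).snd.imK = (![0, 0, 0, 0, 0, 0, 0, -1] j : ℤ) := by
  induction j using Fin.cases with
  | zero => simp [octBasis, Oct.base]
  | succ j =>
    rw [show octBasis j.succ = octUnit j from rfl]
    fin_cases j <;> simp [octUnit]

/-- Up to sign, the octonion units multiply like the vectors of `𝔽₂³`. -/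
theorem octMul_octBasis (i : Fin 7) (j : Fin 8) :
    octMul (imUnit i) (octBasis j) = (octSign i j : ℝ) • octBasis (i.succ ^^^ j) := by
  have h : octMul (imUnit i) (octBasis j) = WithLp.toLp 2
      ((octBasis i.succ).fst * (octBasis j).fst - star (octBasis j).snd * (octBasis i.succ).snd,
        (octBasis j).snd * (octBasis i.succ).fst +
          (octBasis i.succ).snd * star (octBasis j).fst) := rfl
  rw [h]
  obtain ⟨a₀, a₁, a₂, a₃, a₄, a₅, a₆, a₇⟩ := octBasis_coord i.succ
  obtain ⟨b₀, b₁, b₂, b₃, b₄, b₅, b₆, b₇⟩ := octBasis_coord j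
  obtain ⟨c₀, c₁, c₂, c₃, c₄, c₅, c₆, c₇⟩ := octBasis_coord (i.succ ^^^ j)
  refine oct_ext ?_ ?_ <;> ext
  all_goals
    simp [-Matrix.cons_val_succ, a₀, a₁, a₂, a₃, a₄, a₅, a₆, a₇, b₀, b₁, b₂, b₃, b₄, b₅,
      b₆, b₇, c₀, c₁, c₂, c₃, c₄, c₅, c₆, c₇]
    norm_cast
    clear * -
    revert i j
    decide +kernel

theorem imUnit_inner (i j : Fin 7) :
    ⟪(imUnit i : Oct), imUnit j⟫ = if i = j then 1 else 0 := octUnit_inner i j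

/-- The product of the left multiplications by four octonion units is in `Spin(7)`, and it permutes
the basis of the octonions up to signs. -/
theorem exists_spin7_sign (a b c d : Fin 7) :
    ∃ f ∈ Spin7, ∀ j, f (octBasis j) =
      (octSign d j * octSign c (d.succ ^^^ j) * octSign b (c.succ ^^^ (d.succ ^^^ j)) *
        octSign a (b.succ ^^^ (c.succ ^^^ (d.succ ^^^ j))) : ℤ) •
        octBasis (a.succ ^^^ (b.succ ^^^ (c.succ ^^^ (d.succ ^^^ j)))) := by
  obtain ⟨f, hf, hfx⟩ := mem_Spin7 (a := imUnit a) (b := imUnit b) (c := imUnit c)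
    (d := imUnit d) (by simp only [imUnit_inner, if_true, mul_one])
  refine ⟨f, hf, fun j => ?_⟩
  simp only [hfx, octMul_octBasis, map_smul, smul_smul]
  rw [← Int.cast_smul_eq_zsmul ℝ]
  push_cast
  rfl

/-- The product of `(1 + L_a L_b) / √2` and `(1 + L_c L_d) / √2` is in `Spin(7)`, where `L` denotes
the left multiplication by an octonion unit. -/
theorem exists_spin7_rotation {a b c d : Fin 7} (hab : a ≠ b) (hcd : c ≠ d) :
    ∃ f ∈ Spin7, ∀ j, (2 : ℝ) • f (octBasis j) = octBasis j +
      (octSign b j * octSign a (b.succ ^^^ j) : ℤ) • octBasis (a.succ ^^^ (b.succ ^^^ j)) +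
      (octSign d j * octSign c (d.succ ^^^ j) : ℤ) • octBasis (c.succ ^^^ (d.succ ^^^ j)) +
      (octSign d j * octSign c (d.succ ^^^ j) * octSign b (c.succ ^^^ (d.succ ^^^ j)) *
        octSign a (b.succ ^^^ (c.succ ^^^ (d.succ ^^^ j))) : ℤ) •
        octBasis (a.succ ^^^ (b.succ ^^^ (c.succ ^^^ (d.succ ^^^ j)))) := by
  -- `L_a (L_b - L_a) = 1 + L_a L_b`, since `L_a ^ 2 = -1`
  obtain ⟨f, hf, hfx⟩ := mem_Spin7 (a := imUnit a) (b := (1 / 2 : ℝ) • (imUnit b - imUnit a))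
    (c := imUnit c) (d := imUnit d - imUnit c) (by
      simp only [Submodule.coe_smul, Submodule.coe_sub, inner_sub_left, inner_sub_right,
        real_inner_smul_left, real_inner_smul_right, imUnit_inner, if_neg hab, if_neg hab.symm,
        if_neg hcd, if_neg hcd.symm, if_true]
      norm_num)
  refine ⟨f, hf, fun j => ?_⟩
  have hsq : ∀ (i : Fin 7) (x : Oct), octMul (imUnit i) (octMul (imUnit i) x) = -x := fun i x => by
    rw [← Module.End.mul_apply, octMul_sq, Module.algebraMap_end_apply]
    rw [show octForm (imUnit i) = -⟪(imUnit i : Oct), imUnit i⟫ from rfl, imUnit_inner]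
    simp
  rw [hfx]
  simp only [map_smul, map_sub, map_neg, LinearMap.smul_apply, LinearMap.sub_apply, hsq]
  simp only [octMul_octBasis, map_smul, smul_smul]
  simp only [← Int.cast_smul_eq_zsmul ℝ]
  push_cast
  module

/-- The sign changes and the rotations in the isotropy group `G₂` leave only one component of a
3-form free. -/
theorem spin7_rigid {η : SphereForm Oct 3} (hη : ∀ f ∈ Spin7, spherePullback f η = η)
    {b : Module.Basis (Fin 7) ℝ (Tan Oct.base)} (hb : ∀ i, (b i : Oct) = (1 : ℝ) • octUnit i)
    (h₀ : η Oct.base ![b 0, b 1, b 2] = 0) : η Oct.base = 0 := by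
  have hb' : ∀ i, (b i : Oct) = octBasis i.succ := fun i => (hb i).trans (one_smul ℝ _)
  have hsum : ∀ j, octBasis j = ∑ m, (if j = m then 1 else 0 : ℤ) • octBasis m := fun j => by
    simp
  have sign : ∀ (a b' c d : Fin 7) (ε : Fin 7 → ℤ)
      (_ : ∀ j : Fin 8, a.succ ^^^ (b'.succ ^^^ (c.succ ^^^ (d.succ ^^^ j))) = j ∧
        (octSign d j * octSign c (d.succ ^^^ j) * octSign b' (c.succ ^^^ (d.succ ^^^ j)) *
        octSign a (b'.succ ^^^ (c.succ ^^^ (d.succ ^^^ j))) : ℤ) = (Fin.cons 1 ε : Fin 8 → ℤ) j)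
      (i j k : Fin 7), η Oct.base ![b i, b j, b k] =
        (ε i * ε j * ε k : ℤ) * η Oct.base ![b i, b j, b k] := by
    intro a b' c d ε h i j k
    obtain ⟨f, hf, hfx⟩ := exists_spin7_sign a b' c d
    refine apply_signedPerm (hη f hf) ?_ id ε (fun i => ?_) i j k
    · have := hfx 0
      rw [(h 0).1, (h 0).2] at this
      have h' : f (octBasis 0) = octBasis 0 := by simpa using this
      exact h'
    · rw [hb', hfx, (h _).1, (h _).2, Int.cast_smul_eq_zsmul ℝ, id, hb']
      rfl
  have rot : ∀ (a b' c d : Fin 7) (_ : a ≠ b') (_ : c ≠ d) (π : Fin 7 → Fin 7) (ε : Fin 7 → ℤ)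
      (_ : ∀ j m : Fin 8, (if j = m then 1 else 0) +
        (octSign b' j * octSign a (b'.succ ^^^ j)) *
          (if a.succ ^^^ (b'.succ ^^^ j) = m then 1 else 0) +
        (octSign d j * octSign c (d.succ ^^^ j)) *
          (if c.succ ^^^ (d.succ ^^^ j) = m then 1 else 0) +
        (octSign d j * octSign c (d.succ ^^^ j) * octSign b' (c.succ ^^^ (d.succ ^^^ j)) *
        octSign a (b'.succ ^^^ (c.succ ^^^ (d.succ ^^^ j)))) *
          (if a.succ ^^^ (b'.succ ^^^ (c.succ ^^^ (d.succ ^^^ j))) = m then 1 else 0) =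
        2 * (Fin.cons 1 ε : Fin 8 → ℤ) j *
          (if (Fin.cons 0 (Fin.succ ∘ π) : Fin 8 → Fin 8) j = m then 1 else 0 : ℤ))
      (i j k : Fin 7), η Oct.base ![b i, b j, b k] =
        (ε i * ε j * ε k : ℤ) * η Oct.base ![b (π i), b (π j), b (π k)] := by
    intro a b' c d hab hcd π ε h i j k
    obtain ⟨f, hf, hfx⟩ := exists_spin7_rotation hab hcd
    have hfx' : ∀ j, f (octBasis j) = (((Fin.cons 1 ε : Fin 8 → ℤ) j : ℤ) : ℝ) •
        octBasis ((Fin.cons 0 (Fin.succ ∘ π) : Fin 8 → Fin 8) j) := fun j => by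
      refine smul_right_injective Oct (two_ne_zero' ℝ) ?_
      change (2 : ℝ) • f (octBasis j) = (2 : ℝ) • _
      rw [hfx, hsum j, hsum (a.succ ^^^ (b'.succ ^^^ j)), hsum (c.succ ^^^ (d.succ ^^^ j)),
        hsum (a.succ ^^^ (b'.succ ^^^ (c.succ ^^^ (d.succ ^^^ j)))),
        hsum ((Fin.cons 0 (Fin.succ ∘ π) : Fin 8 → Fin 8) j)]
      simp only [Finset.smul_sum, ← Finset.sum_add_distrib, Int.cast_smul_eq_zsmul, smul_smul,
        ← add_smul, h]
      refine Finset.sum_congr rfl fun m _ => ?_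
      rw [← Int.cast_smul_eq_zsmul ℝ, ← Int.cast_smul_eq_zsmul ℝ, smul_smul]
      push_cast
      rw [mul_assoc]
    refine apply_signedPerm (hη f hf) ?_ π ε (fun i => ?_) i j k
    · have := hfx' 0
      have h' : f (octBasis 0) = octBasis 0 := by simpa using this
      exact h'
    · rw [hb', hfx', hb']
      rfl
  -- three sign changes, and four signed permutations which relate the components that remain
  have s₁ := sign 4 3 5 6 ![1, 1, 1, -1, -1, -1, -1] (by decide)
  have s₂ := sign 2 1 5 6 ![1, -1, -1, 1, 1, -1, -1] (by decide)
  have s₃ := sign 2 0 4 6 ![-1, 1, -1, 1, -1, 1, -1] (by decide)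
  have r₁ := rot 1 2 4 3 (by decide) (by decide) ![0, 2, 1, 4, 3, 5, 6] ![1, 1, -1, -1, 1, 1, 1]
    (by decide +kernel)
  have r₂ := rot 1 2 6 5 (by decide) (by decide) ![0, 2, 1, 3, 4, 6, 5] ![1, 1, -1, 1, 1, -1, 1]
    (by decide +kernel)
  have r₃ := rot 0 2 3 5 (by decide) (by decide) ![2, 1, 0, 5, 4, 3, 6] ![1, 1, -1, 1, 1, -1, 1]
    (by decide +kernel)
  have r₄ := rot 0 4 2 6 (by decide) (by decide) ![4, 1, 6, 3, 0, 5, 2] ![1, 1, 1, 1, -1, 1, -1]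
    (by decide +kernel)
  have a₁ := r₄ 1 4 6
  have a₂ := r₁ 2 3 6
  have a₃ := r₂ 1 3 5
  have a₄ := r₁ 2 4 5
  have a₅ := r₃ 0 3 4
  have a₆ := r₃ 0 5 6
  simp at a₁ a₂ a₃ a₄ a₅ a₆
  rw [map_swap_left _ (b 0), h₀, neg_zero] at a₁
  rw [map_swap_right _ (b 2) (b 4)] at a₅
  refine eq_zero_of_signs _ b (fun ε hε => ?_) h₀ ?_ ?_ ?_ ?_ ?_ ?_
  · simp only [List.mem_cons, List.not_mem_nil, or_false] at hε
    rcases hε with rfl | rfl | rfl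
    exacts [s₁, s₂, s₃]
  all_goals linarith

/-- A unit octonion is the product of two unit imaginary octonions. -/
theorem Spin7_transitive (x : sphere (0 : Oct) 1) : ∃ f ∈ Spin7, spherePt f Oct.base = x := by
  obtain ⟨v, hv, hvx⟩ : ∃ v : ImOct, ⟪(v : Oct), v⟫ = 1 ∧ ⟪(v : Oct), x⟫ = 0 := by
    obtain ⟨v, hv, hvx⟩ : ∃ v : ImOct, v ≠ 0 ∧ ⟪(v : Oct), x⟫ = 0 := by
      by_cases h : ⟪(imUnit 0 : Oct), x⟫ = 0
      · refine ⟨imUnit 0, fun h0 => ?_, h⟩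
        have := imUnit_inner 0 0
        rw [h0] at this
        simp at this
      · refine ⟨⟪(imUnit 1 : Oct), x⟫ • imUnit 0 - ⟪(imUnit 0 : Oct), x⟫ • imUnit 1,
          fun h0 => h ?_, ?_⟩
        · have := congrArg (fun w : ImOct => ⟪(w : Oct), imUnit 1⟫) h0
          simp only [Submodule.coe_sub, Submodule.coe_smul, inner_sub_left, real_inner_smul_left,
            imUnit_inner, Submodule.coe_zero, inner_zero_left] at this
          rw [if_neg (by decide), if_pos trivial] at this
          linarith
        · rw [Submodule.coe_sub, Submodule.coe_smul, Submodule.coe_smul, inner_sub_left,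
            real_inner_smul_left, real_inner_smul_left]
          ring
    have hn : ‖(v : Oct)‖ ≠ 0 := norm_ne_zero_iff.2 fun h => hv (Subtype.ext h)
    refine ⟨‖(v : Oct)‖⁻¹ • v, ?_, ?_⟩
    · rw [Submodule.coe_smul, real_inner_smul_left, real_inner_smul_right,
        real_inner_self_eq_norm_sq]
      field_simp
    · rw [Submodule.coe_smul, real_inner_smul_left, hvx, mul_zero]
  have hx : ⟪(x : Oct), x⟫ = 1 := by
    rw [real_inner_self_eq_norm_sq, norm_eq_of_mem_sphere x, one_pow]
  let u : ImOct := ⟨octCross v x, octCross_re _ _⟩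
  have huv : octMul u v = x := by
    rw [octMul_octCross, hv, hvx, one_smul, zero_smul, sub_zero]
  have hu : ⟪(u : Oct), u⟫ = 1 := by
    have := inner_octMul_octMul u v v
    rwa [huv, hx, hv, mul_one, eq_comm] at this
  have hsq : octMul (imUnit 0) (octMul (imUnit 0) (Oct.base : Oct)) = -(Oct.base : Oct) := by
    rw [← Module.End.mul_apply, octMul_sq, Module.algebraMap_end_apply,
      show octForm (imUnit 0) = -⟪(imUnit 0 : Oct), imUnit 0⟫ from rfl, imUnit_inner]
    simp
  obtain ⟨f, hf, hfx⟩ := mem_Spin7 (a := -u) (b := v) (c := imUnit 0) (d := imUnit 0) (by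
    rw [Submodule.coe_neg, inner_neg_neg, hu, hv, imUnit_inner]
    simp)
  refine ⟨f, hf, Subtype.ext ?_⟩
  change f Oct.base = x
  have hv1 : octMul v (Oct.base : Oct) = v := by
    refine oct_ext ?_ ?_ <;> ext <;> simp [octMul, Oct.base]
  rw [hfx, hsq, map_neg (octMul v), hv1, map_neg octMul, LinearMap.neg_apply, map_neg, neg_neg, huv]

theorem spin7Form_invariant (p : ℝ) {f : Oct ≃ₗᵢ[ℝ] Oct} (hf : f ∈ Spin7) (y : Oct) :
    (spin7Form p (f y)).compContinuousLinearMap (f.toContinuousLinearEquiv : Oct →L[ℝ] Oct) =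
      spin7Form p y :=
  curryLeft_invariant (f := (f.toContinuousLinearEquiv : Oct →L[ℝ] Oct))
    (fun v => congrArg (fun t => p / 3 * t) (spin7FourForm_invariant hf v)) y

theorem spin7Form_pullback (p : ℝ) {f : Oct ≃ₗᵢ[ℝ] Oct} (hf : f ∈ Spin7) :
    spherePullback f (sphereRestrict (spin7Form p)) = sphereRestrict (spin7Form p) :=
  spherePullback_restrict (spin7Form p) f fun y => spin7Form_invariant p hf y

theorem spin7Form_frame_one (p : ℝ) {b : Module.Basis (Fin 7) ℝ (Tan Oct.base)}
    (hb : ∀ i, (b i : Oct) = (1 : ℝ) • octUnit i) :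
    sphereRestrict (spin7Form p) Oct.base ![b 0, b 1, b 2] = p := by
  rw [spin7Form_frame p hb, show g2Tensor 0 1 2 = 1 by decide]
  simp

theorem spin7_family : InvariantFamily Spin7 Oct.base spin7Form where
  finrank := Oct.finrank
  transitive := Spin7_transitive
  contDiff p := contDiff_curryLeft _
  horizontal p y v i h := curryLeft_horizontal _ y v i h
  invariant p f hf y := spin7Form_invariant p hf y
  exhausts η hη := by
    obtain ⟨b, hb⟩ := exists_octFrame one_ne_zero
    obtain ⟨p, h₀⟩ : ∃ p : ℝ, η Oct.base ![b 0, b 1, b 2] = p := ⟨_, rfl⟩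
    have h : ∀ f ∈ Spin7, spherePullback f (η - sphereRestrict (spin7Form p)) =
        η - sphereRestrict (spin7Form p) := fun f hf =>
      pullback_sub (hη f hf) (spin7Form_pullback p hf)
    exact ⟨p, sub_eq_zero.1 (spin7_rigid h hb
      (sub_eq_zero.2 (h₀.trans (spin7Form_frame_one p hb).symm)))⟩
  injective p q h := by
    obtain ⟨b, hb⟩ := exists_octFrame one_ne_zero
    have e := spin7Form_frame_one p hb
    rw [h, spin7Form_frame_one q hb] at e
    exact e.symm

theorem spin7Form_standard {c l : ℝ} (h : c * l ^ 3 = 1)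
    {b : Module.Basis (Fin 7) ℝ (Tan Oct.base)} (hb : ∀ i, (b i : Oct) = l • octUnit i)
    (i j k : Fin 7) : sphereRestrict (spin7Form c) Oct.base ![b i, b j, b k] = g2Tensor i j k := by
  rw [spin7Form_frame c hb, h, one_mul]

/-- `⋆d` on the family, in terms of the scaling of the frame. -/
theorem spin7_star {c l : ℝ} (h : c * l ^ 3 = 1) (q : ℝ) :
    sphereStar (sphereRestrict (spin7Form c)) 4 3 rfl (sphereD (sphereRestrict (spin7Form q))) =
      sphereRestrict (spin7Form (4 * l * q)) := by
  have hl : l ≠ 0 := by rintro rfl; simp at h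
  obtain ⟨b, hb⟩ := exists_octFrame hl
  have std := spin7Form_standard h hb
  obtain ⟨r, hr⟩ := spin7_family.exists_star_d (isPositive_of_frame std) q
  have e : sphereRestrict (spin7Form r) Oct.base ![b 0, b 1, b 2] =
      ((1 : ℤˣ) : ℝ) * (4 * ((q / 3) • spin7FourForm) ![(b 3 : Oct), b 4, b 5, b 6]) := by
    rw [← hr]
    exact sphereStar_curryLeft std ((q / 3) • spin7FourForm)
      ⟨![3, 4, 5, 6, 0, 1, 2], ![4, 5, 6, 0, 1, 2, 3], by decide, by decide⟩
  rw [spin7Form_frame r hb, ContinuousAlternatingMap.smul_apply, hb, hb, hb, hb,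
    spin7FourForm_frame, show g2Tensor 0 1 2 = 1 by decide] at e
  have hr' : r = 4 * l * q := by
    refine mul_right_cancel₀ (pow_ne_zero 3 hl) ?_
    simp at e
    linear_combination e
  rw [hr, hr']

theorem spin7_isPositive_iff (c : ℝ) :
    IsPositive (sphereRestrict (spin7Form c) Oct.base) ↔ c ∈ {c : ℝ | c ≠ 0} := by
  constructor
  · rintro h rfl
    obtain ⟨b, hb⟩ := exists_octFrame one_ne_zero
    refine not_isPositive_of_frame (b := b) (fun _ _ _ => 0) (fun i j k => ?_) 0 0
      (by decide +kernel) h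
    rw [spin7Form_frame 0 hb]
    simp
  · intro hc
    have h : c * (cubeEquiv.symm c⁻¹) ^ 3 = 1 := by
      rw [cubeEquiv_symm_pow, mul_inv_cancel₀ hc]
    obtain ⟨b, hb⟩ := exists_octFrame (l := cubeEquiv.symm c⁻¹) fun h0 => by simp [h0] at h
    exact isPositive_of_frame (spin7Form_standard h hb)

theorem g2Laplacian_bijOn_Spin7 :
    BijOn g2Laplacian (positiveInvariantForms Spin7) (positiveInvariantForms Spin7) ∧
      (∀ φ ∈ positiveInvariantForms Spin7, SameOrientation φ (g2Laplacian φ)) ∧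
      ∀ μ ∈ positiveInvariantForms Spin7,
        ∃! φ, φ ∈ positiveInvariantForms Spin7 ∧ g2Laplacian φ = μ := by
  have key : ∀ c : ℝ, c ≠ 0 → ∃ t : ℝ, t ≠ 0 ∧ cubeEquiv.symm c = t ∧ c = t ^ 3 := fun c hc =>
    ⟨_, fun h => hc (by rw [← cubeEquiv_symm_pow c, h]; norm_num), rfl, (cubeEquiv_symm_pow c).symm⟩
  refine spin7_family.g2Laplacian_bijOn (fun c => 16 * cubeEquiv.symm c) {c | c ≠ 0}
    spin7_isPositive_iff (fun c hc => ?_) ⟨fun c hc => ?_, fun c _ c' _ h => ?_, fun c hc => ?_⟩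
    fun c hc => ?_
  · obtain ⟨t, ht, h₁, h₂⟩ := key c hc
    have h : c * t⁻¹ ^ 3 = 1 := by rw [h₂]; field_simp
    refine ⟨_, t * c / 4, spin7_star h c, ?_, ?_⟩
    · rw [spin7_star h, h₁, h₂]
      congr 2
      field_simp
      norm_num
    · rw [spin7_star h]
      congr 2
      field_simp
  · obtain ⟨t, ht, h₁, h₂⟩ := key c hc
    exact mul_ne_zero (by norm_num) (h₁ ▸ ht)
  · exact cubeEquiv.symm.injective (mul_left_cancel₀ (by norm_num) h)
  · refine ⟨cubeEquiv (c / 16), pow_ne_zero 3 (div_ne_zero hc (by norm_num)), ?_⟩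
    change 16 * cubeEquiv.symm (cubeEquiv (c / 16)) = c
    rw [Equiv.symm_apply_apply]
    ring
  · obtain ⟨t, ht, h₁, h₂⟩ := key c hc
    have h : c * t⁻¹ ^ 3 = 1 := by rw [h₂]; field_simp
    obtain ⟨s, hs, -, hs'⟩ := key (16 * t) (by positivity)
    have h' : 16 * cubeEquiv.symm c * s⁻¹ ^ 3 = 1 := by rw [h₁, hs']; field_simp
    obtain ⟨b, hb⟩ := exists_octFrame (inv_ne_zero ht)
    obtain ⟨b', hb'⟩ := exists_octFrame (inv_ne_zero hs)
    refine exists_inducedVolume_smul (spin7Form_standard h hb) (spin7Form_standard h' hb')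
      (fun _ => s / t) (fun _ => ?_) fun i => Subtype.ext ?_
    · have : 0 < s ^ 3 / t ^ 3 := by
        rw [← hs']
        have : 16 * t / t ^ 3 = 16 / t ^ 2 := by field_simp
        rw [this]
        positivity
      rw [← div_pow] at this
      exact (Odd.pow_pos_iff (by decide)).1 this
    · rw [Submodule.coe_smul, hb, hb', smul_smul]
      congr 1
      field_simp

end Spin7

/-! ### The group `Sp(2) × Sp(1)` -/

section Sp2Sp1

/-- The standard quaternionic hermitian form `∑ x̄ᵢ yᵢ` on `ℍ²`. -/
def hermForm : H2 →ₗ[ℝ] H2 →ₗ[ℝ] ℍ :=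
  LinearMap.mk₂ ℝ (fun x y => star (x 0) * y 0 + star (x 1) * y 1)
    (fun x x' y => by simp [add_mul]; abel)
    (fun c x y => by simp)
    (fun x y y' => by simp [mul_add]; abel)
    (fun c x y => by simp)

/-- The three Kähler forms of `ℍ²`, as one form with values in the imaginary quaternions. -/
def quatKaehler : H2 →ₗ[ℝ] H2 →ₗ[ℝ] ℍ :=
  LinearMap.mk₂ ℝ (fun x y => (hermForm x y).im)
    (fun x x' y => by simp)
    (fun c x y => by simp)
    (fun x y y' => by simp)
    (fun c x y => by simp)

theorem quatKaehler_self (x : H2) : quatKaehler x x = 0 := by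
  ext <;> simp [quatKaehler, hermForm] <;> ring

/-- The determinant of the imaginary parts of three quaternions. -/
def imDet : ℍ [⋀^Fin 3]→ₗ[ℝ] ℝ where
  toFun v := (v 0).imI * ((v 1).imJ * (v 2).imK - (v 1).imK * (v 2).imJ) -
    (v 0).imJ * ((v 1).imI * (v 2).imK - (v 1).imK * (v 2).imI) +
    (v 0).imK * ((v 1).imI * (v 2).imJ - (v 1).imJ * (v 2).imI)
  map_update_add' := by
    intro inst v i x y
    obtain rfl : inst = instDecidableEqFin 3 := Subsingleton.elim _ _
    fin_cases i <;> simp [Function.update] <;> ring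
  map_update_smul' := by
    intro inst v i c x
    obtain rfl : inst = instDecidableEqFin 3 := Subsingleton.elim _ _
    fin_cases i <;> simp [Function.update] <;> ring
  map_eq_zero_of_eq' := by
    intro v i j h hij
    fin_cases i <;> fin_cases j <;> first | exact absurd rfl hij | skip
    all_goals
      simp only [Fin.zero_eta, Fin.mk_one, Fin.reduceFinMk] at h
      rw [h]
      ring

theorem imDet_apply (v : Fin 3 → ℍ) : imDet v =
    (v 0).imI * ((v 1).imJ * (v 2).imK - (v 1).imK * (v 2).imJ) -
    (v 0).imJ * ((v 1).imI * (v 2).imK - (v 1).imK * (v 2).imI) +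
    (v 0).imK * ((v 1).imI * (v 2).imJ - (v 1).imJ * (v 2).imI) := rfl

/-- The 3-form `η₁ ∧ η₂ ∧ η₃` at `y`, where `η₁, η₂, η₃` are the components of the imaginary part
of `v ↦ ∑ ȳᵢ vᵢ`. -/
def verticalForm (y : H2) : H2 [⋀^Fin 3]→L[ℝ] ℝ :=
  (imDet.compLinearMap (hermForm y)).toContinuous

theorem verticalForm_apply (y : H2) (v : Fin 3 → H2) :
    verticalForm y v = imDet fun i => hermForm y (v i) := rfl

theorem verticalForm_contDiff : ContDiff ℝ ∞ verticalForm := by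
  refine contDiff_alternating fun v => ?_
  have h : ∀ i, ContDiff ℝ ∞ fun y => hermForm y (v i) := fun i =>
    (LinearMap.toContinuousLinearMap (hermForm.flip (v i))).contDiff
  have hI : ContDiff ℝ ∞ fun q : ℍ => q.imI := (LinearMap.toContinuousLinearMap
    ({ toFun := fun q : ℍ => q.imI, map_add' := by simp, map_smul' := by simp } :
      ℍ →ₗ[ℝ] ℝ)).contDiff
  have hJ : ContDiff ℝ ∞ fun q : ℍ => q.imJ := (LinearMap.toContinuousLinearMap
    ({ toFun := fun q : ℍ => q.imJ, map_add' := by simp, map_smul' := by simp } :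
      ℍ →ₗ[ℝ] ℝ)).contDiff
  have hK : ContDiff ℝ ∞ fun q : ℍ => q.imK := (LinearMap.toContinuousLinearMap
    ({ toFun := fun q : ℍ => q.imK, map_add' := by simp, map_smul' := by simp } :
      ℍ →ₗ[ℝ] ℝ)).contDiff
  have cI := fun i => hI.comp (h i)
  have cJ := fun i => hJ.comp (h i)
  have cK := fun i => hK.comp (h i)
  exact (((cI 0).mul (((cJ 1).mul (cK 2)).sub ((cK 1).mul (cJ 2)))).sub
    ((cJ 0).mul (((cI 1).mul (cK 2)).sub ((cK 1).mul (cI 2))))).add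
    ((cK 0).mul (((cI 1).mul (cJ 2)).sub ((cJ 1).mul (cI 2))))

/-- The `(Sp(2) × Sp(1))`-invariant 4-form on `ℍ²`: half the sum of the squares of the Kähler
forms. -/
def quatFourForm : H2 [⋀^Fin 4]→L[ℝ] ℝ := (squareForm quatKaehler quatKaehler_self).toContinuous

theorem quatFourForm_apply (v : Fin 4 → H2) : quatFourForm v =
    ⟪quatKaehler (v 0) (v 1), quatKaehler (v 2) (v 3)⟫ -
      ⟪quatKaehler (v 0) (v 2), quatKaehler (v 1) (v 3)⟫ +
      ⟪quatKaehler (v 0) (v 3), quatKaehler (v 1) (v 2)⟫ := rfl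

/-- The invariant 3-forms on the unit sphere of `ℍ²`, as restrictions of forms on `ℍ²`. In
`ι_y quatFourForm + 3 η₁ ∧ η₂ ∧ η₃` only the terms `ηᵢ ∧ ωᵢ` with the horizontal parts of the
Kähler forms remain on the sphere. -/
def sp2Form (p : ℝ × ℝ) (y : H2) : H2 [⋀^Fin 3]→L[ℝ] ℝ :=
  (p.1 + 3 * p.2) • verticalForm y + p.2 • quatFourForm.curryLeft y

theorem sp2Form_apply (p : ℝ × ℝ) (y : H2) (v : Fin 3 → H2) : sp2Form p y v =
    (p.1 + 3 * p.2) * verticalForm y v + p.2 * quatFourForm (Matrix.vecCons y v) := rfl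

theorem sp2Form_contDiff (p : ℝ × ℝ) : ContDiff ℝ ∞ (sp2Form p) :=
  (verticalForm_contDiff.const_smul (p.1 + 3 * p.2)).add
    ((contDiff_curryLeft quatFourForm).const_smul p.2)

theorem sp2Form_horizontal (p : ℝ × ℝ) (y : H2) (v : Fin 3 → H2) (i : Fin 3) (h : v i = y) :
    sp2Form p y v = 0 := by
  have h1 : quatFourForm (Matrix.vecCons y v) = 0 := curryLeft_horizontal quatFourForm y v i h
  have h2 : verticalForm y v = 0 := by
    have h0 : (hermForm y y).imI = 0 ∧ (hermForm y y).imJ = 0 ∧ (hermForm y y).imK = 0 := by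
      simp [hermForm]
      refine ⟨?_, ?_, ?_⟩ <;> ring
    rw [verticalForm_apply, imDet_apply]
    fin_cases i <;> simp only [Fin.zero_eta, Fin.mk_one, Fin.reduceFinMk] at h <;>
      rw [h, h0.1, h0.2.1, h0.2.2] <;> ring
  rw [sp2Form_apply, h1, h2, mul_zero, mul_zero, add_zero]

theorem H2.inner_eq (x y : H2) : ⟪x, y⟫ = (hermForm x y).re := by
  rw [PiLp.inner_apply, Fin.sum_univ_two, Quaternion.inner_def, Quaternion.inner_def]
  simp [hermForm]

theorem H2.finrank : Module.finrank ℝ H2 = 8 := by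
  rw [(WithLp.linearEquiv 2 ℝ (Fin 2 → ℍ)).finrank_eq, Module.finrank_pi_fintype]
  simp [Quaternion.finrank_eq_four]

/-- The base point `(1, 0)` of the unit sphere of `ℍ²`. -/
def H2.base : sphere (0 : H2) 1 := ⟨WithLp.toLp 2 ![1, 0], by
  rw [mem_sphere_zero_iff_norm, ← sq_eq_sq₀ (norm_nonneg _) zero_le_one,
    ← real_inner_self_eq_norm_sq, H2.inner_eq]
  simp [hermForm]⟩

/-- The tangent frame `(s i, 0), (s j, 0), (s k, 0), (0, t), (0, t i), (0, t j), (0, -t k)` at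
`(1, 0)`. The sign of the last vector gives the components `ηᵢ ∧ ωᵢ` the signs of the standard
3-form. -/
def sp2Frame (s t : ℝ) : Fin 7 → H2 := fun i => WithLp.toLp 2 <|
  ![![⟨0, s, 0, 0⟩, 0], ![⟨0, 0, s, 0⟩, 0], ![⟨0, 0, 0, s⟩, 0], ![0, ⟨t, 0, 0, 0⟩],
    ![0, ⟨0, t, 0, 0⟩], ![0, ⟨0, 0, t, 0⟩], ![0, ⟨0, 0, 0, -t⟩]] i

theorem exists_sp2Frame {s t : ℝ} (hs : s ≠ 0) (ht : t ≠ 0) :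
    ∃ b : Module.Basis (Fin 7) ℝ (Tan H2.base), ∀ i, (b i : H2) = sp2Frame s t i := by
  have hi : ∀ i j, ⟪sp2Frame s t i, sp2Frame s t j⟫ =
      if i = j then (if i < 3 then s ^ 2 else t ^ 2) else 0 := fun i j => by
    rw [H2.inner_eq]
    simp only [hermForm, LinearMap.mk₂_apply, Quaternion.re_add, Quaternion.re_mul,
      Quaternion.re_star, Quaternion.imI_star, Quaternion.imJ_star, Quaternion.imK_star]
    fin_cases i <;> fin_cases j <;> simp [sp2Frame] <;> ring
  refine exists_frame H2.finrank _ _ (fun i => ?_) (fun i h => ?_) fun i j hij => ?_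
  · rw [H2.inner_eq]
    simp only [hermForm, LinearMap.mk₂_apply, Quaternion.re_add, Quaternion.re_mul,
      Quaternion.re_star, Quaternion.imI_star, Quaternion.imJ_star, Quaternion.imK_star]
    fin_cases i <;> simp [sp2Frame, H2.base]
  · have h1 := hi i i
    rw [h, inner_zero_left, if_pos rfl] at h1
    split_ifs at h1
    · exact pow_ne_zero 2 hs h1.symm
    · exact pow_ne_zero 2 ht h1.symm
  · rw [hi, if_neg hij]

theorem hermForm_base (x : H2) : hermForm H2.base x = x 0 := by
  simp [hermForm, H2.base]

theorem inner_quatKaehler (x y z w : H2) : ⟪quatKaehler x y, quatKaehler z w⟫ =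
    (hermForm x y).imI * (hermForm z w).imI + (hermForm x y).imJ * (hermForm z w).imJ +
      (hermForm x y).imK * (hermForm z w).imK := by
  rw [Quaternion.inner_def]
  simp [quatKaehler]
  ring

theorem sp2Form_frame (p : ℝ × ℝ) {s t : ℝ} {b : Module.Basis (Fin 7) ℝ (Tan H2.base)}
    (hb : ∀ i, (b i : H2) = sp2Frame s t i) (i j k : Fin 7) :
    sphereRestrict (sp2Form p) H2.base ![b i, b j, b k] = p.1 * s ^ 3 * elem3 0 1 2 i j k +
      p.2 * (s * t ^ 2) * (g2Tensor i j k - elem3 0 1 2 i j k) := by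
  have h1 : ∀ i j k, (g2Tensor j i k = -g2Tensor i j k ∧ g2Tensor i k j = -g2Tensor i j k) ∧
    elem3 0 1 2 j i k = -elem3 0 1 2 i j k ∧ elem3 0 1 2 i k j = -elem3 0 1 2 i j k := by
    decide +kernel
  refine tensor_eq_of_sorted _ b (fun i j k => p.1 * s ^ 3 * elem3 0 1 2 i j k +
      p.2 * (s * t ^ 2) * (g2Tensor i j k - elem3 0 1 2 i j k))
    (fun i j k => ?_) (fun i j k => ?_) (fun i j k hij hjk => ?_) i j k
  · rw [(h1 i j k).1.1, (h1 i j k).2.1]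
    push_cast
    ring
  · rw [(h1 i j k).1.2, (h1 i j k).2.2]
    push_cast
    ring
  · rw [sphereRestrict_frame, sp2Form_apply, verticalForm_apply, imDet_apply, quatFourForm_apply]
    simp only [inner_quatKaehler]
    simp only [Matrix.cons_val, hermForm_base]
    simp only [hermForm, LinearMap.mk₂_apply, Quaternion.imI_add, Quaternion.imI_mul,
      Quaternion.imJ_add, Quaternion.imJ_mul, Quaternion.imK_add, Quaternion.imK_mul,
      Quaternion.re_star, Quaternion.imI_star, Quaternion.imJ_star, Quaternion.imK_star, hb]
    fin_cases i <;> fin_cases j <;> first | exact absurd hij (by decide) | skip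
    all_goals fin_cases k <;> first | exact absurd hjk (by decide) | skip
    all_goals
      simp [sp2Frame, g2Tensor, elem3, -mul_eq_mul_left_iff, -mul_eq_mul_right_iff]
    all_goals ring

theorem quatFourForm_frame (s t : ℝ) :
    quatFourForm ![sp2Frame s t 3, sp2Frame s t 4, sp2Frame s t 5, sp2Frame s t 6] = 3 * t ^ 4 ∧
    quatFourForm ![sp2Frame s t 1, sp2Frame s t 2, sp2Frame s t 5, sp2Frame s t 6] =
      -(s ^ 2 * t ^ 2) := by
  simp only [quatFourForm_apply, inner_quatKaehler]
  simp only [Matrix.cons_val]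
  simp only [hermForm, LinearMap.mk₂_apply, Quaternion.imI_add, Quaternion.imI_mul,
    Quaternion.imJ_add, Quaternion.imJ_mul, Quaternion.imK_add, Quaternion.imK_mul,
    Quaternion.re_star, Quaternion.imI_star, Quaternion.imJ_star, Quaternion.imK_star]
  constructor
  · simp [sp2Frame]
    ring
  · simp [sp2Frame]
    ring

theorem hasDerivAt_imDet (a c : Fin 3 → ℍ) : HasDerivAt (fun r : ℝ => imDet fun i => a i + r • c i)
    (imDet ![c 0, a 1, a 2] + imDet ![a 0, c 1, a 2] + imDet ![a 0, a 1, c 2]) 0 := by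
  have e : (fun r : ℝ => imDet fun i => a i + r • c i) = fun r : ℝ => imDet a +
      r * (imDet ![c 0, a 1, a 2] + imDet ![a 0, c 1, a 2] + imDet ![a 0, a 1, c 2]) +
      r ^ 2 * (imDet ![a 0, c 1, c 2] + imDet ![c 0, a 1, c 2] + imDet ![c 0, c 1, a 2] +
        r * imDet c) := by
    funext r
    simp [imDet_apply]
    ring
  rw [e]
  have h1 := (hasDerivAt_id (0 : ℝ)).mul_const
    (imDet ![c 0, a 1, a 2] + imDet ![a 0, c 1, a 2] + imDet ![a 0, a 1, c 2])
  have h2 := (hasDerivAt_pow 2 (0 : ℝ)).mul (((hasDerivAt_id (0 : ℝ)).mul_const (imDet c)).const_add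
    (imDet ![a 0, c 1, c 2] + imDet ![c 0, a 1, c 2] + imDet ![c 0, c 1, a 2]))
  refine ((h1.const_add (imDet a)).add h2).congr_deriv ?_
  simp

/-- The exterior derivative, from the product rule: `verticalForm y` is cubic in `y`. -/
theorem extDeriv_verticalForm (x : H2) (v : Fin 4 → H2) : extDeriv verticalForm x v =
    ∑ i : Fin 4, (-1 : ℝ) ^ i.val *
      (imDet ![hermForm (v i) (v (i.succAbove 0)), hermForm x (v (i.succAbove 1)),
          hermForm x (v (i.succAbove 2))] +
        imDet ![hermForm x (v (i.succAbove 0)), hermForm (v i) (v (i.succAbove 1)),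
          hermForm x (v (i.succAbove 2))] +
        imDet ![hermForm x (v (i.succAbove 0)), hermForm x (v (i.succAbove 1)),
          hermForm (v i) (v (i.succAbove 2))]) := by
  have hd : Differentiable ℝ verticalForm := verticalForm_contDiff.differentiable (by simp)
  rw [extDeriv_apply (hd x)]
  refine Finset.sum_congr rfl fun i _ => ?_
  rw [zsmul_eq_mul]
  push_cast
  congr 1
  let u := i.removeNth v
  have hu : DifferentiableAt ℝ (fun y => verticalForm y u) x := by fun_prop
  refine HasDerivAt.unique (hu.hasFDerivAt.hasLineDerivAt (v i)) ?_
  have := hasDerivAt_imDet (fun j => hermForm x (u j)) fun j => hermForm (v i) (u j)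
  rw [show (fun r : ℝ => imDet fun j => hermForm x (u j) + r • hermForm (v i) (u j)) =
    fun r : ℝ => verticalForm (x + r • v i) u from
      funext fun r => by simp [verticalForm_apply]] at this
  exact this

theorem extDeriv_verticalForm_frame (s t : ℝ) :
    extDeriv verticalForm H2.base ![sp2Frame s t 3, sp2Frame s t 4, sp2Frame s t 5,
      sp2Frame s t 6] = 0 ∧
    extDeriv verticalForm H2.base ![sp2Frame s t 1, sp2Frame s t 2, sp2Frame s t 5,
      sp2Frame s t 6] = 2 * (s ^ 2 * t ^ 2) := by
  have hs : (Fin.succAbove (0 : Fin 4) (0 : Fin 3) = 1 ∧ Fin.succAbove (0 : Fin 4) (1 : Fin 3) = 2 ∧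
      Fin.succAbove (0 : Fin 4) (2 : Fin 3) = 3) ∧ (Fin.succAbove (1 : Fin 4) (0 : Fin 3) = 0 ∧
      Fin.succAbove (1 : Fin 4) (1 : Fin 3) = 2 ∧ Fin.succAbove (1 : Fin 4) (2 : Fin 3) = 3) ∧
      (Fin.succAbove (2 : Fin 4) (0 : Fin 3) = 0 ∧ Fin.succAbove (2 : Fin 4) (1 : Fin 3) = 1 ∧
      Fin.succAbove (2 : Fin 4) (2 : Fin 3) = 3) ∧ Fin.succAbove (3 : Fin 4) (0 : Fin 3) = 0 ∧
      Fin.succAbove (3 : Fin 4) (1 : Fin 3) = 1 ∧ Fin.succAbove (3 : Fin 4) (2 : Fin 3) = 2 := by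
    decide
  simp only [extDeriv_verticalForm, Fin.sum_univ_four, hermForm_base, imDet_apply, hs]
  simp only [Matrix.cons_val]
  simp only [hermForm, LinearMap.mk₂_apply, Quaternion.imI_add, Quaternion.imI_mul,
    Quaternion.imJ_add, Quaternion.imJ_mul, Quaternion.imK_add, Quaternion.imK_mul,
    Quaternion.re_star, Quaternion.imI_star, Quaternion.imJ_star, Quaternion.imK_star]
  constructor
  · simp [sp2Frame]
  · simp [sp2Frame]
    ring

theorem mem_Sp2Sp1 {A : Matrix (Fin 2) (Fin 2) ℍ} {q : ℍ} (hA : Aᴴ * A = 1) (hq : star q * q = 1) :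
    ∃ f ∈ Sp2Sp1, ∀ v : H2, f v = WithLp.toLp 2 fun i => (A *ᵥ v.ofLp) i * star q :=
  ⟨_, ⟨(⟨A, Unitary.mem_iff.2 ⟨hA, mul_eq_one_comm.1 hA⟩⟩,
    ⟨q, Unitary.mem_iff.2 ⟨hq, mul_eq_one_comm.1 hq⟩⟩), rfl⟩, fun _ => rfl⟩

theorem hermForm_eq (x y : H2) : hermForm x y = star x.ofLp ⬝ᵥ y.ofLp := by
  simp [hermForm, dotProduct]

/-- An element of the group, `v ↦ A v q̄`, conjugates the values of the hermitian form by `q`, so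
the invariants of its imaginary part under rotation are invariant forms. -/
theorem exists_hermForm_conj {f : H2 ≃ₗᵢ[ℝ] H2} (hf : f ∈ Sp2Sp1) :
    ∃ q : ℍ, star q * q = 1 ∧ ∀ x y, hermForm (f x) (f y) = q * hermForm x y * star q := by
  obtain ⟨⟨A, q⟩, rfl⟩ := hf
  have hA : (A : Matrix (Fin 2) (Fin 2) ℍ)ᴴ * (A : Matrix (Fin 2) (Fin 2) ℍ) = 1 :=
    (Unitary.mem_iff.1 A.2).1
  refine ⟨q, (Unitary.mem_iff.1 q.2).1, fun x y => ?_⟩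
  have h : star ((A : Matrix (Fin 2) (Fin 2) ℍ) *ᵥ x.ofLp) ⬝ᵥ
      ((A : Matrix (Fin 2) (Fin 2) ℍ) *ᵥ y.ofLp) = hermForm x y := by
    rw [Matrix.star_mulVec, ← Matrix.dotProduct_mulVec, Matrix.mulVec_mulVec, hA,
      Matrix.one_mulVec, hermForm_eq]
  rw [← h, hermForm_eq]
  change star (fun i => ((A : Matrix (Fin 2) (Fin 2) ℍ) *ᵥ x.ofLp) i * star (q : ℍ)) ⬝ᵥ
    (fun i => ((A : Matrix (Fin 2) (Fin 2) ℍ) *ᵥ y.ofLp) i * star (q : ℍ)) = _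
  simp only [dotProduct, Fin.sum_univ_two, Pi.star_apply, star_mul, star_star, mul_add, add_mul,
    mul_assoc]

theorem im_conj (q x : ℍ) : (q * x * star q).im = q * x.im * star q := by
  ext <;> simp <;> ring

theorem re_conj {q : ℍ} (hq : star q * q = 1) (x : ℍ) : (q * x * star q).re = x.re := by
  have h : ∀ a b : ℍ, (a * b).re = (b * a).re := fun a b => by simp; ring
  rw [h, ← mul_assoc, hq, one_mul]

theorem conj_mul_conj {q : ℍ} (hq : star q * q = 1) (x y : ℍ) :
    (q * x * star q) * (q * y * star q) = q * (x * y) * star q := by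
  simp only [mul_assoc]
  rw [← mul_assoc (star q) q, hq, one_mul]

theorem imDet_conj {q : ℍ} (hq : star q * q = 1) (v : Fin 3 → ℍ) :
    imDet (fun i => q * v i * star q) = imDet v := by
  have h : ∀ v, imDet v = -((v 0).im * (v 1).im * (v 2).im).re := fun v => by
    simp [imDet_apply]
    ring
  rw [h, h, im_conj, im_conj, im_conj, conj_mul_conj hq, conj_mul_conj hq, re_conj hq]

theorem quatFourForm_invariant {f : H2 ≃ₗᵢ[ℝ] H2} (hf : f ∈ Sp2Sp1) (v : Fin 4 → H2) :
    quatFourForm (f ∘ v) = quatFourForm v := by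
  obtain ⟨q, hq, h⟩ := exists_hermForm_conj hf
  have hk : ∀ x y z w, ⟪quatKaehler (f x) (f y), quatKaehler (f z) (f w)⟫ =
      ⟪quatKaehler x y, quatKaehler z w⟫ := fun x y z w => by
    have hk' : ∀ x y, quatKaehler (f x) (f y) = q * quatKaehler x y * star q := fun x y =>
      (congrArg Quaternion.im (h x y)).trans (im_conj _ _)
    rw [hk', hk', Quaternion.inner_def, Quaternion.inner_def,
      show star (q * quatKaehler z w * star q) = q * star (quatKaehler z w) * star q by
        simp [mul_assoc], conj_mul_conj hq, re_conj hq]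
  simp only [quatFourForm_apply, Function.comp_apply, hk]

theorem sp2Form_invariant (p : ℝ × ℝ) {f : H2 ≃ₗᵢ[ℝ] H2} (hf : f ∈ Sp2Sp1) (y : H2) :
    (sp2Form p (f y)).compContinuousLinearMap (f.toContinuousLinearEquiv : H2 →L[ℝ] H2) =
      sp2Form p y := by
  ext v
  obtain ⟨q, hq, h⟩ := exists_hermForm_conj hf
  have h1 : verticalForm (f y) (f ∘ v) = verticalForm y v := by
    rw [verticalForm_apply, verticalForm_apply, ← imDet_conj hq fun i => hermForm y (v i)]
    congr 1
    exact funext fun i => h _ _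
  have h2 : quatFourForm (Matrix.vecCons (f y) (f ∘ v)) = quatFourForm (Matrix.vecCons y v) := by
    rw [← quatFourForm_invariant hf (Matrix.vecCons y v)]
    congr 1
    exact funext fun i => Fin.cases rfl (fun _ => rfl) i
  change sp2Form p (f y) (f ∘ v) = _
  rw [sp2Form_apply, sp2Form_apply, h1, h2]

theorem sp2Form_pullback (p : ℝ × ℝ) {f : H2 ≃ₗᵢ[ℝ] H2} (hf : f ∈ Sp2Sp1) :
    spherePullback f (sphereRestrict (sp2Form p)) = sphereRestrict (sp2Form p) :=
  spherePullback_restrict (sp2Form p) f fun y => sp2Form_invariant p hf y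

theorem mem_Sp2Sp1_diagonal {q p : ℍ} (hq : star q * q = 1) (hp : star p * p = 1) :
    ∃ f ∈ Sp2Sp1, ∀ v : H2, f v = WithLp.toLp 2 ![q * v 0 * star q, p * v 1 * star q] := by
  obtain ⟨f, hf, hfv⟩ := mem_Sp2Sp1 (A := Matrix.diagonal ![q, p]) (q := q) (by
    rw [Matrix.diagonal_conjTranspose, Matrix.diagonal_mul_diagonal, ← Matrix.diagonal_one]
    congr 1
    funext i
    fin_cases i
    exacts [hq, hp]) hq
  refine ⟨f, hf, fun v => ?_⟩
  rw [hfv]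
  congr 1
  funext i
  rw [Matrix.mulVec_diagonal]
  fin_cases i <;> rfl

/-- The equation `a x b̄ = c y` in real components. -/
theorem mul_mul_star_eq_smul_iff (a x b y : ℍ) (c : ℝ) : a * x * star b = c • y ↔
    (a.re * x.re - a.imI * x.imI - a.imJ * x.imJ - a.imK * x.imK) * b.re +
      (a.re * x.imI + a.imI * x.re + a.imJ * x.imK - a.imK * x.imJ) * b.imI +
      (a.re * x.imJ - a.imI * x.imK + a.imJ * x.re + a.imK * x.imI) * b.imJ +
      (a.re * x.imK + a.imI * x.imJ - a.imJ * x.imI + a.imK * x.re) * b.imK = c * y.re ∧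
    (a.re * x.imI + a.imI * x.re + a.imJ * x.imK - a.imK * x.imJ) * b.re -
      (a.re * x.re - a.imI * x.imI - a.imJ * x.imJ - a.imK * x.imK) * b.imI -
      (a.re * x.imJ - a.imI * x.imK + a.imJ * x.re + a.imK * x.imI) * b.imK +
      (a.re * x.imK + a.imI * x.imJ - a.imJ * x.imI + a.imK * x.re) * b.imJ = c * y.imI ∧
    (a.re * x.imJ - a.imI * x.imK + a.imJ * x.re + a.imK * x.imI) * b.re -
      (a.re * x.re - a.imI * x.imI - a.imJ * x.imJ - a.imK * x.imK) * b.imJ +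
      (a.re * x.imI + a.imI * x.re + a.imJ * x.imK - a.imK * x.imJ) * b.imK -
      (a.re * x.imK + a.imI * x.imJ - a.imJ * x.imI + a.imK * x.re) * b.imI = c * y.imJ ∧
    (a.re * x.imK + a.imI * x.imJ - a.imJ * x.imI + a.imK * x.re) * b.re -
      (a.re * x.re - a.imI * x.imI - a.imJ * x.imJ - a.imK * x.imK) * b.imK -
      (a.re * x.imI + a.imI * x.re + a.imJ * x.imK - a.imK * x.imJ) * b.imJ +
      (a.re * x.imJ - a.imI * x.imK + a.imJ * x.re + a.imK * x.imI) * b.imI = c * y.imK := by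
  rw [Quaternion.ext_iff]
  simp only [Quaternion.re_mul, Quaternion.imI_mul, Quaternion.imJ_mul,
    Quaternion.imK_mul, Quaternion.re_star, Quaternion.imI_star, Quaternion.imJ_star,
    Quaternion.imK_star, Quaternion.re_smul, Quaternion.imI_smul, Quaternion.imJ_smul,
    Quaternion.imK_smul, smul_eq_mul]
  refine and_congr (Eq.congr_left ?_) (and_congr (Eq.congr_left ?_) (and_congr (Eq.congr_left ?_)
    (Eq.congr_left ?_))) <;> ring

/-- The isotropy group, which acts by `(x, y) ↦ (q x q̄, p y q̄)`, leaves only the two components of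
`sp2Form_frame_one` free. -/
theorem sp2_rigid {η : SphereForm H2 3} (hη : ∀ f ∈ Sp2Sp1, spherePullback f η = η)
    {b : Module.Basis (Fin 7) ℝ (Tan H2.base)} (hb : ∀ i, (b i : H2) = sp2Frame 1 1 i)
    (h₀ : η H2.base ![b 0, b 1, b 2] = 0) (h₁ : η H2.base ![b 0, b 3, b 4] = 0) :
    η H2.base = 0 := by
  have key : ∀ (q p : ℍ) (_ : star q * q = 1) (_ : star p * p = 1)
      (π : Fin 7 → Fin 7) (ε : Fin 7 → ℤ)
      (_ : ∀ i, q * sp2Frame 1 1 i 0 * star q = (ε i : ℝ) • sp2Frame 1 1 (π i) 0 ∧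
        p * sp2Frame 1 1 i 1 * star q = (ε i : ℝ) • sp2Frame 1 1 (π i) 1) (i j k : Fin 7),
      η H2.base ![b i, b j, b k] =
        (ε i * ε j * ε k : ℤ) * η H2.base ![b (π i), b (π j), b (π k)] := by
    intro q p hq hp π ε h i j k
    obtain ⟨f, hf, hfv⟩ := mem_Sp2Sp1_diagonal hq hp
    refine apply_signedPerm (hη f hf) ?_ π ε (fun i => ?_) i j k
    · rw [hfv]
      simp [H2.base, mul_eq_one_comm.1 hq]
    · rw [hfv, hb, hb]
      ext1 j
      fin_cases j
      exacts [(h i).1, (h i).2]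
  have hu : ∀ u : ℍ, u.re ^ 2 + u.imI ^ 2 + u.imJ ^ 2 + u.imK ^ 2 = 1 → star u * u = 1 := by
    intro u h
    rw [Quaternion.star_mul_self, Quaternion.normSq_def', h, Quaternion.coe_one]
  have h1 := hu ⟨1, 0, 0, 0⟩ (by norm_num)
  have hm := hu ⟨-1, 0, 0, 0⟩ (by norm_num)
  have hi := hu ⟨0, 1, 0, 0⟩ (by norm_num)
  have hj := hu ⟨0, 0, 1, 0⟩ (by norm_num)
  have hc := hu ⟨1 / 2, 1 / 2, 1 / 2, 1 / 2⟩ (by norm_num)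
  -- three sign changes, and two signed permutations which relate the components that remain
  have s₁ := key _ _ h1 hm id ![1, 1, 1, -1, -1, -1, -1] (fun i => by
    refine ⟨(mul_mul_star_eq_smul_iff _ _ _ _ _).2 ?_,
      (mul_mul_star_eq_smul_iff _ _ _ _ _).2 ?_⟩ <;>
    fin_cases i <;> simp [sp2Frame])
  have s₂ := key _ _ hi hi id ![1, -1, -1, 1, 1, -1, -1] (fun i => by
    refine ⟨(mul_mul_star_eq_smul_iff _ _ _ _ _).2 ?_,
      (mul_mul_star_eq_smul_iff _ _ _ _ _).2 ?_⟩ <;>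
    fin_cases i <;> simp [sp2Frame])
  have s₃ := key _ _ hj hj id ![-1, 1, -1, 1, -1, 1, -1] (fun i => by
    refine ⟨(mul_mul_star_eq_smul_iff _ _ _ _ _).2 ?_,
      (mul_mul_star_eq_smul_iff _ _ _ _ _).2 ?_⟩ <;>
    fin_cases i <;> simp [sp2Frame])
  have r₁ := key _ _ h1 hj ![0, 1, 2, 5, 6, 3, 4] ![1, 1, 1, 1, 1, -1, -1] (fun i => by
    refine ⟨(mul_mul_star_eq_smul_iff _ _ _ _ _).2 ?_,
      (mul_mul_star_eq_smul_iff _ _ _ _ _).2 ?_⟩ <;>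
    fin_cases i <;> simp [sp2Frame])
  have r₂ := key _ _ hc hc ![1, 2, 0, 3, 5, 6, 4] ![1, 1, 1, 1, 1, -1, -1] (fun i => by
    refine ⟨(mul_mul_star_eq_smul_iff _ _ _ _ _).2 ?_,
      (mul_mul_star_eq_smul_iff _ _ _ _ _).2 ?_⟩ <;>
    fin_cases i <;> simp [sp2Frame] <;> norm_num)
  have a₁ := r₁ 0 3 4
  have a₂ := r₂ 0 3 4
  have a₃ := r₂ 1 3 5
  have a₄ := r₂ 0 5 6
  have a₅ := r₂ 1 4 6
  simp at a₁ a₂ a₃ a₄ a₅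
  rw [map_swap_right _ (b 1)] at a₄
  rw [map_swap_right _ (b 2)] at a₅
  refine eq_zero_of_signs _ b (fun ε hε => ?_) h₀ h₁ ?_ ?_ ?_ ?_ ?_
  · simp only [List.mem_cons, List.not_mem_nil, or_false] at hε
    rcases hε with rfl | rfl | rfl
    exacts [s₁, s₂, s₃]
  all_goals linarith

theorem Sp2Sp1_transitive (x : sphere (0 : H2) 1) : ∃ f ∈ Sp2Sp1, spherePt f H2.base = x := by
  have hx : star ((x : H2) 0) * (x : H2) 0 + star ((x : H2) 1) * (x : H2) 1 = 1 := by
    have h1 : hermForm (x : H2) x = 1 := by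
      have hr : (hermForm (x : H2) x).re = 1 := by
        rw [← H2.inner_eq, real_inner_self_eq_norm_sq, norm_eq_of_mem_sphere x, one_pow]
      have hk : (hermForm (x : H2) x).im = 0 := quatKaehler_self x
      rw [← Quaternion.re_add_im (hermForm (x : H2) x), hr, hk]
      simp
    exact h1
  obtain ⟨A, hA, h0, h1⟩ : ∃ A : Matrix (Fin 2) (Fin 2) ℍ, Aᴴ * A = 1 ∧ A 0 0 = (x : H2) 0 ∧
      A 1 0 = (x : H2) 1 := by
    set p := (x : H2) 0
    set q := (x : H2) 1
    by_cases hp : p = 0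
    · refine ⟨!![0, 1; q, 0], ?_, hp.symm, rfl⟩
      rw [hp, mul_zero, zero_add] at hx
      ext1 i j
      fin_cases i <;> fin_cases j <;> simp [Matrix.mul_apply, Fin.sum_univ_two, hx]
    · have hn : ‖p‖ ≠ 0 := norm_ne_zero_iff.2 hp
      refine ⟨!![p, -(‖p‖⁻¹ • (p * star q)); q, (‖p‖ : ℝ)], ?_, rfl, rfl⟩
      have hpp : star p * p = ((‖p‖ ^ 2 : ℝ) : ℍ) := by
        rw [Quaternion.star_mul_self, Quaternion.normSq_eq_norm_mul_self, sq]
      have hqq : q * star q = star q * q := by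
        rw [Quaternion.star_mul_self, Quaternion.self_mul_star]
      have hs : ‖p‖⁻¹ * ‖p‖ ^ 2 = ‖p‖ := by field_simp
      ext1 i j
      fin_cases i <;> fin_cases j <;> simp [Matrix.mul_apply, Fin.sum_univ_two]
      · exact hx
      · rw [← mul_assoc, hpp, Quaternion.coe_mul_eq_smul, Quaternion.mul_coe_eq_smul, smul_smul, hs,
          neg_add_cancel]
      · rw [mul_assoc, hpp, Quaternion.coe_mul_eq_smul, Quaternion.mul_coe_eq_smul, smul_smul, hs,
          neg_add_cancel]
      · rw [mul_assoc q, ← mul_assoc (star p), hpp, Quaternion.coe_mul_eq_smul, mul_smul_comm,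
          smul_smul, smul_smul, mul_assoc, hs, inv_mul_cancel₀ hn, one_smul, hqq,
          ← Quaternion.coe_mul, ← sq, ← hpp, add_comm, hx]
  obtain ⟨f, hf, hfv⟩ := mem_Sp2Sp1 hA (q := 1) (by simp)
  refine ⟨f, hf, Subtype.ext ?_⟩
  change f H2.base = x
  rw [hfv]
  ext1 i
  fin_cases i <;> simp [H2.base, Matrix.mulVec, dotProduct, h0, h1]

theorem sp2Form_frame_one (p : ℝ × ℝ) {b : Module.Basis (Fin 7) ℝ (Tan H2.base)}
    (hb : ∀ i, (b i : H2) = sp2Frame 1 1 i) :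
    sphereRestrict (sp2Form p) H2.base ![b 0, b 1, b 2] = p.1 ∧
      sphereRestrict (sp2Form p) H2.base ![b 0, b 3, b 4] = p.2 := by
  rw [sp2Form_frame p hb, sp2Form_frame p hb, show g2Tensor 0 1 2 = 1 by decide,
    show elem3 0 1 2 0 1 2 = 1 by decide, show g2Tensor 0 3 4 = 1 by decide,
    show elem3 0 1 2 0 3 4 = 0 by decide]
  simp

theorem sp2_family : InvariantFamily Sp2Sp1 H2.base sp2Form where
  finrank := H2.finrank
  transitive := Sp2Sp1_transitive
  contDiff := sp2Form_contDiff
  horizontal := sp2Form_horizontal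
  invariant p f hf y := sp2Form_invariant p hf y
  exhausts η hη := by
    obtain ⟨b, hb⟩ := exists_sp2Frame one_ne_zero one_ne_zero
    obtain ⟨p, h₀, h₁⟩ : ∃ p : ℝ × ℝ, η H2.base ![b 0, b 1, b 2] = p.1 ∧
      η H2.base ![b 0, b 3, b 4] = p.2 := ⟨(_, _), rfl, rfl⟩
    have h : ∀ f ∈ Sp2Sp1, spherePullback f (η - sphereRestrict (sp2Form p)) =
        η - sphereRestrict (sp2Form p) := fun f hf =>
      pullback_sub (hη f hf) (sp2Form_pullback p hf)
    have e := sp2Form_frame_one p hb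
    exact ⟨p, sub_eq_zero.1 (sp2_rigid h hb (sub_eq_zero.2 (h₀.trans e.1.symm))
      (sub_eq_zero.2 (h₁.trans e.2.symm)))⟩
  injective p q h := by
    obtain ⟨b, hb⟩ := exists_sp2Frame one_ne_zero one_ne_zero
    have e := sp2Form_frame_one p hb
    rw [h, (sp2Form_frame_one q hb).1, (sp2Form_frame_one q hb).2] at e
    exact Prod.ext e.1.symm e.2.symm

theorem sp2Form_standard {p : ℝ × ℝ} {s t : ℝ} (h₁ : p.1 * s ^ 3 = 1) (h₂ : p.2 * (s * t ^ 2) = 1)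
    {b : Module.Basis (Fin 7) ℝ (Tan H2.base)} (hb : ∀ i, (b i : H2) = sp2Frame s t i)
    (i j k : Fin 7) : sphereRestrict (sp2Form p) H2.base ![b i, b j, b k] = g2Tensor i j k := by
  rw [sp2Form_frame p hb, h₁, h₂]
  ring

theorem extDeriv_sp2Form (q : ℝ × ℝ) (x : H2) : extDeriv (sp2Form q) x =
    (q.1 + 3 * q.2) • extDeriv verticalForm x + (4 * q.2) • quatFourForm := by
  have h1 : DifferentiableAt ℝ verticalForm x := verticalForm_contDiff.differentiable (by simp) x
  have h2 : DifferentiableAt ℝ (fun y => quatFourForm.curryLeft y) x :=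
    (contDiff_curryLeft quatFourForm).differentiable (by simp) x
  have e : extDeriv (sp2Form q) x = extDeriv ((q.1 + 3 * q.2) • verticalForm +
    q.2 • fun y => quatFourForm.curryLeft y) x := rfl
  rw [e, extDeriv_add (h1.const_smul _) (h2.const_smul _), extDeriv_smul, extDeriv_smul,
    extDeriv_curryLeft, smul_smul, mul_comm q.2]

/-- `⋆d` on the family, in terms of the scaling of the frame. -/
theorem sp2_star {p : ℝ × ℝ} {s t : ℝ} (h₁ : p.1 * s ^ 3 = 1) (h₂ : p.2 * (s * t ^ 2) = 1)
    (q : ℝ × ℝ) :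
    sphereStar (sphereRestrict (sp2Form p)) 4 3 rfl (sphereD (sphereRestrict (sp2Form q))) =
      sphereRestrict (sp2Form (12 * q.2 * t ^ 4 / s ^ 3, 2 * (q.1 + q.2) * s)) := by
  have hs : s ≠ 0 := by rintro rfl; simp at h₁
  have ht : t ≠ 0 := by rintro rfl; simp at h₂
  obtain ⟨b, hb⟩ := exists_sp2Frame hs ht
  have std := sp2Form_standard h₁ h₂ hb
  obtain ⟨r, hr⟩ := sp2_family.exists_star_d (isPositive_of_frame std) q
  have e : ∀ σ : Perm (Fin 7), sphereRestrict (sp2Form r) H2.base ![b (σ 4), b (σ 5), b (σ 6)] =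
      (Perm.sign σ : ℝ) * ((q.1 + 3 * q.2) * extDeriv verticalForm H2.base
        ![sp2Frame s t (σ 0), sp2Frame s t (σ 1), sp2Frame s t (σ 2), sp2Frame s t (σ 3)] +
        4 * q.2 * quatFourForm
        ![sp2Frame s t (σ 0), sp2Frame s t (σ 1), sp2Frame s t (σ 2), sp2Frame s t (σ 3)]) := by
    intro σ
    have hv : (fun i => ((![b (σ 0), b (σ 1), b (σ 2), b (σ 3)] i : Tan H2.base) : H2)) =
        ![sp2Frame s t (σ 0), sp2Frame s t (σ 1), sp2Frame s t (σ 2), sp2Frame s t (σ 3)] := by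
      funext l
      fin_cases l <;> exact hb _
    rw [← hr, sphereStar_frame std, sphereD_restrict _ ((sp2Form_contDiff q).differentiable
      (by simp)), sphereRestrict_apply, extDeriv_sp2Form, hv]
    rfl
  -- even permutations of the indices that end in those of the component to be computed
  have e₁ := e ⟨![3, 4, 5, 6, 0, 1, 2], ![4, 5, 6, 0, 1, 2, 3], by decide, by decide⟩
  have e₂ := e ⟨![1, 2, 5, 6, 0, 3, 4], ![4, 0, 1, 5, 6, 2, 3], by decide, by decide⟩
  rw [show Perm.sign _ = (1 : ℤˣ) by decide, sp2Form_frame r hb] at e₁ e₂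
  have d := extDeriv_verticalForm_frame s t
  have c := quatFourForm_frame s t
  simp [g2Tensor, elem3, d, c] at e₁ e₂
  have hr' : r = (12 * q.2 * t ^ 4 / s ^ 3, 2 * (q.1 + q.2) * s) := by
    refine Prod.ext ?_ ?_
    · rw [eq_div_iff (pow_ne_zero 3 hs), e₁]
      ring
    · refine mul_right_cancel₀ (mul_ne_zero hs (pow_ne_zero 2 ht)) ?_
      rw [e₂]
      ring
  rw [hr, hr']

/-- The scaling that makes the frame standard, in terms of the cube root of the first
coefficient. -/
theorem exists_sp2_scale {p : ℝ × ℝ} (hp : 0 < p.1 * p.2) :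
    ∃ τ t : ℝ, τ ≠ 0 ∧ 0 < t ∧ cubeEquiv.symm p.1 = τ ∧ p.1 * τ⁻¹ ^ 3 = 1 ∧
      p.2 * (τ⁻¹ * t ^ 2) = 1 := by
  obtain ⟨τ, h⟩ : ∃ τ, cubeEquiv.symm p.1 = τ := ⟨_, rfl⟩
  have hτ3 : τ ^ 3 = p.1 := by rw [← h, cubeEquiv_symm_pow]
  have hτ : τ ≠ 0 := by
    rintro rfl
    simp [← hτ3] at hp
  have hb : p.2 ≠ 0 := by intro h0; simp [h0] at hp
  have hq : 0 < τ / p.2 := by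
    have : τ / p.2 = p.1 * p.2 / (τ * p.2) ^ 2 := by
      rw [← hτ3]
      field_simp
    rw [this]
    positivity
  refine ⟨τ, √(τ / p.2), hτ, Real.sqrt_pos.2 hq, h, ?_, ?_⟩
  · rw [← hτ3]
    field_simp
  · rw [Real.sq_sqrt hq.le]
    field_simp

/-- If the parameters have opposite signs, then scaling the frame leaves the standard form with the
signs of all terms but `e⁰¹²` reversed, whose induced bilinear form is indefinite. -/
theorem sp2_isPositive_iff (p : ℝ × ℝ) : IsPositive (sphereRestrict (sp2Form p) H2.base) ↔
    p ∈ {p : ℝ × ℝ | 0 < p.1 * p.2} := by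
  have hs : ∀ {a : ℝ}, a ≠ 0 → a * cubeEquiv.symm a⁻¹ ^ 3 = 1 := fun ha => by
    rw [cubeEquiv_symm_pow, mul_inv_cancel₀ ha]
  have hs0 : ∀ {a : ℝ}, a ≠ 0 → cubeEquiv.symm a⁻¹ ≠ 0 := fun ha h0 => by
    simpa [h0] using hs ha
  constructor
  · intro h
    by_contra hp
    change ¬ 0 < p.1 * p.2 at hp
    revert h
    by_cases ha : p.1 = 0
    · by_cases hb : p.2 = 0
      · obtain ⟨b, hb'⟩ := exists_sp2Frame one_ne_zero one_ne_zero
        refine not_isPositive_of_frame (b := b) (fun _ _ _ => 0) (fun i j k => ?_) 0 0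
          (by decide +kernel)
        rw [sp2Form_frame p hb', ha, hb]
        simp
      · obtain ⟨b, hb'⟩ := exists_sp2Frame (inv_ne_zero hb) one_ne_zero
        refine not_isPositive_of_frame (b := b)
          (fun i j k => g2Tensor i j k - elem3 0 1 2 i j k) (fun i j k => ?_) 0 0
          (by decide +kernel)
        rw [sp2Form_frame p hb', ha]
        simp [hb]
    · by_cases hb : p.2 = 0
      · obtain ⟨b, hb'⟩ := exists_sp2Frame (hs0 ha) one_ne_zero
        refine not_isPositive_of_frame (b := b) (elem3 0 1 2) (fun i j k => ?_) 3 3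
          (by decide +kernel)
        rw [sp2Form_frame p hb', hb, hs ha]
        simp
      · set s := cubeEquiv.symm p.1⁻¹ with hsd
        have h1 : p.1 * s ^ 3 = 1 := hs ha
        have hs' : s ≠ 0 := hs0 ha
        have h2 : p.2 * s < 0 := by
          have h3 : p.1 * p.2 < 0 := lt_of_le_of_ne (not_lt.1 hp) (mul_ne_zero ha hb)
          have h4 : p.2 * s * (p.1 * s) ^ 2 = p.1 * p.2 := by
            linear_combination p.1 * p.2 * h1
          by_contra h5
          have : 0 ≤ p.2 * s * (p.1 * s) ^ 2 := mul_nonneg (not_lt.1 h5) (sq_nonneg _)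
          linarith
        have h6 : 0 < -(p.2 * s)⁻¹ := neg_pos.2 (inv_lt_zero.2 h2)
        have h7 : p.2 * (s * √(-(p.2 * s)⁻¹) ^ 2) = -1 := by
          rw [Real.sq_sqrt h6.le]
          field_simp
        obtain ⟨b, hb'⟩ := exists_sp2Frame hs' (Real.sqrt_pos.2 h6).ne'
        refine not_isPositive_of_frame (b := b)
          (fun i j k => 2 * elem3 0 1 2 i j k - g2Tensor i j k) (fun i j k => ?_) 0 3
          (by decide +kernel)
        rw [sp2Form_frame p hb', h1, h7]
        push_cast
        ring
  · intro hp
    obtain ⟨τ, t, hτ, ht, -, h₁, h₂⟩ := exists_sp2_scale hp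
    obtain ⟨b, hb⟩ := exists_sp2Frame (inv_ne_zero hτ) ht.ne'
    exact isPositive_of_frame (sp2Form_standard h₁ h₂ hb)

/-- The `G₂`-Laplacian on the family. -/
def sp2Laplacian (p : ℝ × ℝ) : ℝ × ℝ :=
  (24 * (p.1 + p.2) * cubeEquiv.symm p.1 ^ 4 / p.2 ^ 2,
    24 * cubeEquiv.symm p.1 ^ 4 / p.2 + 4 * (p.1 + p.2) / cubeEquiv.symm p.1 ^ 2)

theorem sp2Laplacian_cube {τ m : ℝ} (hτ : τ ≠ 0) (hm : 0 < m) :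
    sp2Laplacian (τ ^ 3, m * τ ^ 3) = (τ * (24 * (1 + m) / m ^ 2),
      τ * (24 * (1 + m) / m ^ 2) * (m / (1 + m) + m ^ 2 / 6)) := by
  have h : cubeEquiv.symm (τ ^ 3) = τ := cubeEquiv.symm_apply_apply τ
  refine Prod.ext ?_ ?_
  · simp only [sp2Laplacian, h]
    field_simp
  · simp only [sp2Laplacian, h]
    field_simp
    ring

/-- The coordinates `τ`, `m` on the set of parameters of positive forms. -/
theorem exists_cube_ratio {p : ℝ × ℝ} (hp : 0 < p.1 * p.2) :
    ∃ τ m : ℝ, τ ≠ 0 ∧ 0 < m ∧ p = (τ ^ 3, m * τ ^ 3) := by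
  obtain ⟨τ, t, hτ, ht, -, h₁, h₂⟩ := exists_sp2_scale hp
  have h3 : p.1 = τ ^ 3 := by
    field_simp at h₁
    exact h₁
  refine ⟨τ, p.2 / τ ^ 3, hτ, ?_, Prod.ext h3 (by field_simp)⟩
  have : p.2 / τ ^ 3 = p.1 * p.2 / (τ ^ 3) ^ 2 := by
    rw [h3]
    field_simp
  rw [this]
  positivity

/-- In the coordinates `a = τ³`, `b = m τ³` the ratio of the components of the Laplacian is an
increasing function of `m` alone, with range `(0, ∞)`. -/
theorem sp2Laplacian_bijOn :
    BijOn sp2Laplacian {p : ℝ × ℝ | 0 < p.1 * p.2} {p : ℝ × ℝ | 0 < p.1 * p.2} := by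
  refine ⟨fun p hp => ?_, fun p hp p' hp' h => ?_, fun p hp => ?_⟩
  · obtain ⟨τ, m, hτ, hm, rfl⟩ := exists_cube_ratio hp
    rw [sp2Laplacian_cube hτ hm]
    change 0 < τ * _ * (τ * _ * _)
    rw [← mul_assoc, ← sq]
    positivity
  · obtain ⟨τ, m, hτ, hm, rfl⟩ := exists_cube_ratio hp
    obtain ⟨τ', m', hτ', hm', rfl⟩ := exists_cube_ratio hp'
    rw [sp2Laplacian_cube hτ hm, sp2Laplacian_cube hτ' hm', Prod.mk.injEq] at h
    have hmm : m = m' := by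
      have h1 : m / (1 + m) + m ^ 2 / 6 = m' / (1 + m') + m' ^ 2 / 6 := by
        have h2 := h.2
        rw [← h.1] at h2
        exact mul_left_cancel₀ (by positivity) h2
      have hlt : ∀ {x y : ℝ}, 0 < x → x < y →
          x / (1 + x) + x ^ 2 / 6 < y / (1 + y) + y ^ 2 / 6 := fun {x y} hx hxy => by
        have h3 : x / (1 + x) < y / (1 + y) := by
          rw [div_lt_div_iff₀ (by linarith) (by linarith)]
          linarith
        have h4 : x ^ 2 < y ^ 2 := pow_lt_pow_left₀ hxy hx.le two_ne_zero
        linarith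
      rcases lt_trichotomy m m' with hlt' | heq | hlt'
      · exact absurd h1 (hlt hm hlt').ne
      · exact heq
      · exact absurd h1 (hlt hm' hlt').ne'
    subst hmm
    rw [mul_right_cancel₀ (by positivity) h.1]
  · obtain ⟨a, b⟩ := p
    change 0 < a * b at hp
    have ha : a ≠ 0 := by rintro rfl; simp at hp
    have hr : 0 < b / a := by
      have : b / a = a * b / a ^ 2 := by field_simp
      rw [this]
      positivity
    obtain ⟨m, hm, hm'⟩ : ∃ m : ℝ, 0 < m ∧ m / (1 + m) + m ^ 2 / 6 = b / a := by
      have hM : (0 : ℝ) ≤ 1 + 6 * (b / a) := by positivity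
      have hc : ContinuousOn (fun m : ℝ => m / (1 + m) + m ^ 2 / 6) (Icc 0 (1 + 6 * (b / a))) := by
        refine (continuousOn_id.div (by fun_prop) fun x hx => ?_).add (by fun_prop)
        linarith [hx.1]
      obtain ⟨m, hm, hm'⟩ := intermediate_value_Icc hM hc (show b / a ∈ Icc _ _ by
        refine ⟨by simpa using hr.le, ?_⟩
        have : 0 ≤ (1 + 6 * (b / a)) / (1 + (1 + 6 * (b / a))) := by positivity
        change b / a ≤ _ + _
        nlinarith)
      refine ⟨m, lt_of_le_of_ne hm.1 ?_, hm'⟩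
      rintro rfl
      simp at hm'
      exact hr.ne hm'
    have hτ : a * m ^ 2 / (24 * (1 + m)) ≠ 0 := by positivity
    refine ⟨_, ?_, (sp2Laplacian_cube hτ hm).trans ?_⟩
    · change 0 < _ * (m * _)
      rw [mul_left_comm, ← sq]
      positivity
    · have e : a * m ^ 2 / (24 * (1 + m)) * (24 * (1 + m) / m ^ 2) = a := by field_simp
      rw [e, hm']
      refine Prod.ext rfl ?_
      change a * (b / a) = b
      field_simp

theorem g2Laplacian_bijOn_Sp2Sp1 :
    BijOn g2Laplacian (positiveInvariantForms Sp2Sp1) (positiveInvariantForms Sp2Sp1) ∧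
      (∀ φ ∈ positiveInvariantForms Sp2Sp1, SameOrientation φ (g2Laplacian φ)) ∧
      ∀ μ ∈ positiveInvariantForms Sp2Sp1,
        ∃! φ, φ ∈ positiveInvariantForms Sp2Sp1 ∧ g2Laplacian φ = μ := by
  refine sp2_family.g2Laplacian_bijOn sp2Laplacian {p | 0 < p.1 * p.2} sp2_isPositive_iff
    (fun p hp => ?_) sp2Laplacian_bijOn fun p hp => ?_
  · obtain ⟨τ, t, hτ, ht, hp₁, h₁, h₂⟩ := exists_sp2_scale hp
    have hb : p.2 ≠ 0 := by intro h; simp [h] at h₂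
    have ht2 : t ^ 2 = τ / p.2 := by
      field_simp at h₂ ⊢
      linarith
    have ht4 : t ^ 4 = (τ / p.2) ^ 2 := by rw [← ht2]; ring
    refine ⟨_, (p.2 * τ / 2 - p.2 ^ 2 / (12 * τ ^ 2), p.2 ^ 2 / (12 * τ ^ 2)), sp2_star h₁ h₂ p,
      ?_, ?_⟩
    · rw [sp2_star h₁ h₂]
      congr 2
      refine Prod.ext ?_ ?_
      · simp only [sp2Laplacian, hp₁, ht4]
        field_simp
        ring
      · simp only [sp2Laplacian, hp₁, ht4]
        field_simp
        ring
    · rw [sp2_star h₁ h₂]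
      congr 2
      have h3 : p.1 = τ ^ 3 := by
        field_simp at h₁
        exact h₁
      refine Prod.ext ?_ ?_
      · simp only [ht4, h3]
        field_simp
      · simp only
        field_simp
        ring
  · obtain ⟨τ, t, hτ, ht, hp₁, h₁, h₂⟩ := exists_sp2_scale hp
    obtain ⟨τ', t', hτ', ht', -, h₁', h₂'⟩ := exists_sp2_scale (sp2Laplacian_bijOn.mapsTo hp)
    obtain ⟨b, hb⟩ := exists_sp2Frame (inv_ne_zero hτ) ht.ne'
    obtain ⟨b', hb'⟩ := exists_sp2Frame (inv_ne_zero hτ') ht'.ne'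
    have hpos : 0 < τ' / τ := by
      obtain ⟨σ, m, hσ, hm, hpe⟩ := exists_cube_ratio hp
      have hσe : σ = τ := by
        rw [← hp₁, hpe]
        exact (cubeEquiv.symm_apply_apply σ).symm
      rw [hpe, sp2Laplacian_cube hσ hm, hσe] at h₁'
      have h3 : (τ' / τ) ^ 3 = 24 * (1 + m) / m ^ 2 / τ ^ 2 := by
        field_simp at h₁' ⊢
        linarith
      refine (Odd.pow_pos_iff (n := 3) (by decide)).1 ?_
      rw [h3]
      positivity
    refine exists_inducedVolume_smul (sp2Form_standard h₁ h₂ hb) (sp2Form_standard h₁' h₂' hb')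
      (fun i => if i < 3 then τ' / τ else t / t') (fun i => ?_) fun i => Subtype.ext ?_
    · split_ifs
      exacts [hpos, div_pos ht ht']
    · rw [Submodule.coe_smul, hb, hb']
      ext1 j
      ext <;> simp only [PiLp.smul_apply, Quaternion.re_smul, Quaternion.imI_smul,
        Quaternion.imJ_smul, Quaternion.imK_smul, smul_eq_mul] <;>
      fin_cases i <;> fin_cases j <;> simp [sp2Frame] <;> field_simp

end Sp2Sp1

theorem theorem1 :
    (BijOn g2Laplacian (positiveInvariantForms SU4) (positiveInvariantForms SU4) ∧
      (∀ φ ∈ positiveInvariantForms SU4, SameOrientation φ (g2Laplacian φ)) ∧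
      ∀ μ ∈ positiveInvariantForms SU4,
        ∃! φ, φ ∈ positiveInvariantForms SU4 ∧ g2Laplacian φ = μ) ∧
    (BijOn g2Laplacian (positiveInvariantForms Spin7) (positiveInvariantForms Spin7) ∧
      (∀ φ ∈ positiveInvariantForms Spin7, SameOrientation φ (g2Laplacian φ)) ∧
      ∀ μ ∈ positiveInvariantForms Spin7,
        ∃! φ, φ ∈ positiveInvariantForms Spin7 ∧ g2Laplacian φ = μ) ∧
    (BijOn g2Laplacian (positiveInvariantForms Sp2Sp1) (positiveInvariantForms Sp2Sp1) ∧
      (∀ φ ∈ positiveInvariantForms Sp2Sp1, SameOrientation φ (g2Laplacian φ)) ∧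
      ∀ μ ∈ positiveInvariantForms Sp2Sp1,
        ∃! φ, φ ∈ positiveInvariantForms Sp2Sp1 ∧ g2Laplacian φ = μ) :=
  ⟨g2Laplacian_bijOn_SU4, g2Laplacian_bijOn_Spin7, g2Laplacian_bijOn_Sp2Sp1⟩

end
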